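/- **Setting.** A principal screens an agent. The allocation space $\mathcal X$ is a compact metric space containing an outside option $\varnothing$. The agent's type $t\in\mathcal T=[\underline t,\overline t]$, $\underline t<\overline t$, has a continuously differentiable distribution function $F$ with density $f>0$ on $\mathcal T$. The agent's payoff is $v(x,t)-p$, where $v$ is continuous on $\mathcal X\times\mathcal T$ and differentiable in $t$ with $v_t$ continuous on $\mathcal X\times\mathcal T$, $v(\varnothing,\cdot)=0$, and $v(x,\cdot)$ is strictly increasing for every $x\neq\varnothing$. For a lottery $a\in\Delta(\mathcal X)$ (a Borel probability measure) put $v(a,t)=\mathbb E_{x\sim a}[v(x,t)]$. A (stochastic) mechanism is a measurable map $(x,p):\mathcal T\to\mathcal X\times\mathbb R$ (respectively into $\Delta(\mathcal X)\times\mathbb R$) with $v(x(t),t)-p(t)\ge v(x(\hat t),t)-p(\hat t)$ and $v(x(t),t)-p(t)\ge 0$ for all $t,\hat t\in\mathcal T$. The principal maximizes $\mathbb E[\lambda(t)(v(x(t),t)-p(t))+p(t)]$, where $\lambda\ge 0$ is continuous and non-increasing with $\mathbb E[\lambda(t)]\le 1$. A menu $\mathcal Y\ni\varnothing$ is *optimal*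 (*optimal among stochastic mechanisms*) if some deterministic mechanism $(x,p)$ with $x(t)\in\mathcal Y$ for all $t$ attains at least the objective value of every mechanism (of every stochastic mechanism). **Definitions.** The demand curve of $x$ is $P(x,q)=v(x,F^{-1}(1-q))$, $q\in[0,1]$, and $P(a,q)=\mathbb E_{x\sim a}[P(x,q)]$ for a lottery $a$. A function $g$ on $[0,1]$ weakly single-crosses $h$ from below at $k$ if $g\le h$ on $[0,k]$ and $g\ge h$ on $[k,1]$. An allocation $x$ is *covered* by a set $\mathcal A$ of lotteries if for every $q\in[0,1]$ there is $a\in\mathcal A$ such that $P(a,\cdot)$ weakly single-crosses $P(x,\cdot)$ from below at $q$. A Borel set $\mathcal X^\star\subseteq\mathcal X$ is a *generalized frontier* if there are a total order $\preceq$ on $\mathcal X^\star$ and a weakly compact set $\mathcal A\subseteq\Delta(\mathcal X^\star)$, totally ordered by the stochastic dominance order induced by $\preceq$ ($a\preceq_{\rm st}a'$ iff $\mathbb E_a[h]\le\mathbb E_{a'}[h]$ for all bounded measurable $\preceq$-monotone $h:\mathcal X^\star\to\mathbb R$), such that (i) every $x\in\mathcal X\setminus\{\varnothing\}$ is covered by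 $\mathcal A$; (ii) $P(x',q)-P(x,q)$ is strictly decreasing in $q\in[0,1]$ for all $x\prec x'$ in $\mathcal X^\star$. Write $x\prec_{\rm surplus}x'$ if $P(x,q)\le P(x',q)$ for all $q\in[0,1]$, strictly for $q\in(0,1)$; in that case the incremental elasticity is $\eta(x',q\mid x)=\left|\frac{d\log(P(x',q)-P(x,q))}{d\log q}\right|^{-1}\in(0,\infty]$ for $q\in(0,1)$. **Theorem.** Let $\mathcal X^\star$ be a generalized frontier. Then the menu $\mathcal X^\star\cup\{\varnothing\}$ is optimal. If, moreover, $\mathcal X^\star\cup\{\varnothing\}=\{x_s\}_{s\in S}$ for some $S\subseteq\mathbb R$ with $x_s\prec_{\rm surplus}x_{s'}$ for all $s<s'$ in $S$, and $\eta(x_{s_2},q\mid x_{s_1})>\eta(x_{s_3},q\mid x_{s_2})$ for all $s_1<s_2<s_3$ in $S$ and all $q\in(0,1)$, then $\mathcal X^\star\cup\{\varnothing\}$ is optimal among stochastic mechanisms. -/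

import Mathlib

open MeasureTheory Set
open scoped ENNReal

/-- A screening problem on the allocation space `X`, a compact metric space that already
includes the outside option `out`.  Types lie in `[tlo, thi]`; functions of the type are
functions on `ℝ` of which only the values on `[tlo, thi]` matter. -/
structure ScreeningModel (X : Type*) [MetricSpace X] where
  /-- lowest type -/
  tlo : ℝ
  /-- highest type -/
  thi : ℝ
  tlo_lt_thi : tlo < thi
  /-- cumulative distribution function of the type -/
  F : ℝ → ℝ
  /-- density of the type -/
  f : ℝ → ℝ
  hasDeriv_F : ∀ t ∈ Icc tlo thi, HasDerivWithinAt F (f t) (Icc tlo thi) t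
  continuousOn_f : ContinuousOn f (Icc tlo thi)
  f_pos : ∀ t ∈ Icc tlo thi, 0 < f t
  F_tlo : F tlo = 0
  F_thi : F thi = 1
  /-- welfare weights -/
  lam : ℝ → ℝ
  continuousOn_lam : ContinuousOn lam (Icc tlo thi)
  lam_nonneg : ∀ t ∈ Icc tlo thi, 0 ≤ lam t
  lam_antitone : AntitoneOn lam (Icc tlo thi)
  lam_mean : ∫ t in Icc tlo thi, lam t * f t ≤ 1
  /-- outside option -/
  out : X
  /-- value of an allocation to a type -/
  v : X → ℝ → ℝ
  /-- partial derivative of `v` in the type -/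
  vt : X → ℝ → ℝ
  v_out : ∀ t ∈ Icc tlo thi, v out t = 0
  v_strictMono : ∀ x, x ≠ out → StrictMonoOn (v x) (Icc tlo thi)
  hasDeriv_v : ∀ x, ∀ t ∈ Icc tlo thi, HasDerivWithinAt (v x) (vt x t) (Icc tlo thi) t
  continuousOn_vt : ContinuousOn (fun z : X × ℝ => vt z.1 z.2) (univ ×ˢ Icc tlo thi)
  continuousOn_v : ContinuousOn (fun z : X × ℝ => v z.1 z.2) (univ ×ˢ Icc tlo thi)

/-- `g` weakly single-crosses `h` from below at `k` (functions of the quantity in `[0, 1]`). -/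
def WeaklySingleCrossesFromBelow (g h : ℝ → ℝ) (k : ℝ) : Prop :=
  (∀ s ∈ Icc (0 : ℝ) 1, s ≤ k → g s ≤ h s) ∧ (∀ s ∈ Icc (0 : ℝ) 1, k ≤ s → h s ≤ g s)

/-- Stochastic dominance between lotteries on an ordered space: every (bounded, measurable)
monotone function has a weakly smaller expectation under `a` than under `a'`. -/
def StochasticLE {Y : Type*} [MeasurableSpace Y] [LinearOrder Y]
    (a a' : ProbabilityMeasure Y) : Prop :=
  ∀ h : Y → ℝ, Monotone h → Measurable h → (∃ C : ℝ, ∀ y, |h y| ≤ C) →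
    ∫ y, h y ∂(a : Measure Y) ≤ ∫ y, h y ∂(a' : Measure Y)

namespace ScreeningModel

noncomputable section

variable {X : Type*} [MetricSpace X] (M : ScreeningModel X)

/-- The type space. -/
def types : Set ℝ := Icc M.tlo M.thi

/-- The inverse of the distribution function, `F⁻¹ : [0, 1] → [tlo, thi]`. -/
def quantile (u : ℝ) : ℝ := Function.invFunOn M.F M.types u

/-- The demand curve `P(x, q) = v(x, F⁻¹(1 - q))`. -/
def demand (x : X) (q : ℝ) : ℝ := M.v x (M.quantile (1 - q))

/-- The demand curve of a lottery on a set `Y` of allocations: the pointwise mixture. -/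
def lotteryDemand [MeasurableSpace X] {Y : Set X} (a : ProbabilityMeasure Y) (q : ℝ) : ℝ :=
  ∫ y : Y, M.demand (y : X) q ∂(a : Measure Y)

/-- `x` is covered by the family `A` of lotteries. -/
def Covered [MeasurableSpace X] {Y : Set X} (A : Set (ProbabilityMeasure Y)) (x : X) : Prop :=
  ∀ q ∈ Icc (0 : ℝ) 1, ∃ a ∈ A,
    WeaklySingleCrossesFromBelow (M.lotteryDemand a) (M.demand x) q

/-- Generalized frontier.  `ProbabilityMeasure Y` carries the topology of weak convergence.
The outside option may or may not be listed in `Y`, and need not be covered. -/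
def IsGeneralizedFrontier [MeasurableSpace X] [BorelSpace X] (Y : Set X) : Prop :=
  MeasurableSet Y ∧ ∃ _ : LinearOrder Y, ∃ A : Set (ProbabilityMeasure Y),
    IsCompact A ∧
    (∀ a ∈ A, ∀ a' ∈ A, StochasticLE a a' ∨ StochasticLE a' a) ∧
    (∀ x : X, x ≠ M.out → M.Covered A x) ∧
    (∀ x x' : Y, x < x' →
      StrictAntiOn (fun q => M.demand (x' : X) q - M.demand (x : X) q) (Icc (0 : ℝ) 1))

/-- Strict surplus order: `P(x, q) < P(x', q)` for all `q ∈ (0, 1)` (and weakly on `[0, 1]`). -/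
def SurplusLT (x x' : X) : Prop :=
  (∀ q ∈ Icc (0 : ℝ) 1, M.demand x q ≤ M.demand x' q) ∧
    ∀ q ∈ Ioo (0 : ℝ) 1, M.demand x q < M.demand x' q

/-- The incremental elasticity `|d log P(x', q | x) / d log q|⁻¹` of `x'` over `x`, where
`P(x', q | x) = P(x', q) - P(x, q)`; it is `∞` where the derivative vanishes. -/
def incrElasticity (x' x : X) (q : ℝ) : ℝ≥0∞ :=
  (ENNReal.ofReal |q * deriv (fun r => Real.log (M.demand x' r - M.demand x r)) q|)⁻¹

/-- The menu `Y` can be indexed by a set `S` of reals so that demand curves are strictly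
increasing in the index in the surplus order, and incremental elasticities are ordered. -/
def SurplusOrderedIncrElasticity (Y : Set X) : Prop :=
  ∃ (S : Set ℝ) (x : ℝ → X), x '' S = Y ∧
    (∀ s₁ ∈ S, ∀ s₂ ∈ S, s₁ < s₂ → M.SurplusLT (x s₁) (x s₂)) ∧
    (∀ s₁ ∈ S, ∀ s₂ ∈ S, ∀ s₃ ∈ S, s₁ < s₂ → s₂ < s₃ → ∀ q ∈ Ioo (0 : ℝ) 1,
      M.incrElasticity (x s₃) (x s₂) q < M.incrElasticity (x s₂) (x s₁) q)

/-- Incentive compatible and individually rational deterministic direct mechanisms. -/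
structure IsMechanism [MeasurableSpace X] (x : ℝ → X) (p : ℝ → ℝ) : Prop where
  measurable_x : Measurable (fun t : M.types => x t)
  measurable_p : Measurable (fun t : M.types => p t)
  ic : ∀ t ∈ M.types, ∀ s ∈ M.types, M.v (x s) t - p s ≤ M.v (x t) t - p t
  ir : ∀ t ∈ M.types, 0 ≤ M.v (x t) t - p t

/-- The principal's objective `E[λ(t) (v(x(t), t) - p(t))] + E[p(t)]`. -/
def objective (x : ℝ → X) (p : ℝ → ℝ) : ℝ :=
  ∫ t in M.types, (M.lam t * (M.v (x t) t - p t) + p t) * M.f t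

/-- Expected value of a lottery to type `t`. -/
def lotteryValue [MeasurableSpace X] (a : ProbabilityMeasure X) (t : ℝ) : ℝ :=
  ∫ y, M.v y t ∂(a : Measure X)

/-- Incentive compatible and individually rational stochastic direct mechanisms. -/
structure IsStochasticMechanism [MeasurableSpace X]
    (a : ℝ → ProbabilityMeasure X) (p : ℝ → ℝ) : Prop where
  measurable_a : Measurable (fun t : M.types => (a t : Measure X))
  measurable_p : Measurable (fun t : M.types => p t)
  ic : ∀ t ∈ M.types, ∀ s ∈ M.types,
    M.lotteryValue (a s) t - p s ≤ M.lotteryValue (a t) t - p t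
  ir : ∀ t ∈ M.types, 0 ≤ M.lotteryValue (a t) t - p t

/-- The principal's objective under a stochastic mechanism. -/
def stochasticObjective [MeasurableSpace X] (a : ℝ → ProbabilityMeasure X) (p : ℝ → ℝ) : ℝ :=
  ∫ t in M.types, (M.lam t * (M.lotteryValue (a t) t - p t) + p t) * M.f t

/-- `Y` is an optimal menu: some optimal mechanism only uses allocations in `Y`. -/
def IsOptimalMenu [MeasurableSpace X] (Y : Set X) : Prop :=
  ∃ (x : ℝ → X) (p : ℝ → ℝ), M.IsMechanism x p ∧ (∀ t ∈ M.types, x t ∈ Y) ∧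
    ∀ (x' : ℝ → X) (p' : ℝ → ℝ), M.IsMechanism x' p' → M.objective x' p' ≤ M.objective x p

/-- `Y` is optimal among stochastic mechanisms: some deterministic mechanism that only uses
allocations in `Y` does at least as well as every stochastic mechanism. -/
def IsStochasticallyOptimalMenu [MeasurableSpace X] (Y : Set X) : Prop :=
  ∃ (x : ℝ → X) (p : ℝ → ℝ), M.IsMechanism x p ∧ (∀ t ∈ M.types, x t ∈ Y) ∧
    ∀ (a : ℝ → ProbabilityMeasure X) (p' : ℝ → ℝ), M.IsStochasticMechanism a p' →
      M.stochasticObjective a p' ≤ M.objective x p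

end

end ScreeningModel

/-! Measure the steepness of an allocation by `kap x`, the difference of its values to the highest
and the lowest type. Condition (ii) makes steepness strictly increasing along the order of the menu,
and a steeper menu item has larger increments over every interval of types. Stochastic dominance
therefore becomes `SteeperLE`, and the outside option, of steepness zero, joins the menu and the
chain `A` of covering lotteries at the bottom. A deterministic rule of increasing steepness is
implementable, and with zero rent at the bottom it is worth its virtual surplus `∫ (v f - G vₜ)`.
Here `G t = ∫_t^hi (1 - λ) f` is nonnegative, because `λ` is non-increasing with mean at most one.

Upper bound. Keep only the downward incentive constraints. A lottery that covers `x(t)` at `t` has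
the same value to type `t` and no larger value to higher types, so substituting it preserves both
the surplus and these constraints. The substituted rule need not be monotone. On a finite grid,
however, an inversion between neighbours can be removed by giving both types one of the two
allocations (`monotone_of_max_downwardIC`). Refining the grid bounds every mechanism by the virtual
surplus of monotone rules with values in `A` (`exists_monotone_rule`).

Determinism. A monotone rule in lotteries is the average of its steepness quantiles, which are
deterministic monotone rules on the menu, so one quantile does at least as well
(`exists_deterministic_rule`). Covering that quantile leads back to `A`
(`integral_le_of_virtual_le`), so nothing is lost either way. The quantile is monotone only almost
everywhere and the menu need not be closed, so it cannot simply be completed to a mechanism. A small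
cost, strictly concave in steepness, forces the optimal quantile onto point masses that belong to
`A` (`exists_degenerate_rule_ge`). These form a compact set, on which Helly's theorem gives a
maximiser defined at every type (`exists_max_virtual`).

Stochastic mechanisms. The elasticity condition says that ratios of successive increments of value
increase in the type. For two types `t < t'`, the points `(v(x, t), v(x, t'))` of the relevant menu
items then lie on a convex curve. Any finite lottery on the menu is dominated, for downward
constraints, by a mixture of two neighbours on that curve (`IsFrontier.exists_mix`), and such
mixtures form a chain. The upper bound, the quantile argument and the covering argument then apply
again. -/

/-! ### The discrete relaxed problem and the exchange argument -/

/-- Allocations `b` and utilities `u` of the types `0, …, n - 1` satisfying the downward incentive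
constraints, with utilities in `[0, K]`. -/
def DownwardIC {ι : Type*} (n : ℕ) (w : ι → ℕ → ℝ) (K : ℝ) (b : ℕ → ι) (u : ℕ → ℝ) : Prop :=
  (∀ i, u i ∈ Icc 0 K) ∧ ∀ i j, i < j → j < n → w (b i) j - w (b i) i ≤ u j - u i

/-- The discrete relaxed objective. -/
def discreteObjective {ι : Type*} (n : ℕ) (μ lam : ℕ → ℝ) (S : ι → ℕ → ℝ) (b : ℕ → ι)
    (u : ℕ → ℝ) : ℝ :=
  ∑ i ∈ Finset.range n, μ i * (S (b i) i - (1 - lam i) * u i)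

/-- With finitely many allocations and utilities confined to `[0, K]`, the feasible set is closed in
a Tychonoff product. The given pair `(c, u)` shows that it is nonempty. -/
lemma exists_max_downwardIC {ι : Type*} [TopologicalSpace ι] [DiscreteTopology ι] [Finite ι]
    (n : ℕ) (μ lam : ℕ → ℝ) (w S : ι → ℕ → ℝ) (K : ℝ) (c : ℕ → ι) (u : ℕ → ℝ)
    (h : DownwardIC n w K c u) :
    ∃ b u', DownwardIC n w K b u' ∧ ∀ b₂ u₂, DownwardIC n w K b₂ u₂ →
      discreteObjective n μ lam S b₂ u₂ ≤ discreteObjective n μ lam S b u' := by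
  have hcomp : IsCompact {p : (ℕ → ι) × (ℕ → ℝ) | DownwardIC n w K p.1 p.2} := by
    have h1 : IsCompact ((univ : Set (ℕ → ι)) ×ˢ (univ.pi fun _ : ℕ => Icc (0 : ℝ) K)) :=
      isCompact_univ.prod (isCompact_univ_pi fun _ => isCompact_Icc)
    refine h1.of_isClosed_subset ?_ ?_
    · have : {p : (ℕ → ι) × (ℕ → ℝ) | DownwardIC n w K p.1 p.2} =
          (⋂ i, {p : (ℕ → ι) × (ℕ → ℝ) | p.2 i ∈ Icc 0 K}) ∩
          ⋂ i, ⋂ j, ⋂ (_ : i < j), ⋂ (_ : j < n),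
            {p : (ℕ → ι) × (ℕ → ℝ) | w (p.1 i) j - w (p.1 i) i ≤ p.2 j - p.2 i} := by
        ext p; simp [DownwardIC]
      rw [this]
      refine IsClosed.inter ?_ ?_
      · refine isClosed_iInter fun i => ?_
        exact isClosed_Icc.preimage (by fun_prop : Continuous fun p : (ℕ → ι) × (ℕ → ℝ) => p.2 i)
      · refine isClosed_iInter fun i => isClosed_iInter fun j => isClosed_iInter fun _ =>
          isClosed_iInter fun _ => isClosed_le ?_ (by fun_prop)
        have h2 : Continuous fun x : ι => w x j - w x i := continuous_of_discreteTopology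
        exact h2.comp ((continuous_apply i).comp continuous_fst)
    · rintro p hp
      exact ⟨mem_univ _, fun i _ => hp.1 i⟩
  have hcont : Continuous fun p : (ℕ → ι) × (ℕ → ℝ) => discreteObjective n μ lam S p.1 p.2 := by
    unfold discreteObjective
    refine continuous_finsetSum _ fun i _ => ?_
    have h2 : Continuous fun x : ι => S x i := continuous_of_discreteTopology
    have h3 : Continuous fun p : (ℕ → ι) × (ℕ → ℝ) => S (p.1 i) i :=
      h2.comp ((continuous_apply i).comp continuous_fst)
    fun_prop
  obtain ⟨p, hp, hmax⟩ := hcomp.exists_isMaxOn ⟨(c, u), h⟩ hcont.continuousOn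
  exact ⟨p.1, p.2, hp, fun b₂ u₂ h₂ => hmax (a := (b₂, u₂)) h₂⟩

/-- A maximiser of the discrete relaxed problem is monotone when the surplus is strictly
supermodular. -/
lemma monotone_of_max_downwardIC {ι : Type*} (n : ℕ) (μ lam : ℕ → ℝ) (w S : ι → ℕ → ℝ)
    (rank : ι → ℝ) (K : ℝ) (hμ : ∀ i < n, 0 < μ i)
    (hlam : ∀ i j, i ≤ j → j < n → lam j ≤ lam i)
    (hw : ∀ c, ∀ i j, i ≤ j → j < n → w c i ≤ w c j)
    (hdiff : ∀ c c', rank c ≤ rank c' → ∀ i j, i ≤ j → j < n → w c j - w c i ≤ w c' j - w c' i)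
    (hS : ∀ c c', rank c < rank c' → ∀ i, i + 1 < n →
      S c (i + 1) - S c i < S c' (i + 1) - S c' i)
    (b : ℕ → ι) (u : ℕ → ℝ) (h : DownwardIC n w K b u)
    (hmax : ∀ b₂ u₂, DownwardIC n w K b₂ u₂ →
      discreteObjective n μ lam S b₂ u₂ ≤ discreteObjective n μ lam S b u) :
    ∀ i j, i ≤ j → j < n → rank (b i) ≤ rank (b j) := by
  -- Suppose `b i` is strictly steeper than `b (i + 1)`. Two deviations are feasible: `i + 1`
  -- receives `b i`, or `i` receives `b (i + 1)`. Adding the two inequalities expressing that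
  -- neither improves the objective contradicts strict supermodularity of `S`.
  have hstep : ∀ i, i + 1 < n → (∀ l ≤ i, rank (b l) ≤ rank (b i)) →
      rank (b i) ≤ rank (b (i + 1)) := by
    intro i hin hpre
    by_contra hlt
    push Not at hlt
    obtain ⟨hb, hic⟩ := h
    -- The slack of the constraint between the two neighbours. The first deviation removes it from
    -- the utility of `i + 1`, so that this constraint binds.
    set dl := u (i + 1) - u i - (w (b i) (i + 1) - w (b i) i) with hdl
    have hdl0 : 0 ≤ dl := by have := hic i (i + 1) (by omega) hin; linarith
    have hstrict := hS _ _ hlt i hin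
    -- first modification
    have hB : discreteObjective n μ lam S (Function.update b (i + 1) (b i))
        (Function.update u (i + 1) (u (i + 1) - dl)) ≤ discreteObjective n μ lam S b u := by
      apply hmax
      refine ⟨fun l => ?_, fun l j hlj hj => ?_⟩
      · by_cases hl : l = i + 1
        · subst hl
          simp only [Function.update_self]
          have h1 := hw (b i) i (i + 1) (by omega) hin
          have h2 := (hb i).1
          have h3 := (hb (i + 1)).2
          constructor <;> linarith
        · simpa [Function.update_of_ne hl] using hb l
      · by_cases hl : l = i + 1
        · subst hl
          have hj' : j ≠ i + 1 := by omega
          simp only [Function.update_self, Function.update_of_ne hj']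
          have := hic i j (by omega) hj
          linarith
        · by_cases hj' : j = i + 1
          · subst hj'
            simp only [Function.update_self, Function.update_of_ne hl]
            rcases eq_or_lt_of_le (Nat.lt_succ_iff.mp hlj) with h1 | h1
            · subst h1; linarith
            -- The constraint from `l` to `i + 1` is chained through `i`. This needs `b l` to be no
            -- steeper than `b i`, the induction hypothesis `hpre`.
            · have h2 := hic l i h1 (by omega)
              have h3 := hdiff _ _ (hpre l h1.le) i (i + 1) (by omega) hin
              linarith
          · simpa [Function.update_of_ne hl, Function.update_of_ne hj'] using hic l j hlj hj
    have hB' : μ (i + 1) * (S (b i) (i + 1) - (1 - lam (i + 1)) * (u (i + 1) - dl)) ≤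
        μ (i + 1) * (S (b (i + 1)) (i + 1) - (1 - lam (i + 1)) * u (i + 1)) := by
      unfold discreteObjective at hB
      rw [← Finset.add_sum_erase _ _ (Finset.mem_range.mpr hin),
        ← Finset.add_sum_erase _ _ (Finset.mem_range.mpr hin)] at hB
      have : ∑ x ∈ (Finset.range n).erase (i + 1), μ x *
          (S (Function.update b (i + 1) (b i) x) x - (1 - lam x) *
            Function.update u (i + 1) (u (i + 1) - dl) x) =
          ∑ x ∈ (Finset.range n).erase (i + 1), μ x * (S (b x) x - (1 - lam x) * u x) := by
        refine Finset.sum_congr rfl fun x hx => ?_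
        have hx' := Finset.ne_of_mem_erase hx
        simp [Function.update_of_ne hx']
      rw [this] at hB
      simp only [Function.update_self] at hB
      linarith
    have hB2 := le_of_mul_le_mul_left hB' (hμ _ hin)
    -- second modification
    set dl' := if 1 ≤ lam i then dl else 0 with hdl'
    have hd1 : dl' ≤ dl := by rw [hdl']; split_ifs <;> linarith
    have hd0 : 0 ≤ dl' := by rw [hdl']; split_ifs <;> linarith
    have hinc := hdiff _ _ hlt.le i (i + 1) (by omega) hin
    have hC : discreteObjective n μ lam S (Function.update b i (b (i + 1)))
        (Function.update u i (u i + dl')) ≤ discreteObjective n μ lam S b u := by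
      apply hmax
      refine ⟨fun l => ?_, fun l j hlj hj => ?_⟩
      · by_cases hl : l = i
        · subst hl
          simp only [Function.update_self]
          have h1 := hw (b l) l (l + 1) (by omega) hin
          have h2 := (hb l).1
          have h3 := (hb (l + 1)).2
          constructor <;> linarith
        · simpa [Function.update_of_ne hl] using hb l
      · by_cases hl : l = i
        · subst hl
          have hj' : j ≠ l := by omega
          simp only [Function.update_self, Function.update_of_ne hj']
          rcases eq_or_lt_of_le (Nat.succ_le_of_lt hlj) with h1 | h1
          · subst h1; simp only [Nat.succ_eq_add_one] at *; linarith
          · have := hic (l + 1) j h1 hj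
            linarith
        · by_cases hj' : j = i
          · subst hj'
            simp only [Function.update_self, Function.update_of_ne hl]
            have := hic l j hlj hj
            linarith
          · simpa [Function.update_of_ne hl, Function.update_of_ne hj'] using hic l j hlj hj
    have hin' : i < n := by omega
    have hC' : μ i * (S (b (i + 1)) i - (1 - lam i) * (u i + dl')) ≤
        μ i * (S (b i) i - (1 - lam i) * u i) := by
      unfold discreteObjective at hC
      rw [← Finset.add_sum_erase _ _ (Finset.mem_range.mpr hin'),
        ← Finset.add_sum_erase _ _ (Finset.mem_range.mpr hin')] at hC
      have : ∑ x ∈ (Finset.range n).erase i, μ x *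
          (S (Function.update b i (b (i + 1)) x) x - (1 - lam x) *
            Function.update u i (u i + dl') x) =
          ∑ x ∈ (Finset.range n).erase i, μ x * (S (b x) x - (1 - lam x) * u x) := by
        refine Finset.sum_congr rfl fun x hx => ?_
        have hx' := Finset.ne_of_mem_erase hx
        simp [Function.update_of_ne hx']
      rw [this] at hC
      simp only [Function.update_self] at hC
      linarith
    have hC2 := le_of_mul_le_mul_left hC' (hμ _ hin')
    have hl := hlam i (i + 1) (by omega) hin
    by_cases h1 : 1 ≤ lam i
    · rw [if_pos h1] at hdl'
      rw [hdl'] at hC2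
      nlinarith
    · rw [if_neg h1] at hdl'
      rw [hdl'] at hC2
      push Not at h1
      nlinarith
  have hpre : ∀ j, j < n → ∀ i ≤ j, rank (b i) ≤ rank (b j) := by
    intro j
    induction j with
    | zero => intro _ i hi; obtain rfl : i = 0 := by omega
              exact le_rfl
    | succ j ih =>
      intro hj i hi
      rcases eq_or_lt_of_le hi with rfl | h1
      · exact le_rfl
      · exact (ih (by omega) i (by omega)).trans (hstep j hj (ih (by omega)))
  exact fun i j hij hj => hpre j hj i hij

/-- In the discrete relaxed problem (downward incentive constraints only), monotone allocation
rules do at least as well as arbitrary ones, up to `ε`. -/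
lemma exists_monotone_downwardIC {ι : Type*} (n : ℕ) (μ lam : ℕ → ℝ)
    (w S : ι → ℕ → ℝ) (rank : ι → ℝ) (K : ℝ) (c : ℕ → ι) (u : ℕ → ℝ) (hμ : ∀ i < n, 0 < μ i)
    (hlam : ∀ i j, i ≤ j → j < n → lam j ≤ lam i)
    (hw : ∀ l < n, ∀ i j, i ≤ j → j < n → w (c l) i ≤ w (c l) j)
    (hdiff : ∀ l < n, ∀ l' < n, rank (c l) ≤ rank (c l') → ∀ i j, i ≤ j → j < n →
      w (c l) j - w (c l) i ≤ w (c l') j - w (c l') i)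
    (hS : ∀ l < n, ∀ l' < n, rank (c l) ≤ rank (c l') → ∀ i j, i ≤ j → j < n →
      S (c l) j - S (c l) i ≤ S (c l') j - S (c l') i)
    (h : DownwardIC n w K c u) (ε : ℝ) (hε : 0 < ε) :
    ∃ (σ : ℕ → ℕ) (u' : ℕ → ℝ), (∀ i < n, σ i < n) ∧ DownwardIC n w K (c ∘ σ) u' ∧
      (∀ i j, i ≤ j → j < n → rank (c (σ i)) ≤ rank (c (σ j))) ∧
      discreteObjective n μ lam S c u - ε ≤ discreteObjective n μ lam S (c ∘ σ) u' := by
  rcases Nat.eq_zero_or_pos n with rfl | hn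
  · exact ⟨id, u, by simp, h, by simp, by simp [discreteObjective, hε.le]⟩
  -- The tie-breaking term `e * (i * rank)` turns weak supermodularity into strict supermodularity.
  -- `C` bounds its weighted sum, without the factor `e`, for every rule, so the objectives of both
  -- compared rules move by at most `e * C = ε / 2`.
  set C : ℝ := 1 + ∑ i ∈ Finset.range n, ∑ l ∈ Finset.range n, |μ i * (i * rank (c l))| with hC
  have hC0 : 0 < C := by positivity
  set e : ℝ := ε / (2 * C) with he
  have he0 : 0 < e := by positivity
  let w' : Fin n → ℕ → ℝ := fun l => w (c l)
  let S' : Fin n → ℕ → ℝ := fun l i => S (c l) i + e * (i * rank (c l))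
  let c' : ℕ → Fin n := fun i => if hi : i < n then ⟨i, hi⟩ else ⟨0, hn⟩
  have hc' : ∀ i < n, (c' i : ℕ) = i := fun i hi => by simp [c', hi]
  have h' : DownwardIC n w' K c' u := by
    refine ⟨h.1, fun i j hij hj => ?_⟩
    have := h.2 i j hij hj
    simpa [w', hc' i (hij.trans hj)] using this
  obtain ⟨b, u', hbu, hmax⟩ := exists_max_downwardIC n μ lam w' S' K c' u h'
  have hmono := monotone_of_max_downwardIC n μ lam w' S' (fun l => rank (c l)) K hμ hlam
    (fun l => hw l l.2) (fun l l' hl => hdiff l l.2 l' l'.2 hl)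
    (fun l l' hl i hi => by
      have h1 := hS l l.2 l' l'.2 hl.le i (i + 1) (by omega) hi
      simp only [S']
      push_cast
      nlinarith) b u' hbu hmax
  have hbd : ∀ b₁ : ℕ → Fin n, |∑ i ∈ Finset.range n, μ i * (i * rank (c (b₁ i)))| ≤ C := by
    intro b₁
    refine (Finset.abs_sum_le_sum_abs _ _).trans ?_
    have : ∑ i ∈ Finset.range n, |μ i * (i * rank (c (b₁ i)))| ≤
        ∑ i ∈ Finset.range n, ∑ l ∈ Finset.range n, |μ i * (i * rank (c l))| := by
      refine Finset.sum_le_sum fun i _ => ?_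
      exact Finset.single_le_sum (f := fun l => |μ i * (i * rank (c l))|)
        (fun _ _ => abs_nonneg _) (Finset.mem_range.mpr (b₁ i).2)
    linarith
  have hsplit : ∀ (b₁ : ℕ → Fin n) (u₁ : ℕ → ℝ), discreteObjective n μ lam S' b₁ u₁ =
      discreteObjective n μ lam S (fun i => c (b₁ i)) u₁ +
        e * ∑ i ∈ Finset.range n, μ i * (i * rank (c (b₁ i))) := by
    intro b₁ u₁
    simp only [discreteObjective, S', Finset.mul_sum, ← Finset.sum_add_distrib]
    exact Finset.sum_congr rfl fun i _ => by ring
  have hcc : discreteObjective n μ lam S (fun i => c (c' i)) u = discreteObjective n μ lam S c u := by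
    refine Finset.sum_congr rfl fun i hi => ?_
    simp only [hc' i (Finset.mem_range.mp hi)]
  refine ⟨fun i => b i, u', fun i _ => (b i).2, hbu, hmono, ?_⟩
  have h1 := hmax c' u h'
  rw [hsplit, hsplit, hcc] at h1
  have h2 := abs_le.mp (hbd b)
  have h3 := abs_le.mp (hbd c')
  have h4 : e * C = ε / 2 := by rw [he]; field_simp
  change _ ≤ discreteObjective n μ lam S (fun i => c (b i)) u'
  nlinarith

/-! ### Virtual surplus calculus for primitives extended to the line -/

/-- A screening problem whose primitives have been extended continuously from the type space
`[lo, hi]` to all of `ℝ`. -/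
structure ExtendedScreening (X : Type*) [TopologicalSpace X] where
  lo : ℝ
  hi : ℝ
  lo_lt_hi : lo < hi
  f : ℝ → ℝ
  lam : ℝ → ℝ
  v : X → ℝ → ℝ
  vt : X → ℝ → ℝ
  B : ℝ
  continuous_f : Continuous f
  f_pos : ∀ t, 0 < f t
  continuous_lam : Continuous lam
  antitone_lam : Antitone lam
  continuous_v : Continuous fun z : X × ℝ => v z.1 z.2
  continuous_vt : Continuous fun z : X × ℝ => vt z.1 z.2
  abs_f_le : ∀ t, |f t| ≤ B
  abs_lam_le : ∀ t, |lam t| ≤ B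
  abs_v_le : ∀ x t, |v x t| ≤ B
  abs_vt_le : ∀ x t, |vt x t| ≤ B
  lipschitz_v : ∀ x s t, |v x s - v x t| ≤ B * |s - t|
  monotone_v : ∀ x, Monotone (v x)
  hasDeriv_v : ∀ x, ∀ t ∈ Icc lo hi, HasDerivWithinAt (v x) (vt x t) (Icc lo hi) t
  mean_nonneg : 0 ≤ ∫ t in lo..hi, (1 - lam t) * f t

namespace ExtendedScreening

noncomputable section

set_option linter.unusedSectionVars false

variable {X : Type*} [MetricSpace X] [CompactSpace X] [MeasurableSpace X] [BorelSpace X]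
  (D : ExtendedScreening X)

/-- Value of a lottery to a type. -/
def val (a : ProbabilityMeasure X) (t : ℝ) : ℝ := ∫ y, D.v y t ∂(a : Measure X)

/-- Derivative of the value of a lottery in the type. -/
def valt (a : ProbabilityMeasure X) (t : ℝ) : ℝ := ∫ y, D.vt y t ∂(a : Measure X)

/-- Steepness of an allocation: difference of its values to the highest and the lowest type. -/
def kap (x : X) : ℝ := D.v x D.hi - D.v x D.lo

/-- Expected steepness of a lottery. -/
def kapL (a : ProbabilityMeasure X) : ℝ := ∫ y, D.kap y ∂(a : Measure X)

/-- Net social cost of marginal rents at type `t`. -/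
def G (t : ℝ) : ℝ := ∫ s in t..D.hi, (1 - D.lam s) * D.f s

lemma continuous_v_left (t : ℝ) : Continuous fun x => D.v x t :=
  D.continuous_v.comp (by fun_prop : Continuous fun x : X => (x, t))

lemma continuous_vt_left (t : ℝ) : Continuous fun x => D.vt x t :=
  D.continuous_vt.comp (by fun_prop : Continuous fun x : X => (x, t))

lemma continuous_vt_right (x : X) : Continuous (D.vt x) :=
  D.continuous_vt.comp (by fun_prop : Continuous fun t : ℝ => (x, t))

lemma continuous_v_right (x : X) : Continuous (D.v x) :=
  D.continuous_v.comp (by fun_prop : Continuous fun t : ℝ => (x, t))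

lemma continuous_kap : Continuous D.kap :=
  (D.continuous_v_left _).sub (D.continuous_v_left _)

lemma B_nonneg : 0 ≤ D.B := (abs_nonneg _).trans (D.abs_f_le 0)

lemma integrable_of_continuous (a : ProbabilityMeasure X) {h : X → ℝ} (hc : Continuous h) :
    Integrable h (a : Measure X) :=
  (BoundedContinuousFunction.mkOfCompact ⟨h, hc⟩).integrable _

lemma integrable_v (a : ProbabilityMeasure X) (t : ℝ) :
    Integrable (fun y => D.v y t) (a : Measure X) :=
  integrable_of_continuous a (D.continuous_v_left t)

lemma integrable_vt (a : ProbabilityMeasure X) (t : ℝ) :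
    Integrable (fun y => D.vt y t) (a : Measure X) :=
  integrable_of_continuous a (D.continuous_vt_left t)

lemma abs_integral_le (a : ProbabilityMeasure X) {h : X → ℝ} {C : ℝ} (hC : ∀ x, |h x| ≤ C) :
    |∫ y, h y ∂(a : Measure X)| ≤ C := by
  have := norm_integral_le_of_norm_le_const (μ := (a : Measure X)) (f := h) (C := C)
    (Filter.Eventually.of_forall fun x => by simpa using hC x)
  simpa using this

lemma abs_val_le (a : ProbabilityMeasure X) (t : ℝ) : |D.val a t| ≤ D.B :=
  abs_integral_le a fun x => D.abs_v_le x t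

lemma abs_valt_le (a : ProbabilityMeasure X) (t : ℝ) : |D.valt a t| ≤ D.B :=
  abs_integral_le a fun x => D.abs_vt_le x t

lemma val_sub (a : ProbabilityMeasure X) (s t : ℝ) :
    D.val a s - D.val a t = ∫ y, (D.v y s - D.v y t) ∂(a : Measure X) :=
  (integral_sub (D.integrable_v a s) (D.integrable_v a t)).symm

lemma lipschitz_val (a : ProbabilityMeasure X) (s t : ℝ) :
    |D.val a s - D.val a t| ≤ D.B * |s - t| := by
  rw [D.val_sub]
  exact abs_integral_le a fun x => D.lipschitz_v x s t

lemma monotone_val (a : ProbabilityMeasure X) : Monotone (D.val a) := fun _ _ hst =>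
  integral_mono (D.integrable_v a _) (D.integrable_v a _) fun x => D.monotone_v x hst

lemma kapL_eq (a : ProbabilityMeasure X) : D.kapL a = D.val a D.hi - D.val a D.lo :=
  (D.val_sub a _ _).symm

lemma kap_nonneg (x : X) : 0 ≤ D.kap x := sub_nonneg.mpr (D.monotone_v x D.lo_lt_hi.le)

lemma kap_le (x : X) : D.kap x ≤ 2 * D.B := by
  have h1 := abs_le.mp (D.abs_v_le x D.hi)
  have h2 := abs_le.mp (D.abs_v_le x D.lo)
  unfold kap; linarith [h1.2, h2.1]

lemma continuous_valt (a : ProbabilityMeasure X) : Continuous (D.valt a) :=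
  continuous_of_dominated (fun t => (D.continuous_vt_left t).aestronglyMeasurable)
    (fun t => Filter.Eventually.of_forall fun x => by simpa using D.abs_vt_le x t)
    (integrable_const D.B) (Filter.Eventually.of_forall fun x => D.continuous_vt_right x)

lemma continuous_val (a : ProbabilityMeasure X) : Continuous (D.val a) :=
  continuous_of_dominated (fun t => (D.continuous_v_left t).aestronglyMeasurable)
    (fun t => Filter.Eventually.of_forall fun x => by simpa using D.abs_v_le x t)
    (integrable_const D.B) (Filter.Eventually.of_forall fun x => D.continuous_v_right x)

lemma integral_vt (x : X) {c d : ℝ} (hc : D.lo ≤ c) (hcd : c ≤ d) (hd : d ≤ D.hi) :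
    ∫ t in c..d, D.vt x t = D.v x d - D.v x c := by
  refine intervalIntegral.integral_eq_sub_of_hasDeriv_right_of_le hcd
    (D.continuous_v_right x).continuousOn (fun t ht => ?_)
    ((D.continuous_vt_right x).intervalIntegrable _ _)
  have h := D.hasDeriv_v x t ⟨by linarith [ht.1], by linarith [ht.2]⟩
  exact (h.hasDerivAt (Icc_mem_nhds (by linarith [ht.1]) (by linarith [ht.2]))).hasDerivWithinAt

lemma integral_valt (a : ProbabilityMeasure X) {c d : ℝ} (hc : D.lo ≤ c) (hcd : c ≤ d)
    (hd : d ≤ D.hi) : ∫ t in c..d, D.valt a t = D.val a d - D.val a c := by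
  unfold valt
  rw [intervalIntegral.integral_of_le hcd, integral_integral_swap, D.val_sub]
  · refine integral_congr_ae (Filter.Eventually.of_forall fun x => ?_)
    simp only
    rw [← intervalIntegral.integral_of_le hcd, D.integral_vt x hc hcd hd]
  · refine Integrable.of_bound (C := D.B) ?_ (Filter.Eventually.of_forall fun z => by
      simpa [Function.uncurry] using D.abs_vt_le z.2 z.1)
    exact (D.continuous_vt.comp continuous_swap).aestronglyMeasurable

lemma continuous_weight : Continuous fun t => (1 - D.lam t) * D.f t :=
  (continuous_const.sub D.continuous_lam).mul D.continuous_f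

lemma hasDerivAt_G (t : ℝ) : HasDerivAt D.G (-((1 - D.lam t) * D.f t)) t :=
  intervalIntegral.integral_hasDerivAt_left (D.continuous_weight.intervalIntegrable _ _)
    D.continuous_weight.aestronglyMeasurable.stronglyMeasurableAtFilter
    D.continuous_weight.continuousAt

lemma continuous_G : Continuous D.G :=
  continuous_iff_continuousAt.mpr fun t => (D.hasDerivAt_G t).continuousAt

lemma G_hi : D.G D.hi = 0 := by simp [G]

lemma G_sub (c d : ℝ) : D.G c - D.G d = ∫ t in c..d, (1 - D.lam t) * D.f t := by
  unfold G
  rw [intervalIntegral.integral_interval_sub_interval_comm' , intervalIntegral.integral_same]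
  · rw [zero_sub, ← intervalIntegral.integral_symm]
  all_goals exact D.continuous_weight.intervalIntegrable _ _

/-- The weight `(1 - λ) f` changes sign at most once, from negative to positive. If `λ t ≤ 1` it is
nonnegative on `[t, hi]`; otherwise it is nonpositive on `[lo, t]`, so that `G t ≥ G lo ≥ 0`. -/
lemma G_nonneg {t : ℝ} (ht : t ∈ Icc D.lo D.hi) : 0 ≤ D.G t := by
  by_cases h : D.lam t ≤ 1
  · refine intervalIntegral.integral_nonneg ht.2 fun s hs => ?_
    have := D.antitone_lam hs.1
    exact mul_nonneg (by linarith) (D.f_pos s).le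
  · push Not at h
    have h1 : 0 ≤ ∫ s in D.lo..t, -((1 - D.lam s) * D.f s) := by
      refine intervalIntegral.integral_nonneg ht.1 fun s hs => ?_
      have := D.antitone_lam hs.2
      have := (D.f_pos s).le
      nlinarith
    rw [intervalIntegral.integral_neg, ← D.G_sub] at h1
    have := D.mean_nonneg
    change 0 ≤ D.G D.lo at this
    linarith

/-- Integration by parts on a cell on which the allocation is constant. -/
lemma integral_virtual (a : ProbabilityMeasure X) {c d : ℝ} (hc : D.lo ≤ c) (hcd : c ≤ d)
    (hd : d ≤ D.hi) :
    ∫ t in c..d, (D.val a t * D.f t - D.G t * D.valt a t) =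
      (∫ t in c..d, D.lam t * D.f t * D.val a t) + D.G c * D.val a c - D.G d * D.val a d := by
  -- This antiderivative of the continuous function `valt` agrees with `val` on the cell and is
  -- differentiable on the whole line, so the fundamental theorem applies up to the endpoints.
  set V : ℝ → ℝ := fun t => D.val a c + ∫ s in c..t, D.valt a s with hV
  have hV' : ∀ t, HasDerivAt V (D.valt a t) t := fun t =>
    (intervalIntegral.integral_hasDerivAt_right ((D.continuous_valt a).intervalIntegrable _ _)
      (D.continuous_valt a).aestronglyMeasurable.stronglyMeasurableAtFilter
      (D.continuous_valt a).continuousAt).const_add _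
  have hVeq : ∀ t ∈ Icc c d, V t = D.val a t := by
    intro t ht
    simp only [hV]
    rw [D.integral_valt a hc ht.1 (ht.2.trans hd)]; ring
  have hftc := intervalIntegral.integral_eq_sub_of_hasDerivAt
    (f := fun t => D.G t * V t) (a := c) (b := d)
    (f' := fun t => -((1 - D.lam t) * D.f t) * V t + D.G t * D.valt a t)
    (fun t _ => (D.hasDerivAt_G t).mul (hV' t)) (by
      apply Continuous.intervalIntegrable
      have h1 : Continuous V := continuous_iff_continuousAt.mpr fun t => (hV' t).continuousAt
      exact ((D.continuous_weight.neg).mul h1).add (D.continuous_G.mul (D.continuous_valt a)))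
  rw [hVeq d ⟨hcd, le_rfl⟩, hVeq c ⟨le_rfl, hcd⟩] at hftc
  have h2 : ∫ t in c..d, (-((1 - D.lam t) * D.f t) * V t + D.G t * D.valt a t) =
      ∫ t in c..d, (-((1 - D.lam t) * D.f t) * D.val a t + D.G t * D.valt a t) := by
    refine intervalIntegral.integral_congr fun t ht => ?_
    rw [uIcc_of_le hcd] at ht
    simp only [hVeq t ht]
  rw [h2] at hftc
  have c1 := D.continuous_val a
  have c2 := D.continuous_valt a
  have c3 := D.continuous_G
  have c4 := D.continuous_f
  have c5 := D.continuous_lam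
  have h3 : ∫ t in c..d, (D.val a t * D.f t - D.G t * D.valt a t) =
      (∫ t in c..d, D.lam t * D.f t * D.val a t) -
        ∫ t in c..d, (-((1 - D.lam t) * D.f t) * D.val a t + D.G t * D.valt a t) := by
    rw [← intervalIntegral.integral_sub]
    · exact intervalIntegral.integral_congr fun t _ => by ring
    all_goals exact Continuous.intervalIntegrable (by fun_prop) _ _
  rw [h3, hftc]; ring

/-- Total rents in terms of the marginal rents. -/
lemma integral_rents {g : ℝ → ℝ} (hg : AEStronglyMeasurable g (volume.restrict (Ioc D.lo D.hi)))
    {C : ℝ} (hC : ∀ t, |g t| ≤ C) :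
    ∫ t in D.lo..D.hi, (1 - D.lam t) * D.f t * ∫ s in D.lo..t, g s =
      ∫ t in D.lo..D.hi, D.G t * g t := by
  set ν : Measure ℝ := volume.restrict (Ioc D.lo D.hi) with hν
  set m : ℝ → ℝ := fun t => (1 - D.lam t) * D.f t with hm
  have hm' : Continuous m := D.continuous_weight
  have hle := D.lo_lt_hi.le
  rw [intervalIntegral.integral_of_le hle, intervalIntegral.integral_of_le hle]
  -- Fubini: both sides integrate `m t * g s` over the triangle `s ≤ t`.
  have h1 : ∫ t in Ioc D.lo D.hi, m t * ∫ s in D.lo..t, g s =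
      ∫ t, ∫ s, m t * (Iic t).indicator g s ∂ν ∂ν := by
    refine setIntegral_congr_fun measurableSet_Ioc fun t ht => ?_
    rw [integral_const_mul, intervalIntegral.integral_of_le ht.1.le,
      integral_indicator measurableSet_Iic, hν, Measure.restrict_restrict measurableSet_Iic]
    congr 3
    ext s; simp only [mem_Ioc, mem_inter_iff, mem_Iic]
    constructor
    · rintro ⟨h1, h2⟩; exact ⟨h2, h1, h2.trans ht.2⟩
    · rintro ⟨h1, h2, _⟩; exact ⟨h2, h1⟩
  have h2 : ∫ t in Ioc D.lo D.hi, D.G t * g t =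
      ∫ s, ∫ t, m t * (Iic t).indicator g s ∂ν ∂ν := by
    refine setIntegral_congr_fun measurableSet_Ioc fun s hs => ?_
    have : (fun t => m t * (Iic t).indicator g s) = fun t => (Ici s).indicator m t * g s := by
      ext t
      by_cases hst : s ≤ t <;> simp [indicator, hst]
    rw [this, integral_mul_const]
    congr 1
    rw [integral_indicator measurableSet_Ici, hν, Measure.restrict_restrict measurableSet_Ici, G,
      intervalIntegral.integral_of_le hs.2]
    rw [integral_Ioc_eq_integral_Ioo, ← integral_Icc_eq_integral_Ioo]
    congr 2
    ext t; simp only [mem_Icc, mem_inter_iff, mem_Ici, mem_Ioc]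
    constructor
    · rintro ⟨h1, h2⟩; exact ⟨h1, hs.1.trans_le h1, h2⟩
    · rintro ⟨h1, _, h2⟩; exact ⟨h1, h2⟩
  change ∫ t in Ioc D.lo D.hi, m t * ∫ s in D.lo..t, g s = _
  rw [h1, h2]
  refine integral_integral_swap ?_
  have hmb : ∀ t, |m t| ≤ (1 + D.B) * D.B := fun t => by
    rw [hm, abs_mul]
    refine mul_le_mul ?_ (D.abs_f_le t) (abs_nonneg _) (by linarith [D.B_nonneg])
    calc |1 - D.lam t| ≤ |1| + |D.lam t| := abs_sub _ _
      _ ≤ 1 + D.B := by simpa using D.abs_lam_le t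
  refine Integrable.of_bound (C := (1 + D.B) * D.B * C) ?_ (Filter.Eventually.of_forall fun z => ?_)
  · have hset : MeasurableSet {z : ℝ × ℝ | z.2 ≤ z.1} := measurableSet_le measurable_snd measurable_fst
    have : (Function.uncurry fun t s => m t * (Iic t).indicator g s) =
        fun z : ℝ × ℝ => m z.1 * {z : ℝ × ℝ | z.2 ≤ z.1}.indicator (fun z => g z.2) z := by
      ext ⟨t, s⟩; simp [Function.uncurry, indicator]
    rw [this]
    exact (hm'.comp continuous_fst).aestronglyMeasurable.mul (hg.comp_snd.indicator hset)
  · have hg' : |(Iic z.1).indicator g z.2| ≤ C := by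
      by_cases h : z.2 ≤ z.1
      · simpa [indicator, h] using hC z.2
      · simpa [indicator, h] using (abs_nonneg _).trans (hC 0)
    simp only [Function.uncurry, Real.norm_eq_abs, abs_mul]
    have h0 : 0 ≤ (1 + D.B) * D.B := (abs_nonneg _).trans (hmb 0)
    exact mul_le_mul (hmb _) hg' (abs_nonneg _) h0

lemma tendsto_integral_of_tendsto {h : X → ℝ} (hc : Continuous h) {ι : Type*} {l : Filter ι}
    {a : ι → ProbabilityMeasure X} {a' : ProbabilityMeasure X} (ha : Filter.Tendsto a l (nhds a')) :
    Filter.Tendsto (fun i => ∫ y, h y ∂(a i : Measure X)) l (nhds (∫ y, h y ∂(a' : Measure X))) :=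
  (ProbabilityMeasure.tendsto_iff_forall_integral_tendsto.mp ha)
    (BoundedContinuousFunction.mkOfCompact ⟨h, hc⟩)

lemma continuous_integral_left {h : X → ℝ} (hc : Continuous h) :
    Continuous fun a : ProbabilityMeasure X => ∫ y, h y ∂(a : Measure X) :=
  continuous_iff_continuousAt.mpr fun _ => tendsto_integral_of_tendsto hc Filter.tendsto_id

lemma continuous_kapL : Continuous D.kapL := continuous_integral_left D.continuous_kap

end

end ExtendedScreening

/-! ### Sampling grids with a random shift -/

/-- For `θ` uniform on `(0, 1)`, the mean of the Riemann sum at the shifted grid is the integral.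
Some `θ` therefore does at least as well while keeping all sample points outside the null set. Only
integrability of `g` is used, since allocation rules are merely measurable. -/
lemma exists_shift {a b : ℝ} (hab : a < b) {g : ℝ → ℝ} (hg : IntervalIntegrable g volume a b)
    {N : Set ℝ} (hN : volume N = 0) {n : ℕ} (hn : 0 < n) :
    ∃ θ ∈ Ioo (0 : ℝ) 1, (∀ i < n, a + (i + θ) * ((b - a) / n) ∉ N) ∧
      ∫ t in a..b, g t ≤ (b - a) / n *
        ∑ i ∈ Finset.range n, g (a + (i + θ) * ((b - a) / n)) := by
  have hn' : (0 : ℝ) < n := by exact_mod_cast hn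
  set h := (b - a) / n with hh
  have h0 : 0 < h := div_pos (sub_pos.mpr hab) hn'
  have hnh : (n : ℝ) * h = b - a := by rw [hh]; field_simp
  let ν : Measure ℝ := volume.restrict (Ioo 0 1)
  have : IsProbabilityMeasure ν := ⟨by simp [ν]⟩
  have hcell : ∀ i < n, IntervalIntegrable g volume (a + i * h) (a + (i + 1 : ℕ) * h) := by
    intro i hi
    have h1 : (i : ℝ) + 1 ≤ n := by exact_mod_cast hi
    have h2 : (0 : ℝ) ≤ i := by positivity
    refine hg.mono_set ?_
    rw [uIcc_of_le (by push_cast; nlinarith), uIcc_of_le hab.le]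
    refine Icc_subset_Icc (by nlinarith) ?_
    push_cast
    nlinarith
  have hint : ∀ i < n, IntervalIntegrable (fun θ => g (a + (i + θ) * h)) volume 0 1 := by
    intro i hi
    have := ((hcell i hi).comp_add_right (a + i * h)).comp_mul_left (c := h)
    have h1 : (a + i * h - (a + i * h)) / h = 0 := by simp
    have h2 : (a + (i + 1 : ℕ) * h - (a + i * h)) / h = 1 := by
      push_cast; field_simp; ring
    rw [h1, h2] at this
    refine this.congr (fun θ _ => ?_)
    congr 1; ring
  have hval : ∀ i < n, h * ∫ θ in (0 : ℝ)..1, g (a + (i + θ) * h) =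
      ∫ t in (a + i * h)..(a + (i + 1 : ℕ) * h), g t := by
    intro i _
    have := intervalIntegral.mul_integral_comp_add_mul (f := g) (a := 0) (b := 1) h (a + i * h)
    rw [show a + (i + 1 : ℕ) * h = a + i * h + h * 1 by push_cast; ring,
      show a + i * h = a + i * h + h * 0 by ring] 
    simp only [mul_zero, add_zero] at this ⊢
    rw [← this]
    congr 2; ext θ; congr 1; ring
  have hNull : ν {θ | ∃ i < n, a + (i + θ) * h ∈ N} = 0 := by
    have : {θ | ∃ i < n, a + (i + θ) * h ∈ N} = ⋃ i ∈ Finset.range n, {θ | a + (i + θ) * h ∈ N} := by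
      ext; simp
    rw [this]
    refine (measure_biUnion_null_iff (Finset.range n).countable_toSet).mpr fun i _ => ?_
    refine Measure.restrict_apply_eq_zero' measurableSet_Ioo |>.mpr (measure_mono_null inter_subset_left ?_)
    have : {θ : ℝ | a + (i + θ) * h ∈ N} = (fun θ => h * θ) ⁻¹' ((fun θ => (a + i * h) + θ) ⁻¹' N) := by
      ext θ
      simp only [mem_ofPred_eq, mem_preimage]
      rw [show a + i * h + h * θ = a + (i + θ) * h by ring]
    rw [this, Real.volume_preimage_mul_left h0.ne', measure_preimage_add, hN, mul_zero]
  have hInt : Integrable (fun θ => h * ∑ i ∈ Finset.range n, g (a + (i + θ) * h)) ν := by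
    refine (integrable_finsetSum _ fun i hi => ?_).const_mul _
    have := hint i (Finset.mem_range.mp hi)
    rw [intervalIntegrable_iff_integrableOn_Ioo_of_le zero_le_one] at this
    exact this
  have h01 : ν (Ioo 0 1)ᶜ = 0 := by simp [ν]
  obtain ⟨θ, hθ, hle⟩ := exists_notMem_null_integral_le hInt (measure_union_null hNull h01)
  simp only [mem_union, mem_ofPred_eq, mem_compl_iff, not_or, not_exists, not_and, not_not] at hθ
  refine ⟨θ, hθ.2, hθ.1, le_trans (le_of_eq ?_) hle⟩
  rw [integral_const_mul, integral_finsetSum, Finset.mul_sum]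
  · have h3 : ∀ i ∈ Finset.range n, h * ∫ θ, g (a + (i + θ) * h) ∂ν =
        ∫ t in (a + i * h)..(a + (i + 1 : ℕ) * h), g t := by
      intro i hi
      rw [← hval i (Finset.mem_range.mp hi), intervalIntegral.integral_of_le zero_le_one,
        integral_Ioc_eq_integral_Ioo]
    rw [Finset.sum_congr rfl h3,
      intervalIntegral.sum_integral_adjacent_intervals (a := fun i : ℕ => a + i * h) hcell]
    congr 1
    · simp
    · rw [hnh]; ring
  · intro i hi
    have := hint i (Finset.mem_range.mp hi)
    rw [intervalIntegrable_iff_integrableOn_Ioo_of_le zero_le_one] at this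
    exact this

/-- Sample points `t 0 < ⋯ < t (n - 1)` of `[lo, hi]` at distance `h`, and the partition
`lo = τ 0 < ⋯ < τ n = hi` with `τ i = t i` for `0 < i < n`. -/
structure IsGrid (lo hi h : ℝ) (n : ℕ) (t τ : ℕ → ℝ) : Prop where
  pos : 0 < n
  mem : ∀ i < n, t i ∈ Ioo lo hi
  lt : ∀ i j, i < j → j < n → t i < t j
  left : τ 0 = lo
  right : τ n = hi
  eq : ∀ i, 0 < i → i < n → τ i = t i
  cell_lt : ∀ i < n, τ i < τ (i + 1)
  mem_cell : ∀ i < n, t i ∈ Icc (τ i) (τ (i + 1))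
  length_le : ∀ i < n, ∀ s ∈ Icc (τ i) (τ (i + 1)), |s - t i| ≤ h
  sum_le : ∑ i ∈ Finset.range n, |τ (i + 1) - τ i - h| ≤ 2 * h

/-- Interior breakpoints are sample points, so that a constraint at a sample point can be used at a
cell boundary. The price is a first cell of length `(1 + θ) h` and a last one of length `(1 - θ) h`,
a total deviation of `2 θ h`. -/
lemma isGrid_shift {lo hi θ : ℝ} (hlt : lo < hi) (hθ : θ ∈ Ioo (0 : ℝ) 1) (m : ℕ) :
    IsGrid lo hi ((hi - lo) / (m + 2 : ℕ)) (m + 2)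
      (fun i => lo + (i + θ) * ((hi - lo) / (m + 2 : ℕ)))
      (fun i => if i = 0 then lo else if i < m + 2 then
        lo + (i + θ) * ((hi - lo) / (m + 2 : ℕ)) else hi) := by
  have hn' : (0 : ℝ) < (m + 2 : ℕ) := by positivity
  set h := (hi - lo) / (m + 2 : ℕ) with hh
  have h0 : 0 < h := div_pos (sub_pos.mpr hlt) hn'
  have hnh : hi = lo + (m + 2) * h := by rw [hh]; push_cast; field_simp; ring
  clear_value h
  subst hnh
  obtain ⟨hθ0, hθ1⟩ := hθ
  have hθh : θ * h < h := by nlinarith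
  have hθh0 : 0 < θ * h := by positivity
  have hcast : ∀ i : ℕ, i < m + 2 → (i : ℝ) * h ≤ (m + 1) * h := fun i hi => by
    have : (i : ℝ) ≤ m + 1 := by exact_mod_cast Nat.lt_succ_iff.mp hi
    nlinarith
  have hnn : ∀ i : ℕ, 0 ≤ (i : ℝ) * h := fun i => by positivity
  refine ⟨by omega, ?_, ?_, by simp, by simp, ?_, ?_, ?_, ?_, ?_⟩
  · intro i hi
    have := hcast i hi
    have := hnn i
    constructor <;> nlinarith
  · intro i j hij hj
    have : (i : ℝ) < j := by exact_mod_cast hij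
    nlinarith
  · intro i hi hin
    simp [hi.ne', hin]
  · intro i hi
    rcases Nat.eq_zero_or_pos i with rfl | hi0
    · simp; positivity
    · by_cases h1 : i + 1 < m + 2
      · simp only [hi0.ne', h1, hi]
        simp
        nlinarith
      · have : i = m + 1 := by omega
        subst this
        simp
        nlinarith
  · intro i hi
    rcases Nat.eq_zero_or_pos i with rfl | hi0
    · simp; constructor <;> nlinarith
    · by_cases h1 : i + 1 < m + 2
      · simp only [hi0.ne', h1, hi]
        simp
        nlinarith
      · have : i = m + 1 := by omega
        subst this
        simp
        nlinarith
  · intro i hi s hs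
    rw [abs_le]
    rcases Nat.eq_zero_or_pos i with rfl | hi0
    · simp at hs
      obtain ⟨hs1, hs2⟩ := hs
      simp
      constructor <;> nlinarith
    · by_cases h1 : i + 1 < m + 2
      · simp only [hi0.ne', h1, hi] at hs
        simp at hs
        obtain ⟨hs1, hs2⟩ := hs
        constructor <;> nlinarith
      · have : i = m + 1 := by omega
        subst this
        simp at hs
        obtain ⟨hs1, hs2⟩ := hs
        push_cast
        constructor <;> nlinarith
  · rw [Finset.sum_range_succ, Finset.sum_range_succ']
    have : ∀ i ∈ Finset.range m, |(if i + 1 + 1 = 0 then lo else if i + 1 + 1 < m + 2 then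
        lo + ((i + 1 + 1 : ℕ) + θ) * h else lo + (m + 2) * h) -
        (if i + 1 = 0 then lo else if i + 1 < m + 2 then
        lo + ((i + 1 : ℕ) + θ) * h else lo + (m + 2) * h) - h| = 0 := by
      intro i hi
      have hi := Finset.mem_range.mp hi
      rw [if_neg (by omega), if_pos (by omega), if_neg (by omega), if_pos (by omega)]
      push_cast
      rw [abs_eq_zero]; ring
    rw [Finset.sum_congr rfl this]
    simp
    rw [abs_of_nonneg (by nlinarith), abs_of_nonpos (by nlinarith)]
    nlinarith

/-! ### Discretisation errors -/

namespace ExtendedScreening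

noncomputable section

set_option linter.unusedSectionVars false

variable {X : Type*} [MetricSpace X] [CompactSpace X] [MeasurableSpace X] [BorelSpace X]
  (D : ExtendedScreening X)

/-- `a'` is a steeper lottery than `a`: it has larger increments in the type, and it dominates `a`
stochastically with respect to steepness. -/
def SteeperLE (a a' : ProbabilityMeasure X) : Prop :=
  (∀ s t, s ≤ t → D.val a t - D.val a s ≤ D.val a' t - D.val a' s) ∧
    ∀ g : ℝ → ℝ, Monotone g →
      ∫ y, g (D.kap y) ∂(a : Measure X) ≤ ∫ y, g (D.kap y) ∂(a' : Measure X)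

/-- The virtual surplus, net of a cost `ρ`, of an allocation rule. -/
def virtual (ρ : ProbabilityMeasure X → ℝ) (b : ℝ → ProbabilityMeasure X) : ℝ :=
  ∫ t in D.lo..D.hi, ((D.val (b t) t - ρ (b t)) * D.f t - D.G t * D.valt (b t) t)

lemma SteeperLE.refl (a : ProbabilityMeasure X) : D.SteeperLE a a := ⟨fun _ _ _ => le_rfl, fun _ _ => le_rfl⟩

/-- Mass of the `i`-th cell. -/
def cellMass (τ : ℕ → ℝ) (i : ℕ) : ℝ := ∫ s in τ i..τ (i + 1), D.f s

/-- Average welfare weight of the `i`-th cell. -/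
def cellLam (τ : ℕ → ℝ) (i : ℕ) : ℝ :=
  (∫ s in τ i..τ (i + 1), D.lam s * D.f s) / D.cellMass τ i

variable {D} in
lemma cellMass_pos {h : ℝ} {n : ℕ} {t τ : ℕ → ℝ} (hG : IsGrid D.lo D.hi h n t τ) {i : ℕ}
    (hi : i < n) : 0 < D.cellMass τ i :=
  intervalIntegral.intervalIntegral_pos_of_pos (D.continuous_f.intervalIntegrable _ _) D.f_pos
    (hG.cell_lt i hi)

variable {D} in
lemma cellMass_mul_cellLam {h : ℝ} {n : ℕ} {t τ : ℕ → ℝ} (hG : IsGrid D.lo D.hi h n t τ) {i : ℕ}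
    (hi : i < n) : D.cellMass τ i * D.cellLam τ i = ∫ s in τ i..τ (i + 1), D.lam s * D.f s :=
  mul_div_cancel₀ _ (cellMass_pos hG hi).ne'

variable {D} in
lemma cellMass_mul_one_sub {h : ℝ} {n : ℕ} {t τ : ℕ → ℝ} (hG : IsGrid D.lo D.hi h n t τ) {i : ℕ}
    (hi : i < n) : D.cellMass τ i * (1 - D.cellLam τ i) =
      ∫ s in τ i..τ (i + 1), (1 - D.lam s) * D.f s := by
  rw [mul_sub, cellMass_mul_cellLam hG hi, mul_one, cellMass, ← intervalIntegral.integral_sub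
    (D.continuous_f.intervalIntegrable _ _)
    (g := fun s => D.lam s * D.f s) ((D.continuous_lam.mul D.continuous_f).intervalIntegrable _ _)]
  exact intervalIntegral.integral_congr fun s _ => by ring

lemma _root_.IsGrid.monotone {lo hi h : ℝ} {n : ℕ} {t τ : ℕ → ℝ} (hG : IsGrid lo hi h n t τ)
    {i j : ℕ} (hij : i ≤ j) (hj : j ≤ n) : τ i ≤ τ j := by
  induction j with
  | zero => obtain rfl : i = 0 := by omega
            exact le_rfl
  | succ j ih =>
    rcases eq_or_lt_of_le hij with rfl | h1
    · exact le_rfl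
    · exact (ih (by omega) (by omega)).trans (hG.cell_lt j (by omega)).le

lemma _root_.IsGrid.mem_Icc {lo hi h : ℝ} {n : ℕ} {t τ : ℕ → ℝ} (hG : IsGrid lo hi h n t τ)
    {i : ℕ} (hin : i ≤ n) : τ i ∈ Icc lo hi := by
  have h1 := hG.monotone (Nat.zero_le i) hin
  have h2 := hG.monotone hin le_rfl
  rw [hG.left] at h1
  rw [hG.right] at h2
  exact ⟨h1, h2⟩

variable {D} in
-- The `f`-weighted average of `λ` over a cell lies between the values of `λ` at its endpoints.
lemma cellLam_antitone {h : ℝ} {n : ℕ} {t τ : ℕ → ℝ} (hG : IsGrid D.lo D.hi h n t τ)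
    {i j : ℕ} (hij : i ≤ j) (hj : j < n) : D.cellLam τ j ≤ D.cellLam τ i := by
  have c1 := D.continuous_f
  have c2 := D.continuous_lam
  have hup : ∀ k < n, D.cellLam τ k ≤ D.lam (τ k) := by
    intro k hk
    refine (div_le_iff₀ (cellMass_pos hG hk)).mpr ?_
    rw [cellMass, ← intervalIntegral.integral_const_mul]
    refine intervalIntegral.integral_mono_on (hG.cell_lt k hk).le
      (Continuous.intervalIntegrable (by fun_prop) _ _)
      (Continuous.intervalIntegrable (by fun_prop) _ _) fun s hs => ?_
    exact mul_le_mul_of_nonneg_right (D.antitone_lam hs.1) (D.f_pos s).le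
  have hdown : ∀ k < n, D.lam (τ (k + 1)) ≤ D.cellLam τ k := by
    intro k hk
    refine (le_div_iff₀ (cellMass_pos hG hk)).mpr ?_
    rw [cellMass, ← intervalIntegral.integral_const_mul]
    refine intervalIntegral.integral_mono_on (hG.cell_lt k hk).le
      (Continuous.intervalIntegrable (by fun_prop) _ _)
      (Continuous.intervalIntegrable (by fun_prop) _ _) fun s hs => ?_
    exact mul_le_mul_of_nonneg_right (D.antitone_lam hs.2) (D.f_pos s).le
  rcases eq_or_lt_of_le hij with rfl | hlt
  · exact le_rfl
  · exact (hup j hj).trans ((D.antitone_lam (hG.monotone (Nat.succ_le_of_lt hlt) hj.le)).trans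
      (hdown i (by omega)))

lemma abs_weight_le (t : ℝ) : |(1 - D.lam t) * D.f t| ≤ (1 + D.B) * D.B := by
  rw [abs_mul]
  refine mul_le_mul ?_ (D.abs_f_le t) (abs_nonneg _) (by linarith [D.B_nonneg])
  calc |1 - D.lam t| ≤ |1| + |D.lam t| := abs_sub _ _
    _ ≤ 1 + D.B := by simpa using D.abs_lam_le t

lemma abs_integral_le_of_le {c d C : ℝ} (hcd : c ≤ d) {g : ℝ → ℝ}
    (hg : ∀ s ∈ Icc c d, |g s| ≤ C) : |∫ s in c..d, g s| ≤ C * (d - c) := by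
  have := intervalIntegral.norm_integral_le_of_norm_le_const (a := c) (b := d) (f := g) (C := C)
    (fun s hs => by
      rw [uIoc_of_le hcd] at hs
      exact hg s ⟨hs.1.le, hs.2⟩)
  rwa [Real.norm_eq_abs, abs_of_nonneg (sub_nonneg.mpr hcd)] at this

lemma _root_.IsGrid.sum_length {lo hi h : ℝ} {n : ℕ} {t τ : ℕ → ℝ} (hG : IsGrid lo hi h n t τ) :
    ∑ i ∈ Finset.range n, (τ (i + 1) - τ i) = hi - lo := by
  rw [Finset.sum_range_sub, hG.left, hG.right]

lemma _root_.IsGrid.sum_integral {lo hi h : ℝ} {n : ℕ} {t τ : ℕ → ℝ} (hG : IsGrid lo hi h n t τ)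
    {g : ℝ → ℝ} (hg : ∀ i < n, IntervalIntegrable g volume (τ i) (τ (i + 1))) :
    ∑ i ∈ Finset.range n, ∫ s in τ i..τ (i + 1), g s = ∫ s in lo..hi, g s := by
  rw [intervalIntegral.sum_integral_adjacent_intervals hg, hG.left, hG.right]

/-- Comparison of a relaxed continuous problem with its discretisation. -/
lemma le_discreteObjective {h η : ℝ} {n : ℕ} {t τ : ℕ → ℝ} (hG : IsGrid D.lo D.hi h n t τ)
    (hη : 0 ≤ η) (hhη : h ≤ η)
    (hf : ∀ s ∈ Icc D.lo D.hi, ∀ s' ∈ Icc D.lo D.hi, |s - s'| ≤ h → |D.f s - D.f s'| ≤ η)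
    {u g : ℝ → ℝ} {C Lu : ℝ} (hLu : 0 ≤ Lu)
    (hu : ∀ s ∈ Icc D.lo D.hi, ∀ s' ∈ Icc D.lo D.hi, |u s - u s'| ≤ Lu * |s - s'|)
    (hC : ∀ s, |g s| ≤ C) (hgi : IntervalIntegrable (fun s => g s * D.f s) volume D.lo D.hi)
    (hshift : ∫ s in D.lo..D.hi, g s * D.f s ≤ h * ∑ i ∈ Finset.range n, g (t i) * D.f (t i))
    {ι : Type*} (S : ι → ℕ → ℝ) (c : ℕ → ι) (hS : ∀ i < n, g (t i) - η ≤ S (c i) i)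
    (u' : ℕ → ℝ) (hu' : ∀ i < n, |u' i - u (t i)| ≤ η) :
    (∫ s in D.lo..D.hi, (g s - (1 - D.lam s) * u s) * D.f s) -
        η * (D.B * (D.hi - D.lo) + C * ((D.hi - D.lo) + 2 * D.B) +
          (1 + D.B) * D.B * (D.hi - D.lo) * (1 + Lu)) ≤
      discreteObjective n (D.cellMass τ) (D.cellLam τ) S c u' := by
  have hC0 : 0 ≤ C := (abs_nonneg _).trans (hC 0)
  have hB := D.B_nonneg
  have hh0 : 0 ≤ h := (abs_nonneg _).trans (hG.length_le 0 hG.pos _ (hG.mem_cell 0 hG.pos))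
  have hMB : 0 ≤ (1 + D.B) * D.B := by positivity
  have hucont : ContinuousOn u (Icc D.lo D.hi) := by
    have : LipschitzOnWith ⟨Lu, hLu⟩ u (Icc D.lo D.hi) := by
      refine LipschitzOnWith.of_dist_le_mul fun s hs s' hs' => ?_
      exact hu s hs s' hs'
    exact this.continuousOn
  have hwu : IntervalIntegrable (fun s => (1 - D.lam s) * D.f s * u s) volume D.lo D.hi := by
    refine ContinuousOn.intervalIntegrable ?_
    rw [uIcc_of_le D.lo_lt_hi.le]
    exact D.continuous_weight.continuousOn.mul hucont
  -- surplus part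
  have h1 : (∫ s in D.lo..D.hi, g s * D.f s) -
      η * (D.B * (D.hi - D.lo) + C * ((D.hi - D.lo) + 2 * D.B)) ≤
      ∑ i ∈ Finset.range n, D.cellMass τ i * S (c i) i := by
    have hterm : ∀ i ∈ Finset.range n, h * (g (t i) * D.f (t i)) -
        (η * D.B * (τ (i + 1) - τ i) +
          C * (η * (τ (i + 1) - τ i) + D.B * |τ (i + 1) - τ i - h|)) ≤
        D.cellMass τ i * S (c i) i := by
      intro i hi
      have hi := Finset.mem_range.mp hi
      have hlen := sub_nonneg.mpr (hG.cell_lt i hi).le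
      have hm0 := cellMass_pos hG hi
      have hmB : D.cellMass τ i ≤ D.B * (τ (i + 1) - τ i) :=
        (le_abs_self _).trans (abs_integral_le_of_le (hG.cell_lt i hi).le fun s _ => D.abs_f_le s)
      have hmf : |D.cellMass τ i - (τ (i + 1) - τ i) * D.f (t i)| ≤ η * (τ (i + 1) - τ i) := by
        have : D.cellMass τ i - (τ (i + 1) - τ i) * D.f (t i) =
            ∫ s in τ i..τ (i + 1), (D.f s - D.f (t i)) := by
          rw [intervalIntegral.integral_sub (D.continuous_f.intervalIntegrable _ _)
            intervalIntegrable_const, intervalIntegral.integral_const, cellMass, smul_eq_mul]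
        rw [this]
        refine abs_integral_le_of_le (hG.cell_lt i hi).le fun s hs => ?_
        refine hf s ?_ (t i) (Ioo_subset_Icc_self (hG.mem i hi)) (hG.length_le i hi s hs)
        exact ⟨(hG.mem_Icc hi.le).1.trans hs.1, hs.2.trans (hG.mem_Icc hi).2⟩
      -- The Riemann sum uses the mesh `h` for every cell, whereas the first and last cells have
      -- other lengths. The resulting deviations sum to at most `2 * h` by `sum_le`.
      have hmf2 : |D.cellMass τ i - h * D.f (t i)| ≤
          η * (τ (i + 1) - τ i) + D.B * |τ (i + 1) - τ i - h| := by
        have : D.cellMass τ i - h * D.f (t i) =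
            (D.cellMass τ i - (τ (i + 1) - τ i) * D.f (t i)) +
              D.f (t i) * (τ (i + 1) - τ i - h) := by ring
        rw [this]
        refine (abs_add_le _ _).trans (add_le_add hmf ?_)
        rw [abs_mul]
        exact mul_le_mul_of_nonneg_right (D.abs_f_le _) (abs_nonneg _)
      have h2 : D.cellMass τ i * (g (t i) - η) ≤ D.cellMass τ i * S (c i) i :=
        mul_le_mul_of_nonneg_left (hS i hi) hm0.le
      have h3 : |(D.cellMass τ i - h * D.f (t i)) * g (t i)| ≤
          (η * (τ (i + 1) - τ i) + D.B * |τ (i + 1) - τ i - h|) * C := by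
        rw [abs_mul]
        exact mul_le_mul hmf2 (hC _) (abs_nonneg _) ((abs_nonneg _).trans hmf2)
      have h4 := (abs_le.mp h3).1
      have h5 : η * D.cellMass τ i ≤ η * (D.B * (τ (i + 1) - τ i)) :=
        mul_le_mul_of_nonneg_left hmB hη
      nlinarith
    have hsum := Finset.sum_le_sum hterm
    rw [Finset.sum_sub_distrib, ← Finset.mul_sum, Finset.sum_add_distrib, ← Finset.mul_sum,
      ← Finset.mul_sum, Finset.sum_add_distrib, ← Finset.mul_sum, ← Finset.mul_sum,
      hG.sum_length] at hsum
    have h6 : C * (D.B * ∑ i ∈ Finset.range n, |τ (i + 1) - τ i - h|) ≤ C * (D.B * (2 * η)) := by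
      refine mul_le_mul_of_nonneg_left (mul_le_mul_of_nonneg_left ?_ hB) hC0
      linarith [hG.sum_le]
    nlinarith
  -- rent part
  have h2 : ∑ i ∈ Finset.range n, D.cellMass τ i * ((1 - D.cellLam τ i) * u' i) ≤
      (∫ s in D.lo..D.hi, (1 - D.lam s) * D.f s * u s) +
        η * ((1 + D.B) * D.B * (D.hi - D.lo) * (1 + Lu)) := by
    have hint : ∀ i < n, IntervalIntegrable (fun s => (1 - D.lam s) * D.f s * u s) volume
        (τ i) (τ (i + 1)) := by
      intro i hi
      refine hwu.mono_set ?_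
      rw [uIcc_of_le (hG.cell_lt i hi).le, uIcc_of_le D.lo_lt_hi.le]
      exact Icc_subset_Icc (hG.mem_Icc hi.le).1 (hG.mem_Icc hi).2
    rw [← hG.sum_integral hint]
    have hterm : ∀ i ∈ Finset.range n, D.cellMass τ i * ((1 - D.cellLam τ i) * u' i) ≤
        (∫ s in τ i..τ (i + 1), (1 - D.lam s) * D.f s * u s) +
          η * ((1 + D.B) * D.B * (1 + Lu)) * (τ (i + 1) - τ i) := by
      intro i hi
      have hi := Finset.mem_range.mp hi
      rw [← mul_assoc, cellMass_mul_one_sub hG hi, ← intervalIntegral.integral_mul_const,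
        ← sub_le_iff_le_add', ← intervalIntegral.integral_sub
          ((D.continuous_weight.intervalIntegrable _ _).mul_const _) (hint i hi)]
      refine (le_abs_self _).trans (abs_integral_le_of_le (hG.cell_lt i hi).le fun s hs => ?_)
      have hs' : s ∈ Icc D.lo D.hi :=
        ⟨(hG.mem_Icc hi.le).1.trans hs.1, hs.2.trans (hG.mem_Icc hi).2⟩
      rw [← mul_sub, abs_mul]
      have h3 : |u' i - u s| ≤ η * (1 + Lu) := by
        have e1 := hu' i hi
        have e2 := hu (t i) (Ioo_subset_Icc_self (hG.mem i hi)) s hs'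
        have e3 := hG.length_le i hi s hs
        rw [abs_sub_comm] at e3
        have e4 : Lu * |t i - s| ≤ Lu * η := mul_le_mul_of_nonneg_left (e3.trans hhη) hLu
        calc |u' i - u s| = |(u' i - u (t i)) + (u (t i) - u s)| := by ring_nf
          _ ≤ _ := abs_add_le _ _
          _ ≤ η * (1 + Lu) := by linarith
      calc _ ≤ (1 + D.B) * D.B * (η * (1 + Lu)) :=
            mul_le_mul (D.abs_weight_le s) h3 (abs_nonneg _) hMB
        _ = _ := by ring
    refine (Finset.sum_le_sum hterm).trans (le_of_eq ?_)
    rw [Finset.sum_add_distrib, ← Finset.mul_sum, hG.sum_length]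
    ring
  have h3 : ∫ s in D.lo..D.hi, (g s - (1 - D.lam s) * u s) * D.f s =
      (∫ s in D.lo..D.hi, g s * D.f s) - ∫ s in D.lo..D.hi, (1 - D.lam s) * D.f s * u s := by
    rw [← intervalIntegral.integral_sub hgi hwu]
    exact intervalIntegral.integral_congr fun s _ => by ring
  have h4 : discreteObjective n (D.cellMass τ) (D.cellLam τ) S c u' =
      ∑ i ∈ Finset.range n, D.cellMass τ i * S (c i) i -
        ∑ i ∈ Finset.range n, D.cellMass τ i * ((1 - D.cellLam τ i) * u' i) := by
    rw [discreteObjective, ← Finset.sum_sub_distrib]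
    exact Finset.sum_congr rfl fun i _ => by ring
  rw [h3, h4]
  linarith

/-- The value at `s` of the index of the cell that contains `s`. -/
def cellIndex (n : ℕ) (t : ℕ → ℝ) (s : ℝ) : ℕ :=
  ((Finset.Ico 1 n).filter fun i => t i ≤ s).card

lemma monotone_cellIndex (n : ℕ) (t : ℕ → ℝ) : Monotone (cellIndex n t) := fun s s' hss =>
  Finset.card_le_card fun i hi => by
    simp only [Finset.mem_filter] at hi ⊢
    exact ⟨hi.1, hi.2.trans hss⟩

lemma cellIndex_lt {n : ℕ} (hn : 0 < n) (t : ℕ → ℝ) (s : ℝ) : cellIndex n t s < n := by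
  refine (Finset.card_filter_le _ _).trans_lt ?_
  simp; omega

lemma cellIndex_eq {lo hi h : ℝ} {n : ℕ} {t τ : ℕ → ℝ} (hG : IsGrid lo hi h n t τ) {i : ℕ}
    (hin : i < n) {s : ℝ} (hs : s ∈ Ico (τ i) (τ (i + 1))) : cellIndex n t s = i := by
  have : (Finset.Ico 1 n).filter (fun j => t j ≤ s) = Finset.Ico 1 (i + 1) := by
    ext j
    simp only [Finset.mem_filter, Finset.mem_Ico]
    constructor
    · rintro ⟨⟨h1, h2⟩, h3⟩
      refine ⟨h1, ?_⟩
      by_contra hlt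
      rw [← hG.eq j h1 h2] at h3
      have := hG.monotone (i := i + 1) (j := j) (by omega) h2.le
      linarith [hs.2]
    · rintro ⟨h1, h2⟩
      refine ⟨⟨h1, by omega⟩, ?_⟩
      rw [← hG.eq j h1 (by omega)]
      exact (hG.monotone (by omega) hin.le).trans hs.1
  rw [cellIndex, this]; simp

/-- The virtual surplus of a monotone step rule is at least its discrete relaxed objective. -/
lemma discreteObjective_le_virtual {h η : ℝ} {n : ℕ} {t τ : ℕ → ℝ}
    (hG : IsGrid D.lo D.hi h n t τ) (hhη : h ≤ η) (ρ : ProbabilityMeasure X → ℝ) {K : ℝ}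
    (b : ℕ → ProbabilityMeasure X) (u : ℕ → ℝ)
    (hic : DownwardIC n (fun a i => D.val a (t i)) K b u) :
    discreteObjective n (D.cellMass τ) (D.cellLam τ) (fun a i => D.val a (t i) - ρ a) b u -
        η * (D.B * D.B * D.B * (D.hi - D.lo) + D.G D.lo * D.B) ≤
      D.virtual ρ (fun s => b (cellIndex n t s)) := by
  have hB := D.B_nonneg
  have hh0 : 0 ≤ h := (abs_nonneg _).trans (hG.length_le 0 hG.pos _ (hG.mem_cell 0 hG.pos))
  set p : ℕ → ℝ := fun i => D.val (b i) (t i) - u i with hp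
  have cG := D.continuous_G
  have cf := D.continuous_f
  have cl := D.continuous_lam
  have hcont : ∀ a, Continuous fun s => (D.val a s - ρ a) * D.f s - D.G s * D.valt a s := by
    intro a
    have c1 := D.continuous_val a
    have c2 := D.continuous_valt a
    fun_prop
  have hcell : ∀ i < n, ∀ s ∈ Ioo (τ i) (τ (i + 1)),
      (D.val (b i) s - ρ (b i)) * D.f s - D.G s * D.valt (b i) s =
      (D.val (b (cellIndex n t s)) s - ρ (b (cellIndex n t s))) * D.f s -
        D.G s * D.valt (b (cellIndex n t s)) s := by
    intro i hi s hs
    rw [cellIndex_eq hG hi ⟨hs.1.le, hs.2⟩]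
  have hint : ∀ i < n, IntervalIntegrable (fun s =>
      (D.val (b (cellIndex n t s)) s - ρ (b (cellIndex n t s))) * D.f s -
        D.G s * D.valt (b (cellIndex n t s)) s) volume (τ i) (τ (i + 1)) := by
    intro i hi
    have hle := (hG.cell_lt i hi).le
    rw [intervalIntegrable_iff_integrableOn_Ioo_of_le hle]
    refine IntegrableOn.congr_fun ?_ (hcell i hi) measurableSet_Ioo
    rw [← intervalIntegrable_iff_integrableOn_Ioo_of_le hle]
    exact (hcont (b i)).intervalIntegrable _ _
  -- `A i` is `G` times the rent of type `τ i` from the option of its own cell. Integration by parts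
  -- on each cell leaves boundary terms. At `τ (i + 1) = t (i + 1)` the downward constraint says
  -- that this type weakly prefers its own option, so with `G ≥ 0` the terms telescope in the right
  -- direction. At the top they vanish because `G hi = 0`, whence the value `0` of `A n`.
  set A : ℕ → ℝ := fun i => if i < n then D.G (τ i) * (D.val (b i) (τ i) - p i) else 0 with hA
  have hterm : ∀ i ∈ Finset.range n, D.cellMass τ i * ((D.val (b i) (t i) - ρ (b i)) -
      (1 - D.cellLam τ i) * u i) - η * (D.B * D.B * D.B) * (τ (i + 1) - τ i) + (A i - A (i + 1)) ≤
      ∫ s in τ i..τ (i + 1), ((D.val (b (cellIndex n t s)) s - ρ (b (cellIndex n t s))) * D.f s -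
        D.G s * D.valt (b (cellIndex n t s)) s) := by
    intro i hi
    have hi := Finset.mem_range.mp hi
    have hlt := hG.cell_lt i hi
    have c1 := D.continuous_val (b i)
    have c2 := D.continuous_valt (b i)
    have e1 : ∫ s in τ i..τ (i + 1),
        ((D.val (b (cellIndex n t s)) s - ρ (b (cellIndex n t s))) * D.f s -
          D.G s * D.valt (b (cellIndex n t s)) s) =
        ∫ s in τ i..τ (i + 1), ((D.val (b i) s - ρ (b i)) * D.f s - D.G s * D.valt (b i) s) := by
      rw [intervalIntegral.integral_of_le hlt.le, intervalIntegral.integral_of_le hlt.le,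
        integral_Ioc_eq_integral_Ioo, integral_Ioc_eq_integral_Ioo]
      exact (setIntegral_congr_fun measurableSet_Ioo (hcell i hi)).symm
    have e2 : ∫ s in τ i..τ (i + 1),
        ((D.val (b i) s - ρ (b i)) * D.f s - D.G s * D.valt (b i) s) =
        (∫ s in τ i..τ (i + 1), (D.val (b i) s * D.f s - D.G s * D.valt (b i) s)) -
          ρ (b i) * D.cellMass τ i := by
      rw [cellMass, ← intervalIntegral.integral_const_mul, ← intervalIntegral.integral_sub]
      · exact intervalIntegral.integral_congr fun s _ => by ring
      all_goals exact Continuous.intervalIntegrable (by fun_prop) _ _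
    have e3 := D.integral_virtual (b i) (hG.mem_Icc hi.le).1 hlt.le (hG.mem_Icc hi).2
    have e4 : D.cellMass τ i * D.cellLam τ i * D.val (b i) (t i) - η * (D.B * D.B * D.B) *
        (τ (i + 1) - τ i) ≤ ∫ s in τ i..τ (i + 1), D.lam s * D.f s * D.val (b i) s := by
      rw [cellMass_mul_cellLam hG hi, ← intervalIntegral.integral_mul_const, sub_le_comm,
        ← intervalIntegral.integral_sub]
      · refine (le_abs_self _).trans (abs_integral_le_of_le hlt.le fun s hs => ?_)
        rw [← mul_sub, abs_mul, abs_mul]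
        have k1 : |D.val (b i) (t i) - D.val (b i) s| ≤ D.B * η := by
          refine (D.lipschitz_val _ _ _).trans (mul_le_mul_of_nonneg_left ?_ hB)
          rw [abs_sub_comm]
          exact (hG.length_le i hi s hs).trans hhη
        calc |D.lam s| * |D.f s| * |D.val (b i) (t i) - D.val (b i) s|
            ≤ D.B * D.B * (D.B * η) := mul_le_mul (mul_le_mul (D.abs_lam_le s) (D.abs_f_le s)
              (abs_nonneg _) hB) k1 (abs_nonneg _) (by positivity)
          _ = _ := by ring
      all_goals exact Continuous.intervalIntegrable (by fun_prop) _ _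
    have e5 : D.cellMass τ i * (1 - D.cellLam τ i) = D.G (τ i) - D.G (τ (i + 1)) := by
      rw [cellMass_mul_one_sub hG hi, D.G_sub]
    have e6 : A i - A (i + 1) ≤ D.G (τ i) * (D.val (b i) (τ i) - p i) -
        D.G (τ (i + 1)) * (D.val (b i) (τ (i + 1)) - p i) := by
      simp only [hA, if_pos hi]
      by_cases hi1 : i + 1 < n
      · rw [if_pos hi1]
        have k1 := hic.2 i (i + 1) (by omega) hi1
        rw [hG.eq (i + 1) (by omega) hi1]
        have k2 := D.G_nonneg (Ioo_subset_Icc_self (hG.mem (i + 1) hi1))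
        simp only [hp]
        simp only at k1
        have k3 : D.val (b i) (t (i + 1)) - (D.val (b i) (t i) - u i) ≤
          D.val (b (i + 1)) (t (i + 1)) - (D.val (b (i + 1)) (t (i + 1)) - u (i + 1)) := by linarith
        have := mul_le_mul_of_nonneg_left k3 k2
        linarith
      · have : i + 1 = n := by omega
        rw [if_neg hi1, this, hG.right, D.G_hi]
        simp
    rw [e1, e2, e3]
    have e7 : D.cellMass τ i * ((D.val (b i) (t i) - ρ (b i)) - (1 - D.cellLam τ i) * u i) =
        D.cellMass τ i * D.cellLam τ i * D.val (b i) (t i) + (D.G (τ i) - D.G (τ (i + 1))) * p i -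
          ρ (b i) * D.cellMass τ i := by
      rw [← e5]; simp only [hp]; ring
    rw [e7]
    nlinarith
  have hsum := Finset.sum_le_sum hterm
  rw [hG.sum_integral hint, Finset.sum_add_distrib, Finset.sum_range_sub',
    Finset.sum_sub_distrib, ← Finset.mul_sum, hG.sum_length] at hsum
  -- The utility `u 0 ≥ 0` belongs to `t 0`, not to `lo`. The Lipschitz bound over the distance
  -- between them costs `D.B * η`.
  have hA0 : -(η * (D.G D.lo * D.B)) ≤ A 0 - A n := by
    simp only [hA, if_pos hG.pos, lt_irrefl, if_false, hG.left, hp]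
    have k1 := D.lipschitz_val (b 0) D.lo (t 0)
    have k2 := hG.length_le 0 hG.pos D.lo ⟨hG.left.le, by
      rw [← hG.left]; exact (hG.cell_lt 0 hG.pos).le⟩
    have k3 := (hic.1 0).1
    have k4 := D.G_nonneg (left_mem_Icc.mpr D.lo_lt_hi.le)
    have k5 : D.B * |D.lo - t 0| ≤ D.B * η := mul_le_mul_of_nonneg_left (k2.trans hhη) hB
    have k6 := (abs_le.mp k1).1
    have k7 : -(D.B * η) ≤ D.val (b 0) D.lo - (D.val (b 0) (t 0) - u 0) := by linarith
    have := mul_le_mul_of_nonneg_left k7 k4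
    linarith
  have : discreteObjective n (D.cellMass τ) (D.cellLam τ) (fun a i => D.val a (t i) - ρ a) b u =
      ∑ i ∈ Finset.range n, D.cellMass τ i * ((D.val (b i) (t i) - ρ (b i)) -
      (1 - D.cellLam τ i) * u i) := rfl
  rw [this]
  unfold virtual
  linarith

end

end ExtendedScreening

/-! ### From relaxed solutions to monotone rules -/

namespace ExtendedScreening

noncomputable section

set_option linter.unusedSectionVars false

variable {X : Type*} [MetricSpace X] [CompactSpace X] [MeasurableSpace X] [BorelSpace X]
  (D : ExtendedScreening X)

/-- A relaxed solution whose allocations can be improved, along any finite grid, by lotteries of a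
chain that lies in `S` is dominated, up to `ε`, by a monotone rule with values in `S`. -/
theorem exists_monotone_rule {S : Set (ProbabilityMeasure X)} {ρ : ProbabilityMeasure X → ℝ}
    {u g : ℝ → ℝ} {C K Lu : ℝ} (hLu : 0 ≤ Lu) {N : Set ℝ} (hN : volume N = 0)
    (hu0 : ∀ s ∈ Icc D.lo D.hi, u s ∈ Icc 0 K)
    (hu : ∀ s ∈ Icc D.lo D.hi, ∀ s' ∈ Icc D.lo D.hi, |u s - u s'| ≤ Lu * |s - s'|)
    (hC : ∀ s, |g s| ≤ C) (hgi : IntervalIntegrable (fun s => g s * D.f s) volume D.lo D.hi)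
    (hgrid : ∀ (n : ℕ) (t : ℕ → ℝ), (∀ i < n, t i ∈ Ioo D.lo D.hi ∧ t i ∉ N) →
      (∀ i j, i < j → j < n → t i < t j) → ∀ η > 0, ∃ c : ℕ → ProbabilityMeasure X,
        (∀ i < n, c i ∈ S) ∧
        (∀ i < n, ∀ j < n, D.kapL (c i) ≤ D.kapL (c j) → D.SteeperLE (c i) (c j)) ∧
        (∀ i < n, g (t i) - η ≤ D.val (c i) (t i) - ρ (c i)) ∧
        ∀ i j, i < j → j < n →
          D.val (c i) (t j) - D.val (c i) (t i) ≤ u (t j) - u (t i) + η)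
    {ε : ℝ} (hε : 0 < ε) :
    ∃ b : ℝ → ProbabilityMeasure X, (∀ s, b s ∈ S) ∧ (∀ s s', s ≤ s' → D.SteeperLE (b s) (b s')) ∧
      (∫ s in D.lo..D.hi, (g s - (1 - D.lam s) * u s) * D.f s) - ε ≤ D.virtual ρ b := by
  have hC0 : 0 ≤ C := (abs_nonneg _).trans (hC 0)
  have hB := D.B_nonneg
  have hlt := D.lo_lt_hi
  have hL : 0 < D.hi - D.lo := sub_pos.mpr hlt
  have hG0 := D.G_nonneg (left_mem_Icc.mpr hlt.le)
  set Q₁ : ℝ := D.B * (D.hi - D.lo) + C * ((D.hi - D.lo) + 2 * D.B) +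
          (1 + D.B) * D.B * (D.hi - D.lo) * (1 + Lu) with hQ₁
  set Q₂ : ℝ := D.B * D.B * D.B * (D.hi - D.lo) + D.G D.lo * D.B with hQ₂
  have hQ₁0 : 0 ≤ Q₁ := by positivity
  have hQ₂0 : 0 ≤ Q₂ := by positivity
  -- The errors are `η * Q₁` from sampling, `η` from the exchange argument and `η * Q₂` from the
  -- return to a step rule; together they make `ε`.
  set η : ℝ := ε / (Q₁ + Q₂ + 1) with hη
  have hη0 : 0 < η := by positivity
  have hηε : η * (Q₁ + Q₂ + 1) = ε := by rw [hη]; field_simp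
  -- the mesh
  have huc := isCompact_Icc.uniformContinuousOn_of_continuous
    (D.continuous_f.continuousOn (s := Icc D.lo D.hi))
  obtain ⟨δ, hδ0, hδ⟩ := Metric.uniformContinuousOn_iff.mp huc η hη0
  obtain ⟨m, hm⟩ := exists_nat_gt ((D.hi - D.lo) / min δ η)
  have hmin : 0 < min δ η := lt_min hδ0 hη0
  have hhmin : (D.hi - D.lo) / (m + 2 : ℕ) < min δ η := by
    rw [div_lt_iff₀ (by positivity)]
    rw [div_lt_iff₀ hmin] at hm
    push_cast
    nlinarith
  obtain ⟨θ, hθ, hθN, hθle⟩ := exists_shift hlt hgi hN (n := m + 2) (by omega)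
  have hgr := isGrid_shift hlt hθ m
  set t : ℕ → ℝ := fun i => D.lo + (i + θ) * ((D.hi - D.lo) / (m + 2 : ℕ)) with ht
  set τ : ℕ → ℝ := fun i => if i = 0 then D.lo else if i < m + 2 then
        D.lo + (i + θ) * ((D.hi - D.lo) / (m + 2 : ℕ)) else D.hi with hτ
  set n := m + 2 with hn
  have hθle' : ∫ s in D.lo..D.hi, g s * D.f s ≤
      (D.hi - D.lo) / n * ∑ i ∈ Finset.range n, g (t i) * D.f (t i) := hθle
  clear_value t τ n
  have hn0 : (0 : ℝ) < n := by exact_mod_cast hgr.pos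
  obtain ⟨c, hcS, hcLE, hcg, hcic⟩ := hgrid n t (fun i hi => ⟨hgr.mem i hi, by
    simpa [ht] using hθN i hi⟩) hgr.lt (η / n) (by positivity)
  have hηn : η / n ≤ η := div_le_self hη0.le (by exact_mod_cast hgr.pos)
  have hidx : ∀ i < n, (i : ℝ) * (η / n) ≤ η := by
    intro i hi
    have : (i : ℝ) ≤ n := by exact_mod_cast hi.le
    calc (i : ℝ) * (η / n) ≤ n * (η / n) := mul_le_mul_of_nonneg_right this (by positivity)
      _ = η := by field_simp
  -- The replaced allocations meet the constraints only up to `η / n`. The ramp `i * (η / n)` grows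
  -- by at least that much between distinct grid points and restores them exactly.
  set u' : ℕ → ℝ := fun i => if i < n then u (t i) + i * (η / n) else 0 with hu'
  have hK : 0 ≤ K := (hu0 D.lo (left_mem_Icc.mpr hlt.le)).1.trans
    (hu0 D.lo (left_mem_Icc.mpr hlt.le)).2
  have htI : ∀ i < n, t i ∈ Icc D.lo D.hi := fun i hi => Ioo_subset_Icc_self (hgr.mem i hi)
  have htle : ∀ i j, i ≤ j → j < n → t i ≤ t j := fun i j hij hj => by
    rcases eq_or_lt_of_le hij with rfl | h1
    · exact le_rfl
    · exact (hgr.lt i j h1 hj).le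
  have hdown : DownwardIC n (fun a i => D.val a (t i)) (K + η) c u' := by
    refine ⟨fun i => ?_, fun i j hij hj => ?_⟩
    · simp only [hu']
      split_ifs with hi
      · have h1 := hu0 _ (htI i hi)
        have h2 := hidx i hi
        have h3 : 0 ≤ (i : ℝ) * (η / n) := by positivity
        exact ⟨by linarith [h1.1], by linarith [h1.2]⟩
      · exact ⟨le_rfl, by positivity⟩
    · simp only [hu', if_pos hj, if_pos (hij.trans hj)]
      have h1 := hcic i j hij hj
      have h2 : (i : ℝ) + 1 ≤ j := by exact_mod_cast hij
      have h3 : ((i : ℝ) + 1) * (η / n) ≤ j * (η / n) :=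
        mul_le_mul_of_nonneg_right h2 (by positivity)
      linarith
  obtain ⟨σ, u'', hσ, hdown', hmono, hobj⟩ := exists_monotone_downwardIC n (D.cellMass τ)
    (D.cellLam τ) (fun a i => D.val a (t i)) (fun a i => D.val a (t i) - ρ a) D.kapL (K + η) c u'
    (fun i hi => cellMass_pos hgr hi) (fun i j hij hj => cellLam_antitone hgr hij hj)
    (fun l _ i j hij hj => D.monotone_val _ (htle i j hij hj))
    (fun l hl l' hl' hle i j hij hj => (hcLE l hl l' hl' hle).1 _ _ (htle i j hij hj))
    (fun l hl l' hl' hle i j hij hj => by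
      have := (hcLE l hl l' hl' hle).1 _ _ (htle i j hij hj)
      linarith) hdown η hη0
  have hlow := D.le_discreteObjective hgr hη0.le (hhmin.le.trans (min_le_right _ _))
    (fun s hs s' hs' hss => (hδ s hs s' hs' (by
      rw [Real.dist_eq]; exact hss.trans_lt (hhmin.trans_le (min_le_left _ _)))).le)
    hLu hu hC hgi hθle' (fun a i => D.val a (t i) - ρ a) c
    (fun i hi => by have := hcg i hi; linarith) u' (fun i hi => by
      simp only [hu', if_pos hi]
      rw [add_sub_cancel_left, abs_of_nonneg (by positivity)]
      exact hidx i hi)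
  have hup := D.discreteObjective_le_virtual hgr (hhmin.le.trans (min_le_right _ _)) ρ
    (fun i => c (σ i)) u'' hdown'
  refine ⟨fun s => c (σ (cellIndex n t s)), fun s => hcS _ (hσ _ (cellIndex_lt hgr.pos t s)),
    fun s s' hss => ?_, ?_⟩
  · exact hcLE _ (hσ _ (cellIndex_lt hgr.pos t s)) _ (hσ _ (cellIndex_lt hgr.pos t s'))
      (hmono _ _ (monotone_cellIndex n t hss) (cellIndex_lt hgr.pos t s'))
  · have h1 : η * Q₁ + η * Q₂ + η = ε := by rw [← hηε]; ring
    have h2 : discreteObjective n (D.cellMass τ) (D.cellLam τ) (fun a i => D.val a (t i) - ρ a)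
      (c ∘ σ) u'' = discreteObjective n (D.cellMass τ) (D.cellLam τ)
        (fun a i => D.val a (t i) - ρ a) (fun i => c (σ i)) u'' := rfl
    linarith

end

end ExtendedScreening

/-! ### Quantile functions of laws on the line -/

/-- The (left-continuous) quantile function of a law on `ℝ`. -/
noncomputable def lawQuantile (μ : Measure ℝ) (θ : ℝ) : ℝ := sInf {z | θ ≤ ProbabilityTheory.cdf μ z}

open Classical in
/-- The quantile function on the open unit interval, extended by `0`. -/
noncomputable def unitQuantile (μ : Measure ℝ) (θ : ℝ) : ℝ :=
  if θ ∈ Ioo (0 : ℝ) 1 then lawQuantile μ θ else 0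

section Quantile

open ProbabilityTheory Filter

lemma lawQuantile_nonempty (μ : Measure ℝ) {θ : ℝ} (hθ : θ < 1) : {z | θ ≤ cdf μ z}.Nonempty :=
  (((tendsto_cdf_atTop μ).eventually (lt_mem_nhds hθ)).exists).imp fun _ h => h.le

lemma lawQuantile_bddBelow (μ : Measure ℝ) {θ : ℝ} (hθ : 0 < θ) : BddBelow {z | θ ≤ cdf μ z} := by
  obtain ⟨z, hz⟩ := ((tendsto_cdf_atBot μ).eventually (gt_mem_nhds hθ)).exists
  refine ⟨z, fun w hw => ?_⟩
  by_contra hlt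
  push Not at hlt
  have h1 : cdf μ w ≤ cdf μ z := monotone_cdf μ hlt.le
  have h2 : θ ≤ cdf μ w := hw
  linarith

/-- The Galois connection between quantile and distribution function. Right-continuity of the latter
puts the infimum itself in the set. -/
lemma lawQuantile_le_iff (μ : Measure ℝ) {θ : ℝ} (hθ : θ ∈ Ioo (0 : ℝ) 1) (z : ℝ) :
    lawQuantile μ θ ≤ z ↔ θ ≤ cdf μ z := by
  constructor
  · intro h
    refine le_trans ?_ (monotone_cdf μ h)
    have hrc : Tendsto (cdf μ) (nhdsWithin (lawQuantile μ θ) (Ioi (lawQuantile μ θ)))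
        (nhds (cdf μ (lawQuantile μ θ))) :=
      ((cdf μ).right_continuous _).mono Ioi_subset_Ici_self
    refine ge_of_tendsto hrc ?_
    filter_upwards [self_mem_nhdsWithin] with w hw
    obtain ⟨x, hx, hxw⟩ := exists_lt_of_csInf_lt (lawQuantile_nonempty μ hθ.2) hw
    exact le_trans hx (monotone_cdf μ hxw.le)
  · exact fun h => csInf_le (lawQuantile_bddBelow μ hθ.1) h

/-- By the Galois connection, sublevel sets of the quantile are given by comparing `θ` with a
measurable function of the parameter. This yields joint measurability. -/
lemma measurable_unitQuantile {T : Type*} [MeasurableSpace T] (μ : T → Measure ℝ)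
    (hμ : ∀ z, Measurable fun t => cdf (μ t) z) :
    Measurable fun p : ℝ × T => unitQuantile (μ p.2) p.1 := by
  refine measurable_of_Iic fun z => ?_
  have : (fun p : ℝ × T => unitQuantile (μ p.2) p.1) ⁻¹' Iic z =
      ({p : ℝ × T | p.1 ∈ Ioo (0 : ℝ) 1} ∩ {p | p.1 ≤ cdf (μ p.2) z}) ∪
        ({p : ℝ × T | p.1 ∈ Ioo (0 : ℝ) 1}ᶜ ∩ {_p | 0 ≤ z}) := by
    ext p
    by_cases hp : p.1 ∈ Ioo (0 : ℝ) 1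
    · simp only [unitQuantile, mem_preimage, hp, if_true, mem_Iic, mem_union, mem_inter_iff, mem_ofPred_eq,
        mem_compl_iff, not_true_eq_false, false_and, or_false, true_and]
      exact lawQuantile_le_iff _ hp z
    · simp [unitQuantile, hp, -mem_Ioo]
  rw [this]
  have h1 : MeasurableSet {p : ℝ × T | p.1 ∈ Ioo (0 : ℝ) 1} := measurable_fst measurableSet_Ioo
  exact (h1.inter (measurableSet_le measurable_fst ((hμ z).comp measurable_snd))).union
    (h1.compl.inter (MeasurableSet.const _))

lemma measurable_unitQuantile_left (μ : Measure ℝ) :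
    Measurable (unitQuantile μ) :=
  (measurable_unitQuantile (T := Unit) (fun _ => μ) (fun _ => measurable_const)).comp
    (measurable_id.prodMk (measurable_const (a := ())))

/-- Inverse transform sampling: up to endpoints, the levels whose quantile is at most `z` form an
interval of length `cdf μ z`. -/
lemma map_unitQuantile (μ : Measure ℝ) [IsProbabilityMeasure μ] :
    Measure.map (unitQuantile μ)
      (volume.restrict (Ioo 0 1)) = μ := by
  have : IsProbabilityMeasure (volume.restrict (Ioo (0 : ℝ) 1)) := ⟨by simp⟩
  have hm := measurable_unitQuantile_left μ
  have : IsProbabilityMeasure (Measure.map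
    (unitQuantile μ)
      (volume.restrict (Ioo 0 1))) := Measure.isProbabilityMeasure_map hm.aemeasurable
  refine Measure.ext_of_Iic _ _ fun z => ?_
  rw [Measure.map_apply hm measurableSet_Iic, Measure.restrict_apply (hm measurableSet_Iic),
    ← ofReal_cdf μ z]
  have h0 : 0 ≤ cdf μ z := cdf_nonneg μ z
  have h1 : cdf μ z ≤ 1 := cdf_le_one μ z
  have hset : (unitQuantile μ) ⁻¹' Iic z ∩ Ioo 0 1 =
      Ioo 0 1 ∩ Iic (cdf μ z) := by
    ext θ
    by_cases hp : θ ∈ Ioo (0 : ℝ) 1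
    · simp only [unitQuantile, mem_inter_iff, mem_preimage, hp, if_true, and_true, true_and, mem_Iic]
      exact lawQuantile_le_iff μ hp z
    · simp [hp, -mem_Ioo]
  rw [hset]
  refine le_antisymm ?_ ?_
  · refine (measure_mono (t := Ioc 0 (cdf μ z)) fun θ hθ => ⟨hθ.1.1, hθ.2⟩).trans ?_
    simp
  · refine le_trans ?_ (measure_mono (s := Ioo 0 (cdf μ z)) fun θ hθ =>
      ⟨⟨hθ.1, hθ.2.trans_le h1⟩, hθ.2.le⟩)
    simp

end Quantile

/-! ### Replacing lotteries by quantiles of steepness -/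

namespace ExtendedScreening

noncomputable section

set_option linter.unusedSectionVars false

variable {X : Type*} [MetricSpace X] [CompactSpace X] [MeasurableSpace X] [BorelSpace X]
  (D : ExtendedScreening X)

/-- A measurable selection of the allocation in `Y` with given steepness. -/
lemma exists_allocation_of_kap {Y : Set X} (hY : MeasurableSet Y) (hne : Y.Nonempty)
    (hinj : InjOn D.kap Y) :
    ∃ io : ℝ → X, Measurable io ∧ (∀ z, io z ∈ Y) ∧ ∀ y ∈ Y, io (D.kap y) = y := by
  classical
  obtain ⟨y₀, hy₀⟩ := hne
  have hm : Measurable D.kap := D.continuous_kap.measurable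
  let io : ℝ → X := fun z => if h : ∃ y ∈ Y, D.kap y = z then h.choose else y₀
  have hio : ∀ y ∈ Y, io (D.kap y) = y := by
    intro y hy
    have h : ∃ y' ∈ Y, D.kap y' = D.kap y := ⟨y, hy, rfl⟩
    simp only [io, dif_pos h]
    exact hinj h.choose_spec.1 hy h.choose_spec.2
  refine ⟨io, fun S hS => ?_, fun z => ?_, hio⟩
  -- Preimages under the selection are, apart from the default `y₀`, images of Borel sets under the
  -- injective map `kap`, hence Borel by Lusin–Souslin.
  · have : io ⁻¹' S = D.kap '' (S ∩ Y) ∪ ((D.kap '' Y)ᶜ ∩ {_z | y₀ ∈ S}) := by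
      ext z
      by_cases h : ∃ y ∈ Y, D.kap y = z
      · obtain ⟨y, hy, rfl⟩ := h
        have h1 : D.kap y ∈ D.kap '' Y := ⟨y, hy, rfl⟩
        simp only [mem_preimage, hio y hy, mem_union, mem_inter_iff, mem_compl_iff, h1,
          not_true_eq_false, false_and, or_false]
        constructor
        · exact fun h => ⟨y, ⟨h, hy⟩, rfl⟩
        · rintro ⟨y', ⟨h1, h2⟩, h3⟩
          rwa [← hinj h2 hy h3]
      · have h1 : z ∉ D.kap '' Y := fun ⟨y, hy, hz⟩ => h ⟨y, hy, hz⟩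
        have h2 : z ∉ D.kap '' (S ∩ Y) := fun ⟨y, hy, hz⟩ => h ⟨y, hy.2, hz⟩
        simp [io, h, h1, h2]
    rw [this]
    exact ((hS.inter hY).image_of_measurable_injOn hm (hinj.mono inter_subset_right)).union
      ((hY.image_of_measurable_injOn hm hinj).compl.inter (MeasurableSet.const _))
  · by_cases h : ∃ y ∈ Y, D.kap y = z
    · obtain ⟨y, hy, rfl⟩ := h
      rwa [hio y hy]
    · simpa [io, h] using hy₀

/-- Dominance is applied to the indicator of `(z, ∞)`, a monotone function of steepness. Hence each
quantile of steepness is monotone in the type. -/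
lemma antitone_cdf_kap {b : ℝ → ProbabilityMeasure X}
    (hb : ∀ s s', s ≤ s' → D.SteeperLE (b s) (b s')) (z : ℝ) :
    Antitone fun t => ProbabilityTheory.cdf (Measure.map D.kap (b t : Measure X)) z := by
  intro s s' hss
  have hm : Measurable D.kap := D.continuous_kap.measurable
  have hprob : ∀ t, IsProbabilityMeasure (Measure.map D.kap (b t : Measure X)) := fun t =>
    Measure.isProbabilityMeasure_map hm.aemeasurable
  have hval : ∀ t, ProbabilityTheory.cdf (Measure.map D.kap (b t : Measure X)) z =
      1 - ∫ y, (Ioi z).indicator 1 (D.kap y) ∂(b t : Measure X) := by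
    intro t
    have := hprob t
    rw [ProbabilityTheory.cdf_eq_real, ← compl_Ioi, probReal_compl_eq_one_sub measurableSet_Ioi,
      map_measureReal_apply hm measurableSet_Ioi, ← integral_indicator_one (hm measurableSet_Ioi)]
    rfl
  have hmono : Monotone ((Ioi z).indicator (1 : ℝ → ℝ)) := by
    intro x x' hxx
    by_cases h : z < x
    · simp [indicator, h, h.trans_le hxx]
    · simp only [indicator, mem_Ioi, h, if_false]
      split_ifs <;> simp
  have := (hb s s' hss).2 _ hmono
  simp only [hval]
  linarith

/-- A monotone rule with values in the lotteries on `Y` is dominated by one of its quantiles,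
a deterministic monotone rule. -/
theorem exists_deterministic_rule {Y : Set X} (hY : MeasurableSet Y) (hne : Y.Nonempty)
    (hinj : InjOn D.kap Y) {b : ℝ → ProbabilityMeasure X}
    (hbY : ∀ t, ∀ᵐ y ∂(b t : Measure X), y ∈ Y)
    (hb : ∀ s s', s ≤ s' → D.SteeperLE (b s) (b s')) {ρ : ℝ → ℝ} (hρ : Continuous ρ) :
    ∃ (y : ℝ → X) (k : ℝ → ℝ), Measurable y ∧ (∀ t, y t ∈ Y) ∧ Monotone k ∧
      (∀ᵐ t, D.kap (y t) = k t) ∧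
      D.virtual (fun a => ∫ x, ρ (D.kap x) ∂(a : Measure X)) b ≤
        ∫ t in D.lo..D.hi, ((D.v (y t) t - ρ (D.kap (y t))) * D.f t - D.G t * D.vt (y t) t) := by
  have hm : Measurable D.kap := D.continuous_kap.measurable
  obtain ⟨io, hiom, hioY, hio⟩ := D.exists_allocation_of_kap hY hne hinj
  -- `q (θ, t)` is the `θ`-quantile of steepness under `b t`. For fixed `t` and uniform `θ` it has
  -- the law of steepness under `b t`; for fixed `θ` in the unit interval it is monotone in `t`.
  set q : ℝ × ℝ → ℝ := fun p =>
    unitQuantile (Measure.map D.kap (b p.2 : Measure X)) p.1 with hq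
  have hqm : Measurable q := measurable_unitQuantile
    (fun t => Measure.map D.kap (b t : Measure X)) fun z => (D.antitone_cdf_kap hb z).measurable
  set ν : Measure ℝ := volume.restrict (Ioo 0 1) with hν
  have hνp : IsProbabilityMeasure ν := ⟨by simp [ν]⟩
  have hprob : ∀ t, IsProbabilityMeasure (Measure.map D.kap (b t : Measure X)) := fun t =>
    Measure.isProbabilityMeasure_map hm.aemeasurable
  have hlaw : ∀ t, Measure.map (fun θ => q (θ, t)) ν = Measure.map D.kap (b t : Measure X) :=
    fun t => by
      have := hprob t
      exact map_unitQuantile (Measure.map D.kap (b t : Measure X))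
  have hqt : ∀ t, Measurable fun θ => q (θ, t) := fun t => hqm.comp (by fun_prop)
  set J : X → ℝ → ℝ := fun x t => (D.v x t - ρ (D.kap x)) * D.f t - D.G t * D.vt x t with hJ
  have hJc : Continuous fun z : X × ℝ => J z.1 z.2 := by
    have c1 := D.continuous_v
    have c2 := D.continuous_vt
    have c3 := D.continuous_G
    have c4 := D.continuous_f
    have c5 := D.continuous_kap
    simp only [hJ]
    fun_prop
  have hJx : ∀ t, Continuous fun x => J x t := fun t =>
    hJc.comp (by fun_prop : Continuous fun x : X => (x, t))
  -- representation of integrals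
  have hrep : ∀ t, ∫ x, J x t ∂(b t : Measure X) = ∫ θ, J (io (q (θ, t))) t ∂ν := by
    intro t
    have hJio : Measurable fun z => J (io z) t := (hJx t).measurable.comp hiom
    have h1 : ∫ x, J x t ∂(b t : Measure X) = ∫ x, J (io (D.kap x)) t ∂(b t : Measure X) := by
      refine integral_congr_ae ?_
      filter_upwards [hbY t] with x hx
      rw [hio x hx]
    rw [h1, ← integral_map (φ := D.kap) hm.aemeasurable (f := fun z => J (io z) t)
      hJio.aestronglyMeasurable, ← hlaw t, integral_map (hqt t).aemeasurable
      hJio.aestronglyMeasurable]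
  have hfix : ∀ t, ∀ᵐ θ ∂ν, D.kap (io (q (θ, t))) = q (θ, t) := by
    intro t
    have hset : MeasurableSet {z | D.kap (io z) = z} :=
      measurableSet_eq_fun (hm.comp hiom) measurable_id
    have h1 : ∀ᵐ z ∂(Measure.map D.kap (b t : Measure X)), D.kap (io z) = z := by
      refine (ae_map_iff hm.aemeasurable hset).mpr ?_
      filter_upwards [hbY t] with x hx
      rw [hio x hx]
    rw [← hlaw t] at h1
    exact (ae_map_iff (hqt t).aemeasurable hset).mp h1
  -- A quantile need not be the steepness of any menu item. For each type this fails only on a null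
  -- set of levels, hence by Fubini, for almost every level, only on a null set of types.
  have hfix' : ∀ᵐ θ ∂ν, ∀ᵐ t, D.kap (io (q (θ, t))) = q (θ, t) := by
    have hset : MeasurableSet {p : ℝ × ℝ | D.kap (io (q p)) = q p} :=
      measurableSet_eq_fun (hm.comp (hiom.comp hqm)) hqm
    refine (Measure.ae_ae_comm (p := fun t θ => D.kap (io (q (θ, t))) = q (θ, t)) ?_).mp
      (Filter.Eventually.of_forall hfix)
    exact hset.preimage measurable_swap
  -- bound of the integrand
  obtain ⟨C, hC⟩ := (isCompact_univ.prod (isCompact_Icc (a := D.lo) (b := D.hi))).exists_bound_of_continuousOn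
    hJc.continuousOn
  have hCb : ∀ x, ∀ t ∈ Icc D.lo D.hi, |J x t| ≤ C := fun x t ht => hC (x, t) ⟨mem_univ _, ht⟩
  set T : Measure ℝ := volume.restrict (Ioc D.lo D.hi) with hT
  have hjm : Measurable fun p : ℝ × ℝ => J (io (q p)) p.2 :=
    hJc.measurable.comp ((hiom.comp hqm).prodMk measurable_snd)
  have hTI : ∀ᵐ t ∂T, t ∈ Icc D.lo D.hi := by
    filter_upwards [ae_restrict_mem measurableSet_Ioc] with t ht using Ioc_subset_Icc_self ht
  have hint : Integrable (Function.uncurry fun θ t => J (io (q (θ, t))) t) (ν.prod T) := by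
    refine Integrable.of_bound (C := C) hjm.aestronglyMeasurable ?_
    have := Measure.quasiMeasurePreserving_snd (μ := ν) (ν := T)
    filter_upwards [this.ae hTI] with p hp
    exact hCb _ _ hp
  have hle := D.lo_lt_hi.le
  have hvirt : D.virtual (fun a => ∫ x, ρ (D.kap x) ∂(a : Measure X)) b =
      ∫ θ, ∫ t, J (io (q (θ, t))) t ∂T ∂ν := by
    rw [integral_integral_swap hint, virtual, intervalIntegral.integral_of_le hle]
    refine integral_congr_ae (Filter.Eventually.of_forall fun t => ?_)
    simp only
    rw [← hrep t]
    have i1 := D.integrable_v (b t) t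
    have i2 := D.integrable_vt (b t) t
    have i3 : Integrable (fun x => ρ (D.kap x)) (b t : Measure X) :=
      integrable_of_continuous _ (hρ.comp D.continuous_kap)
    simp only [hJ, val, valt]
    have i4 : Integrable (fun x => (D.v x t - ρ (D.kap x)) * D.f t) (b t : Measure X) :=
      (i1.sub i3).mul_const _
    rw [integral_sub i4 (i2.const_mul _), integral_mul_const, integral_sub i1 i3,
      integral_const_mul]
  have hnull : ν {θ | ¬ ((∀ᵐ t, D.kap (io (q (θ, t))) = q (θ, t)) ∧ θ ∈ Ioo (0 : ℝ) 1)} = 0 :=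
    hfix'.and (ae_restrict_mem measurableSet_Ioo)
  -- The virtual surplus of `b` is the average over `θ` of that of the quantile rules, so a level
  -- outside the null set does at least as well as the average.
  obtain ⟨θ, hθ, hθle⟩ := exists_notMem_null_integral_le hint.integral_prod_left hnull
  simp only [mem_ofPred_eq, not_not] at hθ
  refine ⟨fun t => io (q (θ, t)), fun t => q (θ, t), hiom.comp (hqm.comp (by fun_prop)),
    fun t => hioY _, fun s s' hss => ?_, hθ.1, ?_⟩
  · simp only [hq, unitQuantile, if_pos hθ.2]
    refine csInf_le_csInf (lawQuantile_bddBelow _ hθ.2.1) (lawQuantile_nonempty _ hθ.2.2)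
      fun z hz => le_trans hz (D.antitone_cdf_kap hb z hss)
  · rw [hvirt, intervalIntegral.integral_of_le hle]
    exact hθle

end

end ExtendedScreening

/-! ### Helly selection and existence of a maximal rule -/

section Selection

open Filter Topology

/-- **Helly's selection theorem**: a sequence of monotone functions with values in a compact set
has a subsequence that converges outside a countable set to a monotone function. -/
theorem exists_monotone_subseq_tendsto {K : Set ℝ} (hK : IsCompact K) {k : ℕ → ℝ → ℝ}
    (hk : ∀ n, Monotone (k n)) (hkK : ∀ n t, k n t ∈ K) :
    ∃ (φ : ℕ → ℕ) (l : ℝ → ℝ), StrictMono φ ∧ Monotone l ∧ (∀ t, l t ∈ K) ∧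
      {t | ¬ Tendsto (fun n => k (φ n) t) atTop (𝓝 (l t))}.Countable := by
  -- Compactness of the countable product over the rationals replaces the diagonal argument.
  have hcomp : IsCompact (univ.pi fun _ : ℚ => K) := isCompact_univ_pi fun _ => hK
  obtain ⟨γ, hγ, φ, hφ, hlim⟩ := hcomp.tendsto_subseq (x := fun n (q : ℚ) => k n q)
    fun n q _ => hkK n q
  have hlim' : ∀ q : ℚ, Tendsto (fun n => k (φ n) q) atTop (𝓝 (γ q)) := fun q =>
    (tendsto_pi_nhds.mp hlim) q
  have hγK : ∀ q, γ q ∈ K := fun q => hγ q (mem_univ q)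
  have hγm : Monotone γ := fun q r hqr =>
    le_of_tendsto_of_tendsto' (hlim' q) (hlim' r) fun n => hk _ (by exact_mod_cast hqr)
  -- The limit at `t` is the supremum of the limits at rationals strictly below `t`. It lies in the
  -- closed set `K`, and squeezing between rationals gives convergence wherever `l` is continuous.
  set l : ℝ → ℝ := fun t => sSup (γ '' {q : ℚ | (q : ℝ) < t}) with hl
  have hne : ∀ t : ℝ, (γ '' {q : ℚ | (q : ℝ) < t}).Nonempty := fun t => by
    obtain ⟨q, hq⟩ := exists_rat_lt t
    exact ⟨γ q, q, hq, rfl⟩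
  have hbdd : ∀ t : ℝ, BddAbove (γ '' {q : ℚ | (q : ℝ) < t}) := fun t =>
    hK.bddAbove.mono (by rintro _ ⟨q, _, rfl⟩; exact hγK q)
  have hle : ∀ (q : ℚ) (t : ℝ), (q : ℝ) < t → γ q ≤ l t := fun q t h =>
    le_csSup (hbdd t) ⟨q, h, rfl⟩
  have hge : ∀ (q : ℚ) (t : ℝ), t ≤ q → l t ≤ γ q := fun q t h =>
    csSup_le (hne t) (by
      rintro _ ⟨r, hr, rfl⟩
      exact hγm (by exact_mod_cast (hr.le.trans h)))
  have hlm : Monotone l := fun s t hst =>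
    csSup_le_csSup (hbdd t) (hne s) (image_mono fun q hq => lt_of_lt_of_le hq hst)
  have hcont : ∀ t, ContinuousAt l t → Tendsto (fun n => k (φ n) t) atTop (𝓝 (l t)) := by
    intro t hc
    rw [tendsto_order]
    constructor
    · intro a ha
      have h1 : ∀ᶠ s in 𝓝 t, a < l s := hc.eventually (lt_mem_nhds ha)
      obtain ⟨ε, hε, hball⟩ := Metric.eventually_nhds_iff.mp h1
      obtain ⟨q, hq1, hq2⟩ := exists_rat_btwn (show t - ε / 2 < t by linarith)
      have h2 : a < γ q := by
        refine lt_of_lt_of_le (hball (y := t - ε / 2) ?_) (hge q _ hq1.le)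
        rw [Real.dist_eq, show t - ε / 2 - t = -(ε / 2) by ring, abs_neg, abs_of_pos (by linarith)]
        linarith
      filter_upwards [(hlim' q).eventually (lt_mem_nhds h2)] with n hn
      exact lt_of_lt_of_le hn (hk _ hq2.le)
    · intro a ha
      have h1 : ∀ᶠ s in 𝓝 t, l s < a := hc.eventually (gt_mem_nhds ha)
      obtain ⟨ε, hε, hball⟩ := Metric.eventually_nhds_iff.mp h1
      obtain ⟨q, hq1, hq2⟩ := exists_rat_btwn (show t < t + ε / 2 by linarith)
      have h2 : γ q < a := by
        refine lt_of_le_of_lt (hle q _ hq2) (hball (y := t + ε / 2) ?_)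
        rw [Real.dist_eq, show t + ε / 2 - t = ε / 2 by ring, abs_of_pos (by linarith)]
        linarith
      filter_upwards [(hlim' q).eventually (gt_mem_nhds h2)] with n hn
      exact lt_of_le_of_lt (hk _ hq1.le) hn
  refine ⟨φ, l, hφ, hlm, fun t => ?_, hlm.countable_not_continuousAt.mono fun t ht hc =>
    ht (hcont t hc)⟩
  exact hK.isClosed.closure_subset_iff.mpr (by rintro _ ⟨q, _, rfl⟩; exact hγK q)
    (csSup_mem_closure (hne t) (hbdd t))
end Selection

namespace ExtendedScreening

noncomputable section

set_option linter.unusedSectionVars false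

variable {X : Type*} [MetricSpace X] [CompactSpace X] [MeasurableSpace X] [BorelSpace X]
  (D : ExtendedScreening X)

lemma SteeperLE.kapL_le {a a' : ProbabilityMeasure X} (h : D.SteeperLE a a') :
    D.kapL a ≤ D.kapL a' := by
  rw [D.kapL_eq, D.kapL_eq]
  exact h.1 _ _ D.lo_lt_hi.le

/-- A rule with values in a compact set of lotteries on which steepness is injective is the
composition of its steepness with a continuous function. -/
lemma tendsto_of_tendsto_kapL {S : Set (ProbabilityMeasure X)} (hS : IsCompact S)
    (hinj : InjOn D.kapL S) {ι : Type*} {l : Filter ι} {a : ι → ProbabilityMeasure X}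
    (ha : ∀ i, a i ∈ S) {a' : ProbabilityMeasure X} (ha' : a' ∈ S)
    (h : Filter.Tendsto (fun i => D.kapL (a i)) l (nhds (D.kapL a'))) :
    Filter.Tendsto a l (nhds a') := by
  have : CompactSpace S := isCompact_iff_compactSpace.mp hS
  have hc : Continuous (S.domRestrict D.kapL) := D.continuous_kapL.comp continuous_subtype_val
  have hcl := hc.isClosedEmbedding (injOn_iff_injective.mp hinj)
  have h1 : Filter.Tendsto (fun i => (⟨a i, ha i⟩ : S)) l (nhds ⟨a', ha'⟩) :=
    hcl.isInducing.tendsto_nhds_iff.mpr h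
  exact (continuous_subtype_val.tendsto _).comp h1

/-- Steepness embeds the compact set `S` in the line, so `b` is measurable because its steepness is
monotone. The integrand is jointly continuous on `S × ℝ` and is evaluated along `(b t, t)`. -/
lemma measurable_virtual_integrand {S : Set (ProbabilityMeasure X)} (hS : IsCompact S)
    (hinj : InjOn D.kapL S) {b : ℝ → ProbabilityMeasure X} (hbS : ∀ t, b t ∈ S)
    (hb : Monotone fun t => D.kapL (b t)) {ρ : ProbabilityMeasure X → ℝ} (hρ : Continuous ρ) :
    Measurable fun t => (D.val (b t) t - ρ (b t)) * D.f t - D.G t * D.valt (b t) t := by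
  have hcompS : CompactSpace S := isCompact_iff_compactSpace.mp hS
  -- joint continuity on `S × ℝ`
  have hjoint : ∀ w : X → ℝ → ℝ, (Continuous fun z : X × ℝ => w z.1 z.2) →
      Continuous fun z : ProbabilityMeasure X × ℝ => ∫ y, w y z.2 ∂(z.1 : Measure X) := by
    intro w hw
    have hwl : ∀ s, Continuous fun y => w y s := fun s =>
      hw.comp (by fun_prop : Continuous fun y : X => (y, s))
    rw [continuous_iff_continuousAt]
    rintro ⟨a, t⟩
    have hcu : Continuous fun s : ℝ => (⟨fun y => w y s, hwl _⟩ : C(X, ℝ)) :=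
      ContinuousMap.continuous_of_continuous_uncurry _ (hw.comp continuous_swap)
    have h1 : Filter.Tendsto (fun z : ProbabilityMeasure X × ℝ =>
        ∫ y, (w y z.2 - w y t) ∂(z.1 : Measure X)) (nhds (a, t)) (nhds 0) := by
      have h2 : Filter.Tendsto (fun z : ProbabilityMeasure X × ℝ =>
          dist (⟨fun y => w y z.2, hwl _⟩ : C(X, ℝ))
            ⟨fun y => w y t, hwl _⟩) (nhds (a, t)) (nhds 0) := by
        rw [← tendsto_iff_dist_tendsto_zero]
        exact (hcu.comp continuous_snd).tendsto (a, t)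
      refine squeeze_zero_norm (fun z => ?_) h2
      refine abs_integral_le z.1 fun y => ?_
      exact ContinuousMap.dist_apply_le_dist (f := ⟨fun y => w y z.2, hwl _⟩)
        (g := ⟨fun y => w y t, hwl _⟩) y
    have h3 : Filter.Tendsto (fun z : ProbabilityMeasure X × ℝ =>
        ∫ y, w y t ∂(z.1 : Measure X)) (nhds (a, t)) (nhds (∫ y, w y t ∂(a : Measure X))) :=
      ((continuous_integral_left (h := fun y => w y t) (hwl _)).comp
        continuous_fst).tendsto (a, t)
    have h4 := h1.add h3
    rw [zero_add] at h4
    refine h4.congr fun z => ?_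
    rw [← integral_add]
    · simp
    · exact integrable_of_continuous _ (Continuous.sub (hwl _) (hwl _))
    · exact integrable_of_continuous _ (hwl _)
  have hc : Continuous (S.domRestrict D.kapL) := D.continuous_kapL.comp continuous_subtype_val
  have hcl := hc.isClosedEmbedding (injOn_iff_injective.mp hinj)
  have hbm : @Measurable ℝ S _ (borel S) fun t => (⟨b t, hbS t⟩ : S) := by
    let _ : MeasurableSpace S := borel S
    have : BorelSpace S := ⟨rfl⟩
    exact hcl.measurableEmbedding.measurable_comp_iff.mp hb.measurable
  let _ : MeasurableSpace S := borel S
  have : BorelSpace S := ⟨rfl⟩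
  have hF : Continuous fun z : S × ℝ =>
      (D.val z.1 z.2 - ρ z.1) * D.f z.2 - D.G z.2 * D.valt z.1 z.2 := by
    have c1 : Continuous fun z : S × ℝ => D.val z.1 z.2 :=
      (hjoint D.v D.continuous_v).comp (by fun_prop : Continuous fun z : S × ℝ => (z.1.1, z.2))
    have c2 : Continuous fun z : S × ℝ => D.valt z.1 z.2 :=
      (hjoint D.vt D.continuous_vt).comp (by fun_prop : Continuous fun z : S × ℝ => (z.1.1, z.2))
    have c3 := D.continuous_G
    have c4 := D.continuous_f
    fun_prop
  have : SecondCountableTopology S := hcl.isEmbedding.secondCountableTopology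
  exact hF.measurable.comp (hbm.prodMk measurable_id)

/-- Existence of a monotone rule with maximal virtual surplus. -/
theorem exists_max_virtual {S : Set (ProbabilityMeasure X)} (hS : IsCompact S) (hne : S.Nonempty)
    (hinj : InjOn D.kapL S)
    (hLE : ∀ a ∈ S, ∀ a' ∈ S, D.kapL a ≤ D.kapL a' → D.SteeperLE a a')
    {ρ : ProbabilityMeasure X → ℝ} (hρ : Continuous ρ) :
    ∃ b : ℝ → ProbabilityMeasure X, (∀ t, b t ∈ S) ∧ (∀ s t, s ≤ t → D.SteeperLE (b s) (b t)) ∧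
      ∀ b' : ℝ → ProbabilityMeasure X, (∀ t, b' t ∈ S) →
        (∀ s t, s ≤ t → D.SteeperLE (b' s) (b' t)) → D.virtual ρ b' ≤ D.virtual ρ b := by
  have hle := D.lo_lt_hi.le
  obtain ⟨R, hR⟩ := hS.exists_bound_of_continuousOn hρ.continuousOn
  obtain ⟨GB, hGB⟩ := (isCompact_Icc (a := D.lo) (b := D.hi)).exists_bound_of_continuousOn
    D.continuous_G.continuousOn
  have hB := D.B_nonneg
  set C : ℝ := (D.B + R) * D.B + GB * D.B with hC
  have hbound : ∀ a ∈ S, ∀ t ∈ Icc D.lo D.hi,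
      ‖(D.val a t - ρ a) * D.f t - D.G t * D.valt a t‖ ≤ C := by
    intro a ha t ht
    have h1 := D.abs_val_le a t
    have h2 := D.abs_valt_le a t
    have h3 : |ρ a| ≤ R := hR a ha
    have h4 : |D.G t| ≤ GB := hGB t ht
    have h5 := D.abs_f_le t
    rw [Real.norm_eq_abs]
    refine (abs_sub _ _).trans (add_le_add ?_ ?_)
    · rw [abs_mul]
      exact mul_le_mul ((abs_sub _ _).trans (add_le_add h1 h3)) h5 (abs_nonneg _)
        (by linarith [abs_nonneg (ρ a)])
    · rw [abs_mul]
      exact mul_le_mul h4 h2 (abs_nonneg _) ((abs_nonneg _).trans h4)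
  set P : Set (ℝ → ProbabilityMeasure X) :=
    {b | (∀ t, b t ∈ S) ∧ ∀ s t, s ≤ t → D.SteeperLE (b s) (b t)} with hP
  obtain ⟨a₀, ha₀⟩ := hne
  have hPne : (D.virtual ρ '' P).Nonempty :=
    ⟨_, fun _ => a₀, ⟨fun _ => ha₀, fun _ _ _ => SteeperLE.refl D a₀⟩, rfl⟩
  have hPb : BddAbove (D.virtual ρ '' P) := by
    refine ⟨C * (D.hi - D.lo), ?_⟩
    rintro _ ⟨b, hb, rfl⟩
    exact (le_abs_self _).trans (abs_integral_le_of_le hle fun s hs => hbound _ (hb.1 s) s hs)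
  obtain ⟨w, -, hw, hwP⟩ := exists_seq_tendsto_sSup hPne hPb
  choose b hbP hbw using hwP
  have hmono : ∀ n, Monotone fun t => D.kapL (b n t) := fun n s t hst =>
    SteeperLE.kapL_le D ((hbP n).2 s t hst)
  -- A maximising sequence is encoded by its monotone steepness functions. Their Helly limit takes
  -- values in the compact set of steepnesses of `S`, so it lifts to a rule in `S`, with convergence
  -- of lotteries at almost every type.
  obtain ⟨φ, l, hφ, hl, hlK, hlim⟩ := exists_monotone_subseq_tendsto
    (hS.image D.continuous_kapL) hmono fun n t => ⟨_, (hbP n).1 t, rfl⟩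
  choose c hcS hcl using hlK
  have hcmono : Monotone fun t => D.kapL (c t) := fun s t hst => by
    simp only [hcl]; exact hl hst
  have hcP : c ∈ P := ⟨hcS, fun s t hst => hLE _ (hcS s) _ (hcS t) (hcmono hst)⟩
  have hconv : Filter.Tendsto (fun n => D.virtual ρ (b (φ n))) Filter.atTop
      (nhds (D.virtual ρ c)) := by
    simp only [virtual, intervalIntegral.integral_of_le hle]
    refine tendsto_integral_of_dominated_convergence (fun _ => C) (fun n => ?_)
      (integrable_const C) (fun n => ?_) ?_
    · exact (D.measurable_virtual_integrand hS hinj (hbP _).1 (hmono _) hρ).aestronglyMeasurable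
    · filter_upwards [ae_restrict_mem measurableSet_Ioc] with t ht
      exact hbound _ ((hbP _).1 t) t (Ioc_subset_Icc_self ht)
    · filter_upwards [ae_restrict_of_ae (hlim.ae_notMem volume)] with t ht
      simp only [not_not] at ht
      rw [← hcl t] at ht
      have h1 := D.tendsto_of_tendsto_kapL hS hinj (fun n => (hbP (φ n)).1 t) (hcS t) ht
      have h2 : Filter.Tendsto (fun n => D.val (b (φ n) t) t) Filter.atTop (nhds (D.val (c t) t)) :=
        tendsto_integral_of_tendsto (D.continuous_v_left t) h1
      have h3 : Filter.Tendsto (fun n => D.valt (b (φ n) t) t) Filter.atTop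
          (nhds (D.valt (c t) t)) :=
        tendsto_integral_of_tendsto (D.continuous_vt_left t) h1
      have h4 := (hρ.tendsto _).comp h1
      exact ((h2.sub h4).mul_const _).sub (h3.const_mul _)
  have hval : D.virtual ρ c = sSup (D.virtual ρ '' P) := by
    refine tendsto_nhds_unique hconv ?_
    simp only [hbw]
    exact hw.comp hφ.tendsto_atTop
  refine ⟨c, hcP.1, hcP.2, fun b' h1 h2 => ?_⟩
  rw [hval]
  exact le_csSup hPb ⟨b', ⟨h1, h2⟩, rfl⟩

end

end ExtendedScreening

/-! ### Frontiers in terms of types -/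

namespace ExtendedScreening

noncomputable section

set_option linter.unusedSectionVars false

variable {X : Type*} [MetricSpace X] [CompactSpace X] [MeasurableSpace X] [BorelSpace X]
  (D : ExtendedScreening X)

/-- A menu `Y`, ordered by steepness, together with a compact chain `A` of lotteries on `Y` that
covers every allocation. -/
structure IsFrontier (out : X) (Y : Set X) (A : Set (ProbabilityMeasure X)) : Prop where
  measurableSet : MeasurableSet Y
  out_mem : out ∈ Y
  v_out : ∀ t, D.v out t = 0
  injOn : InjOn D.kap Y
  isCompact : IsCompact A
  ae_mem : ∀ a ∈ A, ∀ᵐ y ∂(a : Measure X), y ∈ Y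
  chain : ∀ a ∈ A, ∀ a' ∈ A, D.SteeperLE a a' ∨ D.SteeperLE a' a
  cover : ∀ x, ∀ t ∈ Icc D.lo D.hi, ∃ c ∈ A, D.val c t = D.v x t ∧
    (∀ s ∈ Icc D.lo D.hi, t ≤ s → D.val c s ≤ D.v x s) ∧
    (∀ s ∈ Icc D.lo D.hi, s ≤ t → D.v x s ≤ D.val c s)
  incr : ∀ x ∈ Y, ∀ x' ∈ Y, D.kap x ≤ D.kap x' → Monotone fun t => D.v x' t - D.v x t

variable {D}

lemma accPt_Icc {a b t : ℝ} (hab : a < b) (ht : t ∈ Icc a b) : AccPt t (Filter.principal (Icc a b)) :=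
  uniqueDiffWithinAt_iff_accPt.mp (uniqueDiffOn_Icc hab t ht)

lemma vt_nonneg (x : X) {t : ℝ} (ht : t ∈ Icc D.lo D.hi) : 0 ≤ D.vt x t :=
  (D.hasDeriv_v x t ht).nonneg_of_monotoneOn (accPt_Icc D.lo_lt_hi ht) ((D.monotone_v x).monotoneOn _)

/-- Steepness-ranked lotteries of equal expected steepness give the same expectation to every
Lipschitz function of steepness. -/
lemma integral_lipschitz_eq {a a' : ProbabilityMeasure X} (haa : D.SteeperLE a a')
    (hk : D.kapL a = D.kapL a') {g : ℝ → ℝ} {L : ℝ} (hg : ∀ z w, |g z - g w| ≤ L * |z - w|)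
    (hgc : Continuous g) :
    ∫ y, g (D.kap y) ∂(a : Measure X) = ∫ y, g (D.kap y) ∂(a' : Measure X) := by
  have hi : ∀ c : ProbabilityMeasure X, Integrable (fun y => g (D.kap y)) (c : Measure X) :=
    fun c => integrable_of_continuous c (hgc.comp D.continuous_kap)
  have hki : ∀ c : ProbabilityMeasure X, Integrable (fun y => L * D.kap y) (c : Measure X) :=
    fun c => (integrable_of_continuous c D.continuous_kap).const_mul _
  have key : ∀ s : ℝ, |s| = 1 → s * ∫ y, g (D.kap y) ∂(a : Measure X) ≤
      s * ∫ y, g (D.kap y) ∂(a' : Measure X) := by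
    intro s hs
    -- For `s = 1` and `s = -1` the function `L * z + s * g z` is monotone, and the linear part has
    -- the same expectation under both lotteries. The expectation of `g` is thus bounded in both
    -- directions.
    have hm : Monotone fun z => L * z + s * g z := by
      intro z w hzw
      have h1 : |s * (g z - g w)| ≤ L * |z - w| := by rw [abs_mul, hs, one_mul]; exact hg z w
      rw [abs_of_nonpos (sub_nonpos.mpr hzw)] at h1
      have := (abs_le.mp h1).2
      simp only
      nlinarith
    have h2 := haa.2 _ hm
    rw [integral_add (hki a) ((hi a).const_mul s), integral_add (hki a') ((hi a').const_mul s),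
      integral_const_mul, integral_const_mul, integral_const_mul, integral_const_mul] at h2
    have h3 : ∫ y, D.kap y ∂(a : Measure X) = ∫ y, D.kap y ∂(a' : Measure X) := hk
    rw [h3] at h2
    linarith
  have h1 := key 1 (by simp)
  have h2 := key (-1) (by simp)
  linarith

lemma measurable_along {w : X → ℝ → ℝ} (hw : Continuous fun z : X × ℝ => w z.1 z.2) {y : ℝ → X}
    (hy : Measurable y) : Measurable fun t => w (y t) t :=
  hw.measurable.comp (hy.prodMk measurable_id)

lemma intervalIntegrable_of_bound {g : ℝ → ℝ} (hg : Measurable g) {C c d : ℝ}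
    (hC : ∀ t, |g t| ≤ C) : IntervalIntegrable g volume c d :=
  ⟨Integrable.of_bound (C := C) hg.aestronglyMeasurable (Filter.Eventually.of_forall hC),
    Integrable.of_bound (C := C) hg.aestronglyMeasurable (Filter.Eventually.of_forall hC)⟩

namespace IsFrontier

variable {out : X} {Y : Set X} {A : Set (ProbabilityMeasure X)} (h : D.IsFrontier out Y A)

include h

lemma vt_le {x x' : X} (hx : x ∈ Y) (hx' : x' ∈ Y) (hk : D.kap x ≤ D.kap x') {t : ℝ}
    (ht : t ∈ Icc D.lo D.hi) : D.vt x t ≤ D.vt x' t :=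
  sub_nonneg.mp (((D.hasDeriv_v x' t ht).sub (D.hasDeriv_v x t ht)).nonneg_of_monotoneOn
    (accPt_Icc D.lo_lt_hi ht) ((h.incr x hx x' hx' hk).monotoneOn _))

/-- Sine and cosine are Lipschitz, so ranked lotteries of equal mean steepness have the same
characteristic function of steepness, hence the same law of it. Steepness determines the allocation
on `Y`, so the lotteries agree. -/
lemma eq_of_kapL_eq {a a' : ProbabilityMeasure X} (ha : a ∈ A) (ha' : a' ∈ A)
    (haa : D.SteeperLE a a') (hk : D.kapL a = D.kapL a') : a = a' := by
  have hm : Measurable D.kap := D.continuous_kap.measurable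
  have hp : ∀ c : ProbabilityMeasure X, IsProbabilityMeasure (Measure.map D.kap (c : Measure X)) :=
    fun c => Measure.isProbabilityMeasure_map hm.aemeasurable
  have hlaw : Measure.map D.kap (a : Measure X) = Measure.map D.kap (a' : Measure X) := by
    have := hp a
    have := hp a'
    refine Measure.ext_of_charFun (funext fun s => ?_)
    have hchar : ∀ c : ProbabilityMeasure X, charFun (Measure.map D.kap (c : Measure X)) s =
        ((∫ y, Real.cos (s * D.kap y) ∂(c : Measure X) : ℝ) : ℂ) +
          ((∫ y, Real.sin (s * D.kap y) ∂(c : Measure X) : ℝ) : ℂ) * Complex.I := by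
      intro c
      rw [charFun_apply_real, integral_map hm.aemeasurable (by
        exact Continuous.aestronglyMeasurable (by fun_prop))]
      rw [← integral_complex_ofReal, ← integral_complex_ofReal, ← integral_mul_const,
        ← integral_add]
      · refine integral_congr_ae (Filter.Eventually.of_forall fun y => ?_)
        simp only
        rw [Complex.exp_mul_I]
        push_cast
        rfl
      · exact (integrable_of_continuous c (Real.continuous_cos.comp
          (D.continuous_kap.const_mul s))).ofReal
      · exact (integrable_of_continuous c (Real.continuous_sin.comp
          (D.continuous_kap.const_mul s))).ofReal.mul_const _
    have e1 := integral_lipschitz_eq haa hk (g := fun z => Real.cos (s * z)) (L := |s|)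
      (fun z w => (Real.abs_cos_sub_cos_le _ _).trans (by rw [← mul_sub, abs_mul]))
      (by fun_prop)
    have e2 := integral_lipschitz_eq haa hk (g := fun z => Real.sin (s * z)) (L := |s|)
      (fun z w => (Real.abs_sin_sub_sin_le _ _).trans (by rw [← mul_sub, abs_mul]))
      (by fun_prop)
    rw [hchar, hchar, e1, e2]
  obtain ⟨io, hiom, -, hio⟩ := D.exists_allocation_of_kap h.measurableSet ⟨out, h.out_mem⟩ h.injOn
  have hrec : ∀ c ∈ A, Measure.map io (Measure.map D.kap (c : Measure X)) = (c : Measure X) := by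
    intro c hc
    rw [Measure.map_map hiom hm]
    conv_rhs => rw [← Measure.map_id (μ := (c : Measure X))]
    refine Measure.map_congr ?_
    filter_upwards [h.ae_mem c hc] with y hy using hio y hy
  exact Subtype.ext ((hrec a ha).symm.trans (hlaw ▸ hrec a' ha'))

lemma injOn_kapL : InjOn D.kapL A := fun a ha a' ha' hk => by
  rcases h.chain a ha a' ha' with haa | haa
  · exact h.eq_of_kapL_eq ha ha' haa hk
  · exact (h.eq_of_kapL_eq ha' ha haa hk.symm).symm

lemma steeperLE {a a' : ProbabilityMeasure X} (ha : a ∈ A) (ha' : a' ∈ A)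
    (hk : D.kapL a ≤ D.kapL a') : D.SteeperLE a a' := by
  rcases h.chain a ha a' ha' with haa | haa
  · exact haa
  · rw [h.injOn_kapL ha ha' (le_antisymm hk (SteeperLE.kapL_le D haa))]
    exact SteeperLE.refl D _

/-- Replacing the allocations of a monotone deterministic rule by lotteries that cover them. -/
theorem integral_le_of_virtual_le {y : ℝ → X} {k : ℝ → ℝ} (hy : Measurable y) (hyY : ∀ t, y t ∈ Y)
    (hk : Monotone k) (hyk : ∀ᵐ t, D.kap (y t) = k t) {ρ : ProbabilityMeasure X → ℝ} {σ : ℝ → ℝ}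
    (hσ : Monotone σ) {C m : ℝ} (hC : ∀ z, |σ z| ≤ C)
    (hρσ : ∀ c ∈ A, ∀ z, D.kapL c ≤ z → ρ c ≤ σ z)
    (hmax : ∀ b : ℝ → ProbabilityMeasure X, (∀ t, b t ∈ A) →
      (∀ s t, s ≤ t → D.SteeperLE (b s) (b t)) → D.virtual ρ b ≤ m) :
    ∫ t in D.lo..D.hi, ((D.v (y t) t - σ (k t)) * D.f t - D.G t * D.vt (y t) t) ≤ m := by
  have hle := D.lo_lt_hi.le
  have hvm : Measurable fun t => D.v (y t) t := measurable_along D.continuous_v hy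
  have hvtm : Measurable fun t => D.vt (y t) t := measurable_along D.continuous_vt hy
  have hvtb : ∀ t, |D.vt (y t) t| ≤ D.B := fun t => D.abs_vt_le _ _
  have hvti : ∀ c d, IntervalIntegrable (fun t => D.vt (y t) t) volume c d := fun c d =>
    intervalIntegrable_of_bound hvtm hvtb
  set u : ℝ → ℝ := fun t => ∫ s in D.lo..t, D.vt (y s) s with hu
  -- `u` is the rent that the envelope formula assigns to the rule `y`. It depends on `y` only up to
  -- null sets, so an exceptional set of types is harmless.
  have hsub : ∀ s t, u t - u s = ∫ r in s..t, D.vt (y r) r := fun s t =>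
    intervalIntegral.integral_interval_sub_left (hvti _ _) (hvti _ _)
  have hulip : ∀ s t, |u s - u t| ≤ D.B * |s - t| := fun s t => by
    rw [hsub]
    exact intervalIntegral.norm_integral_le_of_norm_le_const (f := fun r => D.vt (y r) r)
      fun r _ => hvtb r
  set g : ℝ → ℝ := fun t => D.v (y t) t - σ (k t) with hg
  have hgm : Measurable g := hvm.sub (hσ.measurable.comp hk.measurable)
  have hgb : ∀ t, |g t| ≤ D.B + C := fun t =>
    (abs_sub _ _).trans (add_le_add (D.abs_v_le _ _) (hC _))
  have hgfi : IntervalIntegrable (fun s => g s * D.f s) volume D.lo D.hi := by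
    refine intervalIntegrable_of_bound (hgm.mul D.continuous_f.measurable)
      (C := (D.B + C) * D.B) fun t => ?_
    rw [Pi.mul_apply, abs_mul]
    exact mul_le_mul (hgb t) (D.abs_f_le t) (abs_nonneg _) ((abs_nonneg _).trans (hgb t))
  have hconv : ∫ s in D.lo..D.hi, (g s - (1 - D.lam s) * u s) * D.f s =
      ∫ t in D.lo..D.hi, ((D.v (y t) t - σ (k t)) * D.f t - D.G t * D.vt (y t) t) := by
    have huc : Continuous u := by
      refine (LipschitzWith.of_dist_le_mul (K := ⟨D.B, D.B_nonneg⟩) fun s t => ?_).continuous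
      exact hulip s t
    have h1 : IntervalIntegrable (fun t => D.G t * D.vt (y t) t) volume D.lo D.hi :=
      (hvti _ _).continuousOn_mul D.continuous_G.continuousOn
    have h2 : IntervalIntegrable (fun t => (1 - D.lam t) * D.f t * u t) volume D.lo D.hi :=
      (D.continuous_weight.mul huc).intervalIntegrable _ _
    rw [intervalIntegral.integral_sub hgfi h1, ← D.integral_rents hvtm.aestronglyMeasurable hvtb,
      ← intervalIntegral.integral_sub hgfi h2]
    exact intervalIntegral.integral_congr fun t _ => by ring
  rw [← hconv]
  refine le_of_forall_pos_le_add fun ε hε => ?_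
  obtain ⟨b, hbA, hb, hle'⟩ := D.exists_monotone_rule (S := A) (ρ := ρ) (u := u) (g := g)
    (C := D.B + C) (K := D.B * (D.hi - D.lo)) (Lu := D.B) D.B_nonneg
    (N := {t | ¬ D.kap (y t) = k t}) hyk
    (fun s hs => by
      have h0 : u D.lo = 0 := intervalIntegral.integral_same
      refine ⟨intervalIntegral.integral_nonneg hs.1 fun r hr => vt_nonneg _ ⟨hr.1, hr.2.trans hs.2⟩, ?_⟩
      have := (le_abs_self _).trans (hulip s D.lo)
      rw [h0, sub_zero, abs_of_nonneg (sub_nonneg.mpr hs.1)] at this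
      exact this.trans (mul_le_mul_of_nonneg_left (by linarith [hs.2]) D.B_nonneg))
    (fun s _ t _ => hulip s t) hgb hgfi
    (fun n t ht htt η hη => by
      have hcov : ∀ i, ∃ c, i < n → c ∈ A ∧ D.val c (t i) = D.v (y (t i)) (t i) ∧
          (∀ s ∈ Icc D.lo D.hi, t i ≤ s → D.val c s ≤ D.v (y (t i)) s) ∧
          (∀ s ∈ Icc D.lo D.hi, s ≤ t i → D.v (y (t i)) s ≤ D.val c s) := by
        intro i
        by_cases hin : i < n
        · obtain ⟨c, hc⟩ := h.cover (y (t i)) (t i) (Ioo_subset_Icc_self (ht i hin).1)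
          exact ⟨c, fun _ => hc⟩
        · exact ⟨⟨Measure.dirac out, inferInstance⟩, fun h => absurd h hin⟩
      choose c hc using hcov
      refine ⟨c, fun i hin => (hc i hin).1, fun i hin j hjn => h.steeperLE (hc i hin).1 (hc j hjn).1,
        fun i hin => ?_, fun i j hij hjn => ?_⟩
      · obtain ⟨h1, h2, h3, h4⟩ := hc i hin
        -- The covering lottery is no higher than `y (t i)` at the top type and no lower at the
        -- bottom type, so it is no steeper. Its cost is therefore bounded by `σ (k (t i))`.
        have hkc : D.kapL (c i) ≤ k (t i) := by
          have h5 : D.kap (y (t i)) = k (t i) := not_not.mp (ht i hin).2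
          rw [← h5, D.kapL_eq, kap]
          have := h3 D.hi ⟨hle, le_rfl⟩ (ht i hin).1.2.le
          have := h4 D.lo ⟨le_rfl, hle⟩ (ht i hin).1.1.le
          linarith
        have := hρσ _ h1 _ hkc
        simp only [hg]
        linarith
      · have hin := hij.trans hjn
        obtain ⟨h1, h2, h3, h4⟩ := hc i hin
        have hti := (ht i hin).1
        have htj := (ht j hjn).1
        have hij' := (htt i j hij hjn).le
        have h5 := h3 (t j) (Ioo_subset_Icc_self htj) hij'
        -- Slopes increase along the rule, so between `t i` and `t j` the rent grows at least as
        -- fast as the value of the fixed allocation `y (t i)`.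
        have h6 : D.v (y (t i)) (t j) - D.v (y (t i)) (t i) ≤ u (t j) - u (t i) := by
          rw [hsub, ← D.integral_vt _ hti.1.le hij' htj.2.le]
          refine intervalIntegral.integral_mono_ae_restrict hij'
            ((D.continuous_vt_right _).intervalIntegrable _ _) (hvti _ _) ?_
          filter_upwards [ae_restrict_mem measurableSet_Icc, ae_restrict_of_ae hyk] with r hr hkr
          refine h.vt_le (hyY _) (hyY _) ?_ ⟨hti.1.le.trans hr.1, hr.2.trans htj.2.le⟩
          have h7 : D.kap (y (t i)) = k (t i) := not_not.mp (ht i hin).2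
          rw [h7, hkr]
          exact hk hr.1
        linarith) hε
  linarith [hmax b hbA hb]

end IsFrontier

end

end ExtendedScreening

/-! ### Degenerate lotteries and the optimal deterministic rule -/

namespace ExtendedScreening

noncomputable section

set_option linter.unusedSectionVars false

variable {X : Type*} [MetricSpace X] [CompactSpace X] [MeasurableSpace X] [BorelSpace X]
  {D : ExtendedScreening X}

/-- The second moment of the steepness under a lottery. -/
def kapSq (D : ExtendedScreening X) (a : ProbabilityMeasure X) : ℝ :=
  ∫ y, D.kap y ^ 2 ∂(a : Measure X)

lemma continuous_kapSq : Continuous D.kapSq := continuous_integral_left (D.continuous_kap.pow 2)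

/-- The variance of steepness. The condition `kapSq a = kapL a ^ 2` is closed in `a` and, for
lotteries in `A`, characterises point masses on the menu, so these form a compact set. -/
lemma integral_sub_kapL_sq (a : ProbabilityMeasure X) :
    ∫ y, (D.kap y - D.kapL a) ^ 2 ∂(a : Measure X) = D.kapSq a - D.kapL a ^ 2 := by
  have i1 : Integrable (fun y => D.kap y ^ 2) (a : Measure X) :=
    integrable_of_continuous a (D.continuous_kap.pow 2)
  have i2 : Integrable (fun y => 2 * D.kapL a * D.kap y) (a : Measure X) :=
    (integrable_of_continuous a D.continuous_kap).const_mul _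
  have h1 : ∀ y, (D.kap y - D.kapL a) ^ 2 = D.kap y ^ 2 - 2 * D.kapL a * D.kap y + D.kapL a ^ 2 :=
    fun y => by ring
  simp only [h1]
  have i3 : Integrable (fun y => D.kap y ^ 2 - 2 * D.kapL a * D.kap y) (a : Measure X) := i1.sub i2
  rw [integral_add i3 (integrable_const _), integral_sub i1 i2, integral_const_mul]
  simp only [integral_const, probReal_univ, smul_eq_mul, one_mul]
  change D.kapSq a - 2 * D.kapL a * D.kapL a + D.kapL a ^ 2 = _
  ring

lemma kapL_sq_le (a : ProbabilityMeasure X) : D.kapL a ^ 2 ≤ D.kapSq a := by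
  have h := integral_sub_kapL_sq (D := D) a
  have : 0 ≤ ∫ y, (D.kap y - D.kapL a) ^ 2 ∂(a : Measure X) :=
    integral_nonneg fun y => sq_nonneg _
  linarith

lemma ae_kap_eq {a : ProbabilityMeasure X} (ha : D.kapSq a = D.kapL a ^ 2) :
    ∀ᵐ y ∂(a : Measure X), D.kap y = D.kapL a := by
  have h := integral_sub_kapL_sq (D := D) a
  rw [ha, sub_self] at h
  have h1 := (integral_eq_zero_iff_of_nonneg (fun y => sq_nonneg (D.kap y - D.kapL a))
    (integrable_of_continuous a ((D.continuous_kap.sub continuous_const).pow 2))).mp h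
  filter_upwards [h1] with y hy
  have : (D.kap y - D.kapL a) ^ 2 = 0 := hy
  exact sub_eq_zero.mp (pow_eq_zero_iff (by norm_num) |>.mp this)

lemma kapL_nonneg (a : ProbabilityMeasure X) : 0 ≤ D.kapL a := integral_nonneg D.kap_nonneg

lemma kapL_le_two_mul (a : ProbabilityMeasure X) : D.kapL a ≤ 2 * D.B := by
  have h := abs_integral_le a (h := D.kap) (C := 2 * D.B) fun x => by
    rw [abs_of_nonneg (D.kap_nonneg x)]; exact D.kap_le x
  exact (le_abs_self _).trans h

lemma kapSq_eq_of_kapL_eq_zero {a : ProbabilityMeasure X} (ha : D.kapL a = 0) :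
    D.kapSq a = D.kapL a ^ 2 := by
  have h1 := (integral_eq_zero_iff_of_nonneg D.kap_nonneg
    (integrable_of_continuous a D.continuous_kap)).mp ha
  have h2 : D.kapSq a = ∫ _, (0 : ℝ) ∂(a : Measure X) := by
    refine integral_congr_ae ?_
    filter_upwards [h1] with y hy
    rw [hy]; simp
  rw [h2, ha]; simp

namespace IsFrontier

variable {out : X} {Y : Set X} {A : Set (ProbabilityMeasure X)} (h : D.IsFrontier out Y A)

include h

lemma exists_eq_of_degenerate {a : ProbabilityMeasure X} (ha : a ∈ A)
    (hd : D.kapSq a = D.kapL a ^ 2) : ∃ y ∈ Y, D.kap y = D.kapL a ∧ ∀ᵐ x ∂(a : Measure X), x = y := by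
  have h1 := (h.ae_mem a ha).and (ae_kap_eq hd)
  obtain ⟨y, hy, hyk⟩ := h1.exists
  refine ⟨y, hy, hyk, ?_⟩
  filter_upwards [h1] with x hx
  exact h.injOn hx.1 hy (hx.2.trans hyk.symm)

lemma val_eq_of_degenerate {a : ProbabilityMeasure X} (ha : a ∈ A)
    (hd : D.kapSq a = D.kapL a ^ 2) {y : X} (hy : y ∈ Y) (hk : D.kap y = D.kapL a) (t : ℝ) :
    D.val a t = D.v y t ∧ D.valt a t = D.vt y t := by
  obtain ⟨y', hy', hk', hae⟩ := h.exists_eq_of_degenerate ha hd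
  obtain rfl : y = y' := h.injOn hy hy' (hk.trans hk'.symm)
  constructor
  · have : D.val a t = ∫ _, D.v y t ∂(a : Measure X) := integral_congr_ae (by
      filter_upwards [hae] with x hx
      rw [hx])
    simpa using this
  · have : D.valt a t = ∫ _, D.vt y t ∂(a : Measure X) := integral_congr_ae (by
      filter_upwards [hae] with x hx
      rw [hx])
    simpa using this

/-- A lottery covering the outside option at the lowest type has value zero there and at most zero
at the highest type. -/
lemma exists_kapL_eq_zero : ∃ c ∈ A, D.kapL c = 0 := by
  obtain ⟨c, hc, h0, h1, -⟩ := h.cover out D.lo ⟨le_rfl, D.lo_lt_hi.le⟩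
  refine ⟨c, hc, le_antisymm ?_ (kapL_nonneg _)⟩
  rw [D.kapL_eq, h0]
  have := h1 D.hi ⟨D.lo_lt_hi.le, le_rfl⟩ D.lo_lt_hi.le
  rw [h.v_out] at this ⊢
  linarith

lemma isCompact_degenerate : IsCompact {a ∈ A | D.kapSq a = D.kapL a ^ 2} :=
  h.isCompact.inter_right (isClosed_eq continuous_kapSq (D.continuous_kapL.pow 2))

/-- A monotone deterministic rule whose steepness is, almost everywhere, that of a degenerate
lottery in `A` is a rule with values in the degenerate lotteries of `A`. -/
lemma exists_degenerate_rule {y : ℝ → X} {k : ℝ → ℝ} (hyY : ∀ t, y t ∈ Y) (hk : Monotone k)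
    (hyk : ∀ᵐ t, D.kap (y t) = k t)
    (hkd : ∀ᵐ t ∂(volume.restrict (Ioc D.lo D.hi)), ∃ a ∈ A, D.kapSq a = D.kapL a ^ 2 ∧ D.kapL a = k t) :
    ∃ b : ℝ → ProbabilityMeasure X, (∀ t, b t ∈ {a ∈ A | D.kapSq a = D.kapL a ^ 2}) ∧
      (∀ s t, s ≤ t → D.SteeperLE (b s) (b t)) ∧
      D.virtual (fun _ => 0) b =
        ∫ t in D.lo..D.hi, (D.v (y t) t * D.f t - D.G t * D.vt (y t) t) := by
  set Ad : Set (ProbabilityMeasure X) := {a ∈ A | D.kapSq a = D.kapL a ^ 2} with hAd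
  set Z : Set ℝ := D.kapL '' Ad with hZ
  have hZc : IsCompact Z := h.isCompact_degenerate.image D.continuous_kapL
  obtain ⟨c₀, hc₀, hk₀⟩ := h.exists_kapL_eq_zero
  have hZ0 : (0 : ℝ) ∈ Z := ⟨c₀, ⟨hc₀, kapSq_eq_of_kapL_eq_zero hk₀⟩, hk₀⟩
  -- The supremum of the admissible steepnesses reached so far is monotone at every type, lies in
  -- the closed set `Z`, and equals `k t` whenever `k t` is admissible. The element `0` only keeps
  -- the set nonempty.
  set W : ℝ → Set ℝ := fun t => insert 0 {z ∈ Z | ∃ s ≤ t, k s = z} with hW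
  have hWZ : ∀ t, W t ⊆ Z := fun t z hz => by
    rcases hz with rfl | hz
    · exact hZ0
    · exact hz.1
  have hWb : ∀ t, BddAbove (W t) := fun t => hZc.bddAbove.mono (hWZ t)
  have hWn : ∀ t, (W t).Nonempty := fun t => ⟨0, mem_insert _ _⟩
  have hmem : ∀ t, sSup (W t) ∈ Z := fun t =>
    hZc.isClosed.closure_subset_iff.mpr (hWZ t) (csSup_mem_closure (hWn t) (hWb t))
  choose b hb hbk using hmem
  have hmono : ∀ s t, s ≤ t → D.kapL (b s) ≤ D.kapL (b t) := by
    intro s t hst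
    rw [hbk, hbk]
    refine csSup_le_csSup (hWb t) (hWn s) ?_
    rintro z (rfl | ⟨hz, r, hr, hrz⟩)
    · exact mem_insert _ _
    · exact Or.inr ⟨hz, r, hr.trans hst, hrz⟩
  refine ⟨b, hb, fun s t hst => h.steeperLE (hb s).1 (hb t).1 (hmono s t hst), ?_⟩
  rw [virtual, intervalIntegral.integral_of_le D.lo_lt_hi.le,
    intervalIntegral.integral_of_le D.lo_lt_hi.le]
  refine integral_congr_ae ?_
  filter_upwards [hkd, ae_restrict_of_ae hyk] with t ⟨a, ha, had, hak⟩ hyt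
  have hkt : D.kapL (b t) = k t := by
    rw [hbk]
    refine le_antisymm (csSup_le (hWn t) ?_) (le_csSup (hWb t) (Or.inr ⟨⟨a, ⟨ha, had⟩, hak⟩, t, le_rfl, rfl⟩))
    rintro z (rfl | ⟨-, r, hr, rfl⟩)
    · rw [← hak]; exact kapL_nonneg a
    · exact hk hr
  obtain ⟨e1, e2⟩ := h.val_eq_of_degenerate (hb t).1 (hb t).2 (hyY t) (hyt.trans hkt.symm) t
  rw [e1, e2, sub_zero]

/-- The largest steepness cost among the lotteries in `A` that are at most as steep as `z`. -/
lemma exists_cost_envelope {ρ : ProbabilityMeasure X → ℝ} (hρ : Continuous ρ)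
    (hρ0 : ∀ a ∈ A, 0 ≤ ρ a) : ∃ (σ : ℝ → ℝ) (C : ℝ), Monotone σ ∧ (∀ z, |σ z| ≤ C) ∧
      (∀ c ∈ A, ∀ z, D.kapL c ≤ z → ρ c ≤ σ z) ∧
      ∀ z, 0 ≤ z → ∃ c ∈ A, D.kapL c ≤ z ∧ ρ c = σ z := by
  obtain ⟨C, hC⟩ := h.isCompact.exists_bound_of_continuousOn hρ.continuousOn
  set W : ℝ → Set ℝ := fun z => ρ '' {c ∈ A | D.kapL c ≤ z} with hW
  have hWb : ∀ z, BddAbove (W z) := fun z => ⟨C, by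
    rintro _ ⟨c, hc, rfl⟩
    exact (le_abs_self _).trans (hC c hc.1)⟩
  have h0 : ∀ z, ∀ w ∈ W z, 0 ≤ w := by
    rintro z _ ⟨c, hc, rfl⟩
    exact hρ0 c hc.1
  obtain ⟨c₀, hc₀, hk₀⟩ := h.exists_kapL_eq_zero
  have hC0 : 0 ≤ C := (norm_nonneg _).trans (hC c₀ hc₀)
  refine ⟨fun z => sSup (W z), C, fun z z' hz => ?_, fun z => ?_, fun c hc z hcz =>
    le_csSup (hWb z) ⟨c, ⟨hc, hcz⟩, rfl⟩, fun z hz => ?_⟩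
  · simp only
    -- Where no lottery is flat enough, the supremum of the empty set is `0` by convention.
    -- Monotonicity survives because costs are nonnegative.
    rcases (W z).eq_empty_or_nonempty with he | hne
    · rw [he, Real.sSup_empty]
      exact Real.sSup_nonneg (h0 z')
    · refine csSup_le_csSup (hWb z') hne (image_mono fun c hc => ⟨hc.1, hc.2.trans hz⟩)
  · rw [abs_of_nonneg (Real.sSup_nonneg (h0 z))]
    refine Real.sSup_le ?_ hC0
    rintro _ ⟨c, hc, rfl⟩
    exact (le_abs_self _).trans (hC c hc.1)
  · have hcomp : IsCompact {c ∈ A | D.kapL c ≤ z} :=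
      h.isCompact.inter_right (isClosed_le D.continuous_kapL continuous_const)
    have hne : ({c ∈ A | D.kapL c ≤ z}).Nonempty := ⟨c₀, hc₀, hk₀.le.trans hz⟩
    obtain ⟨c, hc, he⟩ := (hcomp.image hρ).sSup_mem (hne.image ρ)
    exact ⟨c, hc.1, hc.2, he⟩

/-- Rules with values in `A` do at most as well as rules with values in its degenerate members, up
to a small cost. -/
lemma exists_degenerate_rule_ge {ε : ℝ} (hε : 0 < ε) :
    ∃ b' : ℝ → ProbabilityMeasure X, (∀ t, b' t ∈ {a ∈ A | D.kapSq a = D.kapL a ^ 2}) ∧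
      (∀ s t, s ≤ t → D.SteeperLE (b' s) (b' t)) ∧
      ∀ b : ℝ → ProbabilityMeasure X, (∀ t, b t ∈ A) → (∀ s t, s ≤ t → D.SteeperLE (b s) (b t)) →
        D.virtual (fun _ => 0) b ≤ D.virtual (fun _ => 0) b' +
          ε * ((4 * D.B + 1) * (2 * D.B)) * D.B * (D.hi - D.lo) := by
  have hle := D.lo_lt_hi.le
  have hB := D.B_nonneg
  set C : ℝ := 4 * D.B + 1 with hC
  -- A strictly concave cost of steepness. It is strictly increasing on `[0, 2B]`, since `C = 4B +
  -- 1` exceeds the sum of any two points there. By Jensen a lottery costs at most as much as a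
  -- point mass of its mean steepness, with equality only when it is degenerate.
  set ρ₀ : ℝ → ℝ := fun z => ε * (C * z - z ^ 2) with hρ₀
  have hρ₀c : Continuous ρ₀ := by fun_prop
  have hρ₀m : ∀ z w, 0 ≤ z → z < w → w ≤ 2 * D.B → ρ₀ z < ρ₀ w := by
    intro z w hz hzw hw
    have h1 : 0 < (w - z) * (C - (w + z)) := mul_pos (by linarith) (by simp only [hC]; linarith)
    have := mul_pos hε h1
    simp only [hρ₀]
    nlinarith
  set ρ : ProbabilityMeasure X → ℝ := fun a => ∫ x, ρ₀ (D.kap x) ∂(a : Measure X) with hρ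
  have hρc : Continuous ρ := continuous_integral_left (hρ₀c.comp D.continuous_kap)
  have hρeq : ∀ a, ρ a = ε * (C * D.kapL a - D.kapSq a) := by
    intro a
    have i1 : Integrable (fun y => D.kap y ^ 2) (a : Measure X) :=
      integrable_of_continuous a (D.continuous_kap.pow 2)
    have i2 : Integrable (fun y => C * D.kap y) (a : Measure X) :=
      (integrable_of_continuous a D.continuous_kap).const_mul _
    simp only [hρ, hρ₀]
    rw [integral_const_mul, integral_sub i2 i1, integral_const_mul]
    rfl
  have hρ₀0 : ∀ x, 0 ≤ ρ₀ (D.kap x) := fun x => by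
    have h1 := D.kap_nonneg x
    have h2 := D.kap_le x
    simp only [hρ₀]
    refine mul_nonneg hε.le ?_
    rw [sq, ← sub_mul]
    exact mul_nonneg (by simp only [hC]; linarith) h1
  have hρ0 : ∀ a, 0 ≤ ρ a := fun a => integral_nonneg fun x => hρ₀0 x
  have hρle : ∀ a, ρ a ≤ ρ₀ (D.kapL a) := fun a => by
    rw [hρeq]
    have := kapL_sq_le (D := D) a
    exact mul_le_mul_of_nonneg_left (by linarith) hε.le
  have hρub : ∀ a, ρ a ≤ ε * (C * (2 * D.B)) := fun a => by
    rw [hρeq]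
    have h1 := kapL_sq_le (D := D) a
    have h2 := kapL_le_two_mul (D := D) a
    have h3 : C * D.kapL a ≤ C * (2 * D.B) := mul_le_mul_of_nonneg_left h2 (by positivity)
    exact mul_le_mul_of_nonneg_left (by nlinarith [sq_nonneg (D.kapL a)]) hε.le
  obtain ⟨c₀, hc₀, hk₀⟩ := h.exists_kapL_eq_zero
  obtain ⟨bs, hbsA, hbs, hbsmax⟩ := D.exists_max_virtual h.isCompact ⟨c₀, hc₀⟩ h.injOn_kapL
    (fun a ha a' ha' hk => h.steeperLE ha ha' hk) hρc
  obtain ⟨y, k, hym, hyY, hk, hyk, hyge⟩ := D.exists_deterministic_rule h.measurableSet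
    ⟨out, h.out_mem⟩ h.injOn (fun t => h.ae_mem _ (hbsA t)) hbs hρ₀c
  obtain ⟨σ, Cσ, hσ, hσC, hρσ, hσatt⟩ := h.exists_cost_envelope hρc fun a _ => hρ0 a
  have hF := h.integral_le_of_virtual_le hym hyY hk hyk hσ hσC hρσ hbsmax
  have hvm : Measurable fun t => D.v (y t) t := measurable_along D.continuous_v hym
  have hvtm : Measurable fun t => D.vt (y t) t := measurable_along D.continuous_vt hym
  have ivt : IntervalIntegrable (fun t => D.G t * D.vt (y t) t) volume D.lo D.hi :=
    (intervalIntegrable_of_bound hvtm fun t => D.abs_vt_le _ _).continuousOn_mul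
      D.continuous_G.continuousOn
  have ivf : IntervalIntegrable (fun t => D.v (y t) t * D.f t) volume D.lo D.hi :=
    (intervalIntegrable_of_bound hvm fun t => D.abs_v_le _ _).mul_continuousOn
      D.continuous_f.continuousOn
  have iσ : IntervalIntegrable (fun t => σ (k t) * D.f t) volume D.lo D.hi :=
    (intervalIntegrable_of_bound (hσ.measurable.comp hk.measurable) fun t => hσC _).mul_continuousOn
      D.continuous_f.continuousOn
  have hρ₀b : ∀ x, ρ₀ (D.kap x) ≤ ε * (C * (2 * D.B)) := fun x => by
    have h3 : C * D.kap x ≤ C * (2 * D.B) := mul_le_mul_of_nonneg_left (D.kap_le x) (by positivity)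
    exact mul_le_mul_of_nonneg_left (by nlinarith [sq_nonneg (D.kap x)]) hε.le
  have iρ : IntervalIntegrable (fun t => ρ₀ (D.kap (y t)) * D.f t) volume D.lo D.hi :=
    (intervalIntegrable_of_bound (hρ₀c.measurable.comp (D.continuous_kap.measurable.comp hym))
      (C := ε * (C * (2 * D.B))) fun t => by
        simp only [Function.comp]
        rw [abs_of_nonneg (hρ₀0 _)]; exact hρ₀b _).mul_continuousOn
      D.continuous_f.continuousOn
  -- the envelope of the cost is attained almost everywhere along the quantile
  have hσle : ∀ z, 0 ≤ z → z ≤ 2 * D.B → σ z ≤ ρ₀ z ∧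
      (σ z = ρ₀ z → ∃ a ∈ A, D.kapSq a = D.kapL a ^ 2 ∧ D.kapL a = z) := by
    -- The lottery attaining `σ z` is no steeper than `z`. If it is strictly flatter, strict
    -- monotonicity of `ρ₀` excludes equality; if not, equality in Jensen forces zero variance.
    intro z hz hz'
    obtain ⟨c, hc, hcz, hcσ⟩ := hσatt z hz
    have h1 := hρle c
    rcases eq_or_lt_of_le hcz with he | hlt
    · rw [← hcσ, ← he]
      refine ⟨h1, fun h2 => ⟨c, hc, ?_, rfl⟩⟩
      rw [hρeq] at h2
      have h3 := mul_left_cancel₀ hε.ne' h2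
      linarith
    · have h2 := hρ₀m _ _ (kapL_nonneg c) hlt hz'
      rw [← hcσ]
      exact ⟨h1.trans h2.le, fun h3 => absurd h3 (by linarith)⟩
  have hle1 : ∀ᵐ t, σ (k t) ≤ ρ₀ (D.kap (y t)) := by
    filter_upwards [hyk] with t ht
    rw [← ht]
    exact (hσle _ (D.kap_nonneg _) (D.kap_le _)).1
  -- The quantile `y` with cost `ρ₀` does at least as well as the maximiser `bs`, while covering
  -- shows that `y` with the cheaper cost `σ` does at most as well as `bs`. The average of `ρ₀ - σ`
  -- along `y` is thus nonpositive. As it is pointwise nonnegative almost everywhere, it vanishes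
  -- almost everywhere, so `y` has the steepness of point masses in `A`.
  have hdiff : ∫ t in D.lo..D.hi, (ρ₀ (D.kap (y t)) * D.f t - σ (k t) * D.f t) ≤ 0 := by
    have h1 := hyge
    change D.virtual ρ bs ≤ _ at h1
    have e1 : ∫ t in D.lo..D.hi, ((D.v (y t) t - σ (k t)) * D.f t - D.G t * D.vt (y t) t) =
        (∫ t in D.lo..D.hi, D.v (y t) t * D.f t) - (∫ t in D.lo..D.hi, σ (k t) * D.f t) -
          ∫ t in D.lo..D.hi, D.G t * D.vt (y t) t := by
      rw [← intervalIntegral.integral_sub ivf iσ, ← intervalIntegral.integral_sub (ivf.sub iσ) ivt]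
      exact intervalIntegral.integral_congr fun t _ => by ring
    have e2 : ∫ t in D.lo..D.hi, ((D.v (y t) t - ρ₀ (D.kap (y t))) * D.f t - D.G t * D.vt (y t) t) =
        (∫ t in D.lo..D.hi, D.v (y t) t * D.f t) - (∫ t in D.lo..D.hi, ρ₀ (D.kap (y t)) * D.f t) -
          ∫ t in D.lo..D.hi, D.G t * D.vt (y t) t := by
      rw [← intervalIntegral.integral_sub ivf iρ, ← intervalIntegral.integral_sub (ivf.sub iρ) ivt]
      exact intervalIntegral.integral_congr fun t _ => by ring
    rw [e1] at hF
    rw [e2] at h1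
    rw [intervalIntegral.integral_sub iρ iσ]
    linarith
  have hnn : 0 ≤ᵐ[volume.restrict (Ioc D.lo D.hi)]
      fun t => ρ₀ (D.kap (y t)) * D.f t - σ (k t) * D.f t := by
    filter_upwards [ae_restrict_of_ae hle1] with t ht
    have := D.f_pos t
    simp only [Pi.zero_apply]
    rw [← sub_mul]
    exact mul_nonneg (by linarith) this.le
  have hzero : ∀ᵐ t ∂(volume.restrict (Ioc D.lo D.hi)),
      ∃ a ∈ A, D.kapSq a = D.kapL a ^ 2 ∧ D.kapL a = k t := by
    have h1 : ∫ t in D.lo..D.hi, (ρ₀ (D.kap (y t)) * D.f t - σ (k t) * D.f t) = 0 := by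
      refine le_antisymm hdiff ?_
      rw [intervalIntegral.integral_of_le hle]
      exact integral_nonneg_of_ae hnn
    rw [intervalIntegral.integral_of_le hle, integral_eq_zero_iff_of_nonneg_ae hnn
      ((intervalIntegrable_iff_integrableOn_Ioc_of_le hle).mp (iρ.sub iσ))] at h1
    filter_upwards [h1, ae_restrict_of_ae hyk] with t ht htk
    simp only [Pi.zero_apply] at ht
    rw [← sub_mul] at ht
    have h2 := (mul_eq_zero.mp ht).resolve_right (D.f_pos t).ne'
    rw [htk] at h2
    exact (hσle (k t) (htk ▸ D.kap_nonneg _) (htk ▸ D.kap_le _)).2 (by linarith)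
  obtain ⟨b', hb'A, hb', hb'v⟩ := h.exists_degenerate_rule hyY hk hyk hzero
  refine ⟨b', hb'A, hb', fun b hbA hb => ?_⟩
  -- The cost can be dropped from the upper bound because it is nonnegative. On the side of `b` it
  -- costs at most its supremum, which is of order `ε`.
  have hmain : D.virtual ρ b ≤ D.virtual (fun _ => 0) b' := by
    refine (hbsmax b hbA hb).trans (hyge.trans ?_)
    rw [hb'v]
    refine intervalIntegral.integral_mono_on hle ?_ (ivf.sub ivt) fun t _ => ?_
    · refine ((ivf.sub iρ).sub ivt).congr ?_
      intro t _
      ring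
    · have := mul_nonneg (hρ₀0 (y t)) (D.f_pos t).le
      linarith
  have hmb : Monotone fun t => D.kapL (b t) := fun s t hst => SteeperLE.kapL_le D (hb s t hst)
  have m0 := D.measurable_virtual_integrand h.isCompact h.injOn_kapL hbA hmb
    (ρ := fun _ => 0) continuous_const
  have m1 := D.measurable_virtual_integrand h.isCompact h.injOn_kapL hbA hmb hρc
  obtain ⟨GB, hGB⟩ := (isCompact_Icc (a := D.lo) (b := D.hi)).exists_bound_of_continuousOn
    D.continuous_G.continuousOn
  have hint : ∀ ρ' : ProbabilityMeasure X → ℝ, (∀ a, 0 ≤ ρ' a) →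
      (∀ a, ρ' a ≤ ε * (C * (2 * D.B))) →
      Measurable (fun t => (D.val (b t) t - ρ' (b t)) * D.f t - D.G t * D.valt (b t) t) →
      IntervalIntegrable (fun t => (D.val (b t) t - ρ' (b t)) * D.f t - D.G t * D.valt (b t) t)
        volume D.lo D.hi := by
    intro ρ' h0 h1 hm
    rw [intervalIntegrable_iff_integrableOn_Ioc_of_le hle]
    refine Integrable.of_bound (C := (D.B + ε * (C * (2 * D.B))) * D.B + GB * D.B)
      hm.aestronglyMeasurable ?_
    filter_upwards [ae_restrict_mem measurableSet_Ioc] with t ht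
    refine (abs_sub _ _).trans (add_le_add ?_ ?_)
    · rw [abs_mul]
      have h3 : |D.val (b t) t - ρ' (b t)| ≤ D.B + ε * (C * (2 * D.B)) :=
        (abs_sub _ _).trans (add_le_add (D.abs_val_le _ _) (by
          rw [abs_of_nonneg (h0 _)]; exact h1 _))
      exact mul_le_mul h3 (D.abs_f_le t) (abs_nonneg _) ((abs_nonneg _).trans h3)
    · rw [abs_mul]
      have h3 : |D.G t| ≤ GB := hGB t (Ioc_subset_Icc_self ht)
      exact mul_le_mul h3 (D.abs_valt_le _ _) (abs_nonneg _) ((abs_nonneg _).trans h3)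
  have i0 := hint (fun _ => 0) (fun _ => le_rfl) (fun _ => by positivity) m0
  have i1 := hint ρ hρ0 hρub m1
  have hcmp : D.virtual (fun _ => 0) b ≤ ∫ t in D.lo..D.hi,
      (((D.val (b t) t - ρ (b t)) * D.f t - D.G t * D.valt (b t) t) +
        ε * (C * (2 * D.B)) * D.B) := by
    refine intervalIntegral.integral_mono_on hle i0 (i1.add intervalIntegrable_const) fun t _ => ?_
    have h1 : ρ (b t) * D.f t ≤ ε * (C * (2 * D.B)) * D.B :=
      mul_le_mul (hρub _) ((le_abs_self _).trans (D.abs_f_le t)) (D.f_pos t).le (by positivity)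
    linarith
  rw [intervalIntegral.integral_add i1 intervalIntegrable_const,
    intervalIntegral.integral_const, smul_eq_mul] at hcmp
  change _ ≤ D.virtual ρ b + _ at hcmp
  linarith

/-- **Optimality of monotone deterministic rules on the frontier** among monotone rules with values
in the covering chain. -/
theorem exists_optimal_rule : ∃ y : ℝ → X, Measurable y ∧ (∀ t, y t ∈ Y) ∧
    Monotone (fun t => D.kap (y t)) ∧
    ∀ b : ℝ → ProbabilityMeasure X, (∀ t, b t ∈ A) → (∀ s t, s ≤ t → D.SteeperLE (b s) (b t)) →
      D.virtual (fun _ => 0) b ≤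
        ∫ t in D.lo..D.hi, (D.v (y t) t * D.f t - D.G t * D.vt (y t) t) := by
  obtain ⟨c₀, hc₀, hk₀⟩ := h.exists_kapL_eq_zero
  -- The maximiser is taken over the degenerate members of `A` and without cost, so one rule serves
  -- every `ε` in the comparison.
  obtain ⟨b, hbA, hb, hbmax⟩ := D.exists_max_virtual h.isCompact_degenerate
    ⟨c₀, hc₀, kapSq_eq_of_kapL_eq_zero hk₀⟩ (h.injOn_kapL.mono fun a ha => ha.1)
    (fun a ha a' ha' hk => h.steeperLE ha.1 ha'.1 hk) (ρ := fun _ => 0) continuous_const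
  obtain ⟨io, hiom, hioY, hio⟩ := D.exists_allocation_of_kap h.measurableSet ⟨out, h.out_mem⟩ h.injOn
  have hmono : Monotone fun t => D.kapL (b t) := fun s t hst => SteeperLE.kapL_le D (hb s t hst)
  have hkio : ∀ t, D.kap (io (D.kapL (b t))) = D.kapL (b t) := fun t => by
    obtain ⟨y, hy, hyk, -⟩ := h.exists_eq_of_degenerate (hbA t).1 (hbA t).2
    rw [← hyk, hio y hy]
  refine ⟨fun t => io (D.kapL (b t)), hiom.comp hmono.measurable, fun t => hioY _, ?_,
    fun b₁ hb₁A hb₁ => ?_⟩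
  · simpa only [hkio] using hmono
  · have e : ∫ t in D.lo..D.hi, (D.v (io (D.kapL (b t))) t * D.f t -
        D.G t * D.vt (io (D.kapL (b t))) t) = D.virtual (fun _ => 0) b := by
      refine intervalIntegral.integral_congr fun t _ => ?_
      obtain ⟨e1, e2⟩ := h.val_eq_of_degenerate (hbA t).1 (hbA t).2 (hioY _) (hkio t) t
      simp only
      rw [e1, e2, sub_zero]
    rw [e]
    set Q : ℝ := ((4 * D.B + 1) * (2 * D.B)) * D.B * (D.hi - D.lo) with hQ
    have hQ0 : 0 ≤ Q := by
      have := D.B_nonneg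
      have := sub_nonneg.mpr D.lo_lt_hi.le
      positivity
    refine le_of_forall_pos_le_add fun ε hε => ?_
    obtain ⟨b', hb'A, hb', hb'v⟩ := h.exists_degenerate_rule_ge (ε := ε / (Q + 1)) (by positivity)
    have h1 := hb'v b₁ hb₁A hb₁
    have h2 := hbmax b' hb'A hb'
    have h3 : ε / (Q + 1) * ((4 * D.B + 1) * (2 * D.B)) * D.B * (D.hi - D.lo) ≤ ε := by
      calc _ = ε * (Q / (Q + 1)) := by rw [hQ]; ring
        _ ≤ ε * 1 := mul_le_mul_of_nonneg_left ((div_le_one (by positivity)).mpr (by linarith)) hε.le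
        _ = ε := mul_one _
    linarith

end IsFrontier

end

end ExtendedScreening

/-! ### From the screening model to extended primitives -/

namespace ScreeningModel

noncomputable section

set_option linter.unusedSectionVars false

section Basic

variable {X : Type*} [MetricSpace X] (M : ScreeningModel X)

/-- The type closest to a given real number. -/
def clamp (t : ℝ) : ℝ := max M.tlo (min t M.thi)

lemma clamp_mem (t : ℝ) : M.clamp t ∈ M.types :=
  ⟨le_max_left _ _, max_le M.tlo_lt_thi.le (min_le_right _ _)⟩

lemma clamp_of_mem {t : ℝ} (ht : t ∈ M.types) : M.clamp t = t := by
  rw [clamp, min_eq_left ht.2, max_eq_right ht.1]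

lemma continuous_clamp : Continuous M.clamp := by unfold clamp; fun_prop

lemma monotone_clamp : Monotone M.clamp := fun _ _ h =>
  max_le_max le_rfl (min_le_min h le_rfl)

lemma abs_clamp_sub_le (s t : ℝ) : |M.clamp s - M.clamp t| ≤ |s - t| := by
  unfold clamp
  refine (abs_max_sub_max_le_max _ _ _ _).trans (max_le (by simp) ?_)
  exact (abs_min_sub_min_le_max _ _ _ _).trans (max_le le_rfl (by simp))

lemma monotoneOn_v (x : X) : MonotoneOn (M.v x) M.types := by
  by_cases h : x = M.out
  · intro s hs t ht _
    rw [h, M.v_out s hs, M.v_out t ht]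
  · exact (M.v_strictMono x h).monotoneOn

lemma strictMonoOn_F : StrictMonoOn M.F M.types := by
  refine strictMonoOn_of_deriv_pos (convex_Icc _ _)
    (fun t ht => (M.hasDeriv_F t ht).continuousWithinAt) fun t ht => ?_
  rw [interior_Icc] at ht
  rw [((M.hasDeriv_F t (Ioo_subset_Icc_self ht)).hasDerivAt (Icc_mem_nhds ht.1 ht.2)).deriv]
  exact M.f_pos t (Ioo_subset_Icc_self ht)

lemma F_mem {t : ℝ} (ht : t ∈ M.types) : M.F t ∈ Icc (0 : ℝ) 1 := by
  have h1 := M.strictMonoOn_F.monotoneOn (left_mem_Icc.mpr M.tlo_lt_thi.le) ht ht.1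
  have h2 := M.strictMonoOn_F.monotoneOn ht (right_mem_Icc.mpr M.tlo_lt_thi.le) ht.2
  rw [M.F_tlo] at h1
  rw [M.F_thi] at h2
  exact ⟨h1, h2⟩

lemma quantile_F {t : ℝ} (ht : t ∈ M.types) : M.quantile (M.F t) = t :=
  M.strictMonoOn_F.injOn.leftInvOn_invFunOn ht

lemma exists_F_eq {u : ℝ} (hu : u ∈ Icc (0 : ℝ) 1) : ∃ t ∈ M.types, M.F t = u := by
  have := intermediate_value_Icc M.tlo_lt_thi.le (f := M.F)
    (fun t ht => (M.hasDeriv_F t ht).continuousWithinAt)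
  rw [M.F_tlo, M.F_thi] at this
  exact this hu

lemma demand_one_sub_F (x : X) {t : ℝ} (ht : t ∈ M.types) : M.demand x (1 - M.F t) = M.v x t := by
  rw [demand, sub_sub_cancel, M.quantile_F ht]

lemma integral_f : ∫ t in M.tlo..M.thi, M.f t = 1 := by
  rw [intervalIntegral.integral_eq_sub_of_hasDeriv_right_of_le M.tlo_lt_thi.le
    (fun t ht => (M.hasDeriv_F t ht).continuousWithinAt) (fun t ht =>
      ((M.hasDeriv_F t (Ioo_subset_Icc_self ht)).hasDerivAt
        (Icc_mem_nhds ht.1 ht.2)).hasDerivWithinAt), M.F_thi, M.F_tlo, sub_zero]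
  exact M.continuousOn_f.intervalIntegrable_of_Icc M.tlo_lt_thi.le

end Basic

section Extension

variable {X : Type*} [MetricSpace X] [CompactSpace X] (M : ScreeningModel X)

lemma exists_bound : ∃ B : ℝ, 0 ≤ B ∧ ∀ t ∈ M.types, |M.f t| ≤ B ∧ |M.lam t| ≤ B ∧
    ∀ x, |M.v x t| ≤ B ∧ |M.vt x t| ≤ B := by
  have hc : IsCompact ((univ : Set X) ×ˢ Icc M.tlo M.thi) := isCompact_univ.prod isCompact_Icc
  obtain ⟨B₁, h₁⟩ := (isCompact_Icc (a := M.tlo) (b := M.thi)).exists_bound_of_continuousOn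
    M.continuousOn_f
  obtain ⟨B₂, h₂⟩ := (isCompact_Icc (a := M.tlo) (b := M.thi)).exists_bound_of_continuousOn
    M.continuousOn_lam
  obtain ⟨B₃, h₃⟩ := hc.exists_bound_of_continuousOn M.continuousOn_v
  obtain ⟨B₄, h₄⟩ := hc.exists_bound_of_continuousOn M.continuousOn_vt
  refine ⟨max 0 (max (max B₁ B₂) (max B₃ B₄)), le_max_left _ _, fun t ht => ⟨?_, ?_, fun x => ⟨?_, ?_⟩⟩⟩
  · exact (h₁ t ht).trans (by simp)
  · exact (h₂ t ht).trans (by simp)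
  · exact (h₃ (x, t) ⟨mem_univ _, ht⟩).trans (by simp)
  · exact (h₄ (x, t) ⟨mem_univ _, ht⟩).trans (by simp)

/-- The primitives of a screening problem, extended to all of `ℝ` by constants. -/
def extend : ExtendedScreening X where
  lo := M.tlo
  hi := M.thi
  lo_lt_hi := M.tlo_lt_thi
  f t := M.f (M.clamp t)
  lam t := M.lam (M.clamp t)
  v x t := M.v x (M.clamp t)
  vt x t := M.vt x (M.clamp t)
  B := M.exists_bound.choose
  continuous_f := M.continuousOn_f.comp_continuous M.continuous_clamp M.clamp_mem
  f_pos t := M.f_pos _ (M.clamp_mem t)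
  continuous_lam := M.continuousOn_lam.comp_continuous M.continuous_clamp M.clamp_mem
  antitone_lam s t h := M.lam_antitone (M.clamp_mem s) (M.clamp_mem t) (M.monotone_clamp h)
  continuous_v := M.continuousOn_v.comp_continuous
    (f := fun z : X × ℝ => (z.1, M.clamp z.2)) (by have := M.continuous_clamp; fun_prop)
    fun z => ⟨mem_univ _, M.clamp_mem z.2⟩
  continuous_vt := M.continuousOn_vt.comp_continuous
    (f := fun z : X × ℝ => (z.1, M.clamp z.2)) (by have := M.continuous_clamp; fun_prop)
    fun z => ⟨mem_univ _, M.clamp_mem z.2⟩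
  abs_f_le t := (M.exists_bound.choose_spec.2 _ (M.clamp_mem t)).1
  abs_lam_le t := (M.exists_bound.choose_spec.2 _ (M.clamp_mem t)).2.1
  abs_v_le x t := ((M.exists_bound.choose_spec.2 _ (M.clamp_mem t)).2.2 x).1
  abs_vt_le x t := ((M.exists_bound.choose_spec.2 _ (M.clamp_mem t)).2.2 x).2
  lipschitz_v x s t := by
    have h := Convex.norm_image_sub_le_of_norm_hasDerivWithin_le (M.hasDeriv_v x)
      (fun r hr => ((M.exists_bound.choose_spec.2 r hr).2.2 x).2) (convex_Icc _ _)
      (M.clamp_mem t) (M.clamp_mem s)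
    exact h.trans (mul_le_mul_of_nonneg_left (M.abs_clamp_sub_le s t) M.exists_bound.choose_spec.1)
  monotone_v x s t h := M.monotoneOn_v x (M.clamp_mem s) (M.clamp_mem t) (M.monotone_clamp h)
  hasDeriv_v x t ht := by
    rw [M.clamp_of_mem ht]
    exact (M.hasDeriv_v x t ht).congr (fun s hs => by rw [M.clamp_of_mem hs])
      (by rw [M.clamp_of_mem ht])
  mean_nonneg := by
    have hle := M.tlo_lt_thi.le
    have h1 : ∫ t in M.tlo..M.thi, (1 - M.lam (M.clamp t)) * M.f (M.clamp t) =
        ∫ t in M.tlo..M.thi, (M.f t - M.lam t * M.f t) := by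
      refine intervalIntegral.integral_congr fun t ht => ?_
      rw [uIcc_of_le hle] at ht
      simp only [M.clamp_of_mem ht]
      ring
    rw [h1, intervalIntegral.integral_sub (M.continuousOn_f.intervalIntegrable_of_Icc hle)
      (g := fun t => M.lam t * M.f t)
      (ContinuousOn.intervalIntegrable_of_Icc hle (M.continuousOn_lam.mul M.continuousOn_f)),
      M.integral_f,
      intervalIntegral.integral_of_le hle, ← integral_Icc_eq_integral_Ioc]
    linarith [M.lam_mean]

lemma extend_v (x : X) {t : ℝ} (ht : t ∈ M.types) : M.extend.v x t = M.v x t :=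
  congrArg (M.v x) (M.clamp_of_mem ht)

lemma extend_v_out (t : ℝ) : M.extend.v M.out t = 0 := M.v_out _ (M.clamp_mem t)

lemma kap_out : M.extend.kap M.out = 0 := by
  simp [ExtendedScreening.kap, extend_v_out]

lemma kap_pos {x : X} (hx : x ≠ M.out) : 0 < M.extend.kap x := by
  have hl : M.tlo ∈ M.types := left_mem_Icc.mpr M.tlo_lt_thi.le
  have hh : M.thi ∈ M.types := right_mem_Icc.mpr M.tlo_lt_thi.le
  change 0 < M.extend.v x M.thi - M.extend.v x M.tlo
  rw [M.extend_v x hl, M.extend_v x hh]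
  exact sub_pos.mpr (M.v_strictMono x hx hl hh M.tlo_lt_thi)

end Extension

section Frontier

variable {X : Type*} [MetricSpace X] [CompactSpace X] [MeasurableSpace X] [BorelSpace X]
  (M : ScreeningModel X)

/-- A lottery on a set of allocations as a lottery on all allocations. -/
def push {Y : Set X} (a : ProbabilityMeasure Y) : ProbabilityMeasure X :=
  a.map (f := Subtype.val) measurable_subtype_coe.aemeasurable

lemma integral_push {Y : Set X} (a : ProbabilityMeasure Y) {g : X → ℝ} (hg : Measurable g) :
    ∫ x, g x ∂(push a : Measure X) = ∫ y : Y, g y ∂(a : Measure Y) :=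
  integral_map measurable_subtype_coe.aemeasurable hg.aestronglyMeasurable

lemma val_push {Y : Set X} (a : ProbabilityMeasure Y) (t : ℝ) :
    M.extend.val (push a) t = ∫ y : Y, M.extend.v y t ∂(a : Measure Y) :=
  integral_push a (M.extend.continuous_v_left t).measurable

lemma lotteryDemand_one_sub_F {Y : Set X} (a : ProbabilityMeasure Y) {t : ℝ} (ht : t ∈ M.types) :
    M.lotteryDemand a (1 - M.F t) = M.extend.val (push a) t := by
  rw [val_push, lotteryDemand]
  exact integral_congr_ae (Filter.Eventually.of_forall fun y => by
    simp only [M.demand_one_sub_F _ ht, M.extend_v _ ht])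

/-- The point mass at an allocation. -/
def pure (x : X) : ProbabilityMeasure X := ⟨Measure.dirac x, inferInstance⟩

lemma integral_pure (x : X) (g : X → ℝ) : ∫ y, g y ∂(pure x : Measure X) = g x :=
  integral_dirac g x

lemma val_pure (x : X) (t : ℝ) : M.extend.val (pure x) t = M.extend.v x t := integral_pure _ _

lemma integrable_comp_kap (D : ExtendedScreening X) (a : ProbabilityMeasure X) {g : ℝ → ℝ}
    (hg : Monotone g) : Integrable (fun y => g (D.kap y)) (a : Measure X) := by
  refine Integrable.of_bound (C := max |g 0| |g (2 * D.B)|)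
    (hg.measurable.comp D.continuous_kap.measurable).aestronglyMeasurable
    (Filter.Eventually.of_forall fun y => ?_)
  exact abs_le_max_abs_abs (hg (D.kap_nonneg y)) (hg (D.kap_le y))

/-- The outside option has constant value and the least possible steepness, so it can be placed
below any chain. -/
lemma steeperLE_pure_out (a : ProbabilityMeasure X) : M.extend.SteeperLE (pure M.out) a := by
  refine ⟨fun s t hst => ?_, fun g hg => ?_⟩
  · rw [val_pure, val_pure, extend_v_out, extend_v_out, sub_zero]
    exact sub_nonneg.mpr (M.extend.monotone_val a hst)
  · rw [integral_pure, kap_out]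
    have h := integral_mono (μ := (a : Measure X)) (integrable_const (g 0))
      (integrable_comp_kap M.extend a hg) fun y => hg (M.extend.kap_nonneg y)
    simpa using h

lemma strictMonoOn_of_strictAntiOn_demand {x x' : X}
    (h : StrictAntiOn (fun q => M.demand x' q - M.demand x q) (Icc (0 : ℝ) 1)) :
    StrictMonoOn (fun t => M.v x' t - M.v x t) M.types := by
  intro s hs t ht hst
  have h1 := M.F_mem hs
  have h2 := M.F_mem ht
  have h3 := h (a := 1 - M.F t) (b := 1 - M.F s) ⟨by linarith [h2.2], by linarith [h2.1]⟩
    ⟨by linarith [h1.2], by linarith [h1.1]⟩ (by linarith [M.strictMonoOn_F hs ht hst])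
  simpa only [M.demand_one_sub_F _ hs, M.demand_one_sub_F _ ht] using h3

/-- A generalized frontier, together with the outside option, in terms of types. -/
theorem IsGeneralizedFrontier.exists_isFrontier {Y : Set X} (hY : M.IsGeneralizedFrontier Y) :
    ∃ A, M.extend.IsFrontier M.out (insert M.out Y) A := by
  obtain ⟨hYm, _, A, hA, hchain, hcov, hinc⟩ := hY
  have hl : M.tlo ∈ M.types := left_mem_Icc.mpr M.tlo_lt_thi.le
  have hh : M.thi ∈ M.types := right_mem_Icc.mpr M.tlo_lt_thi.le
  have hincr : ∀ x x' : Y, x ≤ x' → Monotone fun t => M.extend.v x' t - M.extend.v x t := by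
    intro x x' hxx s t hst
    rcases eq_or_lt_of_le hxx with rfl | hlt
    · simp
    · exact (M.strictMonoOn_of_strictAntiOn_demand (hinc x x' hlt)).monotoneOn (M.clamp_mem s)
        (M.clamp_mem t) (M.monotone_clamp hst)
  have hkap : ∀ x x' : Y, x < x' → M.extend.kap x < M.extend.kap x' := by
    intro x x' hlt
    have := M.strictMonoOn_of_strictAntiOn_demand (hinc x x' hlt) hl hh M.tlo_lt_thi
    change M.extend.v x M.thi - M.extend.v x M.tlo < M.extend.v x' M.thi - M.extend.v x' M.tlo
    simp only [M.extend_v _ hl, M.extend_v _ hh]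
    linarith
  -- Steepness is strictly increasing along the given total order, so it recovers that order.
  have hle : ∀ x x' : Y, M.extend.kap x ≤ M.extend.kap x' → x ≤ x' := fun x x' hk =>
    not_lt.mp fun hlt => absurd (hkap x' x hlt) (not_lt.mpr hk)
  -- Increments of value between two types and monotone functions of steepness are both bounded and
  -- monotone along the order, so both are admissible test functions for stochastic dominance.
  have hst : ∀ a a' : ProbabilityMeasure Y, StochasticLE a a' →
      M.extend.SteeperLE (push a) (push a') := by
    intro a a' haa
    refine ⟨fun s t hs => ?_, fun g hg => ?_⟩
    · rw [M.extend.val_sub, M.extend.val_sub]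
      have hc : Measurable fun y => M.extend.v y t - M.extend.v y s :=
        ((M.extend.continuous_v_left t).sub (M.extend.continuous_v_left s)).measurable
      rw [integral_push a hc, integral_push a' hc]
      refine haa _ (fun y y' hyy => ?_) (hc.comp measurable_subtype_coe) ⟨M.extend.B * |t - s|, fun y =>
        M.extend.lipschitz_v y t s⟩
      have := hincr y y' hyy hs
      simp only at this
      linarith
    · have hc : Measurable fun y => g (M.extend.kap y) :=
        hg.measurable.comp M.extend.continuous_kap.measurable
      rw [integral_push a hc, integral_push a' hc]
      refine haa _ (fun y y' hyy => ?_) (hc.comp measurable_subtype_coe)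
        ⟨max |g 0| |g (2 * M.extend.B)|, fun y =>
          abs_le_max_abs_abs (hg (M.extend.kap_nonneg y)) (hg (M.extend.kap_le y))⟩
      rcases eq_or_lt_of_le hyy with rfl | hlt
      · exact le_rfl
      · exact hg (hkap y y' hlt).le
  -- The outside option need not be covered by the given lotteries. Its point mass covers it and
  -- leaves the family a compact chain.
  refine ⟨insert (pure M.out) (push '' A), hYm.insert _, mem_insert _ _, M.extend_v_out, ?_, ?_, ?_,
    ?_, ?_, ?_⟩
  · rintro x hx x' hx' hk
    by_cases h1 : x = M.out <;> by_cases h2 : x' = M.out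
    · rw [h1, h2]
    · have := M.kap_pos h2
      rw [← hk, h1, kap_out] at this
      exact absurd this (lt_irrefl _)
    · have := M.kap_pos h1
      rw [hk, h2, kap_out] at this
      exact absurd this (lt_irrefl _)
    · have e1 : x ∈ Y := hx.resolve_left h1
      have e2 : x' ∈ Y := hx'.resolve_left h2
      exact congrArg Subtype.val (le_antisymm (hle ⟨x, e1⟩ ⟨x', e2⟩ hk.le) (hle ⟨x', e2⟩ ⟨x, e1⟩ hk.ge))
  · exact (hA.image (ProbabilityMeasure.continuous_map continuous_subtype_val)).insert _
  · rintro a (rfl | ⟨a, -, rfl⟩)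
    · exact (ae_dirac_iff (hYm.insert _)).mpr (mem_insert _ _)
    · refine (ae_map_iff measurable_subtype_coe.aemeasurable (hYm.insert _)).mpr ?_
      exact Filter.Eventually.of_forall fun y => Or.inr y.2
  · rintro a (rfl | ⟨a, ha, rfl⟩) a' ha'
    · exact Or.inl (M.steeperLE_pure_out a')
    · rcases ha' with rfl | ⟨a', ha', rfl⟩
      · exact Or.inr (M.steeperLE_pure_out _)
      · exact (hchain a ha a' ha').imp (hst a a') (hst a' a)
  · intro x t ht
    by_cases hx : x = M.out
    · refine ⟨pure M.out, mem_insert _ _, ?_, ?_, ?_⟩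
      all_goals simp [hx, val_pure]
    · have hFt := M.F_mem ht
      obtain ⟨a, ha, h1, h2⟩ := hcov x hx (1 - M.F t) ⟨by linarith [hFt.2], by linarith [hFt.1]⟩
      have h3 : ∀ s ∈ M.types, t ≤ s → M.extend.val (push a) s ≤ M.extend.v x s := by
        intro s hs hts
        have hFs := M.F_mem hs
        have := h1 (1 - M.F s) ⟨by linarith [hFs.2], by linarith [hFs.1]⟩
          (by linarith [M.strictMonoOn_F.monotoneOn ht hs hts])
        rwa [M.lotteryDemand_one_sub_F a hs, M.demand_one_sub_F x hs, ← M.extend_v x hs] at this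
      have h4 : ∀ s ∈ M.types, s ≤ t → M.extend.v x s ≤ M.extend.val (push a) s := by
        intro s hs hts
        have hFs := M.F_mem hs
        have := h2 (1 - M.F s) ⟨by linarith [hFs.2], by linarith [hFs.1]⟩
          (by linarith [M.strictMonoOn_F.monotoneOn hs ht hts])
        rwa [M.lotteryDemand_one_sub_F a hs, M.demand_one_sub_F x hs, ← M.extend_v x hs] at this
      exact ⟨push a, Or.inr ⟨a, ha, rfl⟩, le_antisymm (h3 t ht le_rfl) (h4 t ht le_rfl), h3, h4⟩
  · rintro x hx x' hx' hk
    by_cases h1 : x = M.out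
    · simpa [h1, extend_v_out] using M.extend.monotone_v x'
    · by_cases h2 : x' = M.out
      · have := M.kap_pos h1
        rw [h2, kap_out] at hk
        linarith
      · exact hincr ⟨x, hx.resolve_left h1⟩ ⟨x', hx'.resolve_left h2⟩ (hle _ _ hk)

end Frontier

end

end ScreeningModel

/-! ### From mechanisms to monotone rules, and implementation -/

namespace ExtendedScreening

noncomputable section

set_option linter.unusedSectionVars false

variable {X : Type*} [MetricSpace X] [CompactSpace X] [MeasurableSpace X] [BorelSpace X]
  {D : ExtendedScreening X}

/-- A mechanism, in which type `t` values the allocation of type `s` at `w s t`, is dominated by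
monotone rules with values in a set of lotteries that covers its allocations along finite grids. -/
theorem exists_monotone_rule_of_ic {S : Set (ProbabilityMeasure X)} {w : ℝ → ℝ → ℝ} {p : ℝ → ℝ}
    (hwB : ∀ s t, |w s t| ≤ D.B) (hwL : ∀ r s t, |w r s - w r t| ≤ D.B * |s - t|)
    (hwm : Measurable fun t => w t t)
    (hic : ∀ t ∈ Icc D.lo D.hi, ∀ s ∈ Icc D.lo D.hi, w s t - p s ≤ w t t - p t)
    (hir : ∀ t ∈ Icc D.lo D.hi, 0 ≤ w t t - p t)
    (hgrid : ∀ (n : ℕ) (t : ℕ → ℝ), (∀ i < n, t i ∈ Ioo D.lo D.hi) →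
      (∀ i j, i < j → j < n → t i < t j) → ∀ η > 0, ∃ c : ℕ → ProbabilityMeasure X,
        (∀ i < n, c i ∈ S) ∧
        (∀ i < n, ∀ j < n, D.kapL (c i) ≤ D.kapL (c j) → D.SteeperLE (c i) (c j)) ∧
        (∀ i < n, w (t i) (t i) - η ≤ D.val (c i) (t i)) ∧
        ∀ i j, i < j → j < n →
          D.val (c i) (t j) - D.val (c i) (t i) ≤ w (t i) (t j) - w (t i) (t i) + η)
    {ε : ℝ} (hε : 0 < ε) :
    ∃ b : ℝ → ProbabilityMeasure X, (∀ s, b s ∈ S) ∧ (∀ s s', s ≤ s' → D.SteeperLE (b s) (b s')) ∧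
      (∫ t in D.lo..D.hi, (D.lam t * (w t t - p t) + p t) * D.f t) - ε ≤
        D.virtual (fun _ => 0) b := by
  have hle := D.lo_lt_hi.le
  have hinc : ∀ s ∈ Icc D.lo D.hi, ∀ t ∈ Icc D.lo D.hi,
      w s t - w s s ≤ (w t t - p t) - (w s s - p s) := fun s hs t ht => by
    linarith [hic t ht s hs]
  -- Incentive compatibility in both directions makes the utility of the mechanism Lipschitz, so no
  -- regularity or bound on prices is needed.
  have hlip : ∀ s ∈ Icc D.lo D.hi, ∀ t ∈ Icc D.lo D.hi,
      |(w s s - p s) - (w t t - p t)| ≤ D.B * |s - t| := by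
    intro s hs t ht
    have h1 := hinc s hs t ht
    have h2 := hinc t ht s hs
    have h3 := abs_le.mp (hwL s t s)
    have h4 := abs_le.mp (hwL t s t)
    rw [abs_sub_comm t s] at h3
    rw [abs_le]
    constructor <;> linarith [h3.1, h4.1]
  have hlo : D.lo ∈ Icc D.lo D.hi := ⟨le_rfl, hle⟩
  obtain ⟨b, hbS, hb, hbv⟩ := D.exists_monotone_rule (S := S) (ρ := fun _ => 0)
    (u := fun t => w t t - p t) (g := fun t => w t t) (C := D.B)
    (K := (w D.lo D.lo - p D.lo) + D.B * (D.hi - D.lo)) (Lu := D.B) D.B_nonneg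
    (N := ∅) measure_empty
    (fun s hs => ⟨hir s hs, by
      have h1 := (abs_le.mp (hlip s hs D.lo hlo)).2
      rw [abs_of_nonneg (sub_nonneg.mpr hs.1)] at h1
      have := mul_le_mul_of_nonneg_left (sub_le_sub_right hs.2 D.lo) D.B_nonneg
      linarith⟩) hlip (fun s => hwB s s)
    ((intervalIntegrable_of_bound hwm fun t => hwB t t).mul_continuousOn
      D.continuous_f.continuousOn)
    (fun n t ht htt η hη => by
      obtain ⟨c, h1, h2, h3, h4⟩ := hgrid n t (fun i hi => (ht i hi).1) htt η hη
      refine ⟨c, h1, h2, fun i hi => by simpa using h3 i hi, fun i j hij hj => ?_⟩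
      have h5 := hinc (t i) (Ioo_subset_Icc_self (ht i (hij.trans hj)).1) (t j)
        (Ioo_subset_Icc_self (ht j hj).1)
      exact (h4 i j hij hj).trans (by linarith)) hε
  refine ⟨b, hbS, hb, le_trans (le_of_eq ?_) hbv⟩
  congr 1
  exact intervalIntegral.integral_congr fun t _ => by ring

end

end ExtendedScreening

namespace ScreeningModel

noncomputable section

set_option linter.unusedSectionVars false

variable {X : Type*} [MetricSpace X] [CompactSpace X] [MeasurableSpace X] [BorelSpace X]
  {M : ScreeningModel X}

open ExtendedScreening in
/-- Implementation of a monotone rule by a mechanism. -/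
lemma exists_mechanism {Y : Set X} {A : Set (ProbabilityMeasure X)}
    (h : M.extend.IsFrontier M.out Y A) {y : ℝ → X} (hym : Measurable y) (hyY : ∀ t, y t ∈ Y)
    (hk : Monotone fun t => M.extend.kap (y t)) :
    ∃ p : ℝ → ℝ, M.IsMechanism y p ∧ M.objective y p = ∫ t in M.extend.lo..M.extend.hi,
      (M.extend.v (y t) t * M.extend.f t - M.extend.G t * M.extend.vt (y t) t) := by
  set D := M.extend with hD
  have hle := D.lo_lt_hi.le
  have hvm : Measurable fun t => D.v (y t) t := measurable_along D.continuous_v hym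
  have hvtm : Measurable fun t => D.vt (y t) t := measurable_along D.continuous_vt hym
  have hvtb : ∀ t, |D.vt (y t) t| ≤ D.B := fun t => D.abs_vt_le _ _
  have hvti : ∀ c d, IntervalIntegrable (fun t => D.vt (y t) t) volume c d := fun c d =>
    intervalIntegrable_of_bound hvtm hvtb
  -- The envelope rent with zero utility at the lowest type. Since slopes increase with steepness,
  -- the payments it induces satisfy the upward as well as the downward constraints.
  set u : ℝ → ℝ := fun t => ∫ s in D.lo..t, D.vt (y s) s with hu
  have hsub : ∀ s t, u t - u s = ∫ r in s..t, D.vt (y r) r := fun s t =>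
    intervalIntegral.integral_interval_sub_left (hvti _ _) (hvti _ _)
  have huc : Continuous u := intervalIntegral.continuous_primitive hvti _
  have hic : ∀ t ∈ M.types, ∀ s ∈ M.types, D.v (y s) t - D.v (y s) s ≤ u t - u s := by
    intro t ht s hs
    rcases le_total s t with hst | hst
    · rw [hsub, ← D.integral_vt _ hs.1 hst ht.2]
      refine intervalIntegral.integral_mono_on hst
        ((D.continuous_vt_right _).intervalIntegrable _ _) (hvti _ _) fun r hr => ?_
      exact h.vt_le (hyY _) (hyY _) (hk hr.1) ⟨hs.1.trans hr.1, hr.2.trans ht.2⟩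
    · have h1 : u s - u t ≤ D.v (y s) s - D.v (y s) t := by
        rw [hsub, ← D.integral_vt _ ht.1 hst hs.2]
        refine intervalIntegral.integral_mono_on hst (hvti _ _)
          ((D.continuous_vt_right _).intervalIntegrable _ _) fun r hr => ?_
        exact h.vt_le (hyY _) (hyY _) (hk hr.2) ⟨ht.1.trans hr.1, hr.2.trans hs.2⟩
      linarith
  have hv : ∀ t ∈ M.types, ∀ x, D.v x t = M.v x t := fun t ht x => M.extend_v x ht
  refine ⟨fun t => D.v (y t) t - u t, ⟨hym.comp measurable_subtype_coe,
    (hvm.sub huc.measurable).comp measurable_subtype_coe, fun t ht s hs => ?_, fun t ht => ?_⟩, ?_⟩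
  · rw [← hv t ht, ← hv t ht]
    linarith [hic t ht s hs]
  · rw [← hv t ht]
    have : 0 ≤ u t := intervalIntegral.integral_nonneg ht.1 fun r hr =>
      ExtendedScreening.vt_nonneg _ ⟨hr.1, hr.2.trans ht.2⟩
    linarith
  · have h1 : IntervalIntegrable (fun t => D.v (y t) t * D.f t) volume D.lo D.hi :=
      (intervalIntegrable_of_bound hvm fun t => D.abs_v_le _ _).mul_continuousOn
        D.continuous_f.continuousOn
    have h2 : IntervalIntegrable (fun t => D.G t * D.vt (y t) t) volume D.lo D.hi :=
      (hvti _ _).continuousOn_mul D.continuous_G.continuousOn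
    have h3 : IntervalIntegrable (fun t => (1 - D.lam t) * D.f t * u t) volume D.lo D.hi :=
      (D.continuous_weight.mul huc).intervalIntegrable _ _
    rw [intervalIntegral.integral_sub h1 h2, ← D.integral_rents hvtm.aestronglyMeasurable hvtb,
      ← intervalIntegral.integral_sub h1 h3, objective, types, integral_Icc_eq_integral_Ioc,
      ← intervalIntegral.integral_of_le M.tlo_lt_thi.le]
    refine intervalIntegral.integral_congr fun t ht => ?_
    rw [uIcc_of_le M.tlo_lt_thi.le] at ht
    have e1 : D.f t = M.f t := congrArg M.f (M.clamp_of_mem ht)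
    have e2 : D.lam t = M.lam t := congrArg M.lam (M.clamp_of_mem ht)
    rw [e1, e2, hv t ht]
    ring

lemma objective_integral_eq {w p : ℝ → ℝ} :
    ∫ t in M.types, (M.lam t * (w t - p t) + p t) * M.f t =
      ∫ t in M.extend.lo..M.extend.hi,
        (M.extend.lam t * (w t - p t) + p t) * M.extend.f t := by
  have hle := M.extend.lo_lt_hi.le
  rw [types, integral_Icc_eq_integral_Ioc, ← intervalIntegral.integral_of_le M.tlo_lt_thi.le]
  refine intervalIntegral.integral_congr fun t ht => ?_
  rw [uIcc_of_le M.tlo_lt_thi.le] at ht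
  have e1 : M.extend.f t = M.f t := congrArg M.f (M.clamp_of_mem ht)
  have e2 : M.extend.lam t = M.lam t := congrArg M.lam (M.clamp_of_mem ht)
  simp only [e1, e2]

/-- Every deterministic mechanism is dominated by monotone rules with values in the covering
chain. -/
lemma IsMechanism.exists_monotone_rule {Y : Set X} {A : Set (ProbabilityMeasure X)}
    (h : M.extend.IsFrontier M.out Y A) {x : ℝ → X} {p : ℝ → ℝ} (hm : M.IsMechanism x p)
    {ε : ℝ} (hε : 0 < ε) : ∃ b : ℝ → ProbabilityMeasure X, (∀ s, b s ∈ A) ∧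
      (∀ s s', s ≤ s' → M.extend.SteeperLE (b s) (b s')) ∧
      M.objective x p - ε ≤ M.extend.virtual (fun _ => 0) b := by
  set D := M.extend with hD
  have hcm : Measurable fun t : ℝ => (⟨M.clamp t, M.clamp_mem t⟩ : M.types) :=
    M.continuous_clamp.measurable.subtype_mk
  have hxm : Measurable fun t => x (M.clamp t) := hm.measurable_x.comp hcm
  have hx : ∀ t ∈ M.types, x (M.clamp t) = x t := fun t ht => congrArg x (M.clamp_of_mem ht)
  have hv : ∀ t ∈ M.types, ∀ x, D.v x t = M.v x t := fun t ht x => M.extend_v x ht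
  obtain ⟨b, hbA, hb, hbv⟩ := ExtendedScreening.exists_monotone_rule_of_ic (D := D) (S := A)
    (w := fun s t => D.v (x (M.clamp s)) t) (p := p) (fun s t => D.abs_v_le _ _)
    (fun r s t => D.lipschitz_v _ _ _)
    (ExtendedScreening.measurable_along D.continuous_v hxm)
    (fun t ht s hs => by
      rw [hx t ht, hx s hs, hv t ht, hv t ht]
      exact hm.ic t ht s hs)
    (fun t ht => by
      rw [hx t ht, hv t ht]
      exact hm.ir t ht)
    (fun n t ht htt η hη => by
      -- Covering at `t i` keeps the value to `t i` and lowers the value to higher types, so the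
      -- downward constraints survive. Upward constraints may fail, which is why only the relaxed
      -- problem is used.
      have hcov : ∀ i, ∃ c, i < n → c ∈ A ∧ D.val c (t i) = D.v (x (M.clamp (t i))) (t i) ∧
          (∀ s ∈ Icc D.lo D.hi, t i ≤ s → D.val c s ≤ D.v (x (M.clamp (t i))) s) := by
        intro i
        by_cases hin : i < n
        · obtain ⟨c, hc, h1, h2, -⟩ := h.cover (x (M.clamp (t i))) (t i)
            (Ioo_subset_Icc_self (ht i hin))
          exact ⟨c, fun _ => ⟨hc, h1, h2⟩⟩
        · exact ⟨pure M.out, fun h => absurd h hin⟩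
      choose c hc using hcov
      refine ⟨c, fun i hin => (hc i hin).1, fun i hin j hjn => h.steeperLE (hc i hin).1 (hc j hjn).1,
        fun i hin => by rw [(hc i hin).2.1]; linarith, fun i j hij hjn => ?_⟩
      obtain ⟨-, h1, h2⟩ := hc i (hij.trans hjn)
      have := h2 (t j) (Ioo_subset_Icc_self (ht j hjn)) (htt i j hij hjn).le
      linarith) hε
  refine ⟨b, hbA, hb, le_trans (le_of_eq ?_) hbv⟩
  rw [objective, objective_integral_eq]
  congr 1
  refine intervalIntegral.integral_congr fun t ht => ?_
  rw [uIcc_of_le D.lo_lt_hi.le] at ht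
  rw [hx t ht, hv t ht]

end

end ScreeningModel

/-! ### Domination of arbitrary lotteries by mixtures of neighbours -/

section Mixtures

/-- Two mixtures of adjacent elements of a chain are ranked in the same way by all functions that
are monotone along the chain. -/
lemma mix_le_mix {T : Set ℝ} {κ h : ℝ → ℝ} (hκ : StrictMonoOn κ T) (hh : MonotoneOn h T)
    {a b a' b' θ θ' : ℝ} (ha : a ∈ T) (hb : b ∈ T) (ha' : a' ∈ T) (hb' : b' ∈ T) (hab : a ≤ b)
    (hab' : a' ≤ b') (hadj : ∀ r ∈ T, r ≤ a ∨ b ≤ r) (hadj' : ∀ r ∈ T, r ≤ a' ∨ b' ≤ r)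
    (hθ : θ ∈ Icc (0 : ℝ) 1) (hθ' : θ' ∈ Icc (0 : ℝ) 1)
    (hk : (1 - θ) * κ a + θ * κ b ≤ (1 - θ') * κ a' + θ' * κ b') :
    (1 - θ) * h a + θ * h b ≤ (1 - θ') * h a' + θ' * h b' := by
  have low : ∀ {g : ℝ → ℝ}, MonotoneOn g T → g a' ≤ (1 - θ') * g a' + θ' * g b' := fun hg => by
    nlinarith [hg ha' hb' hab', hθ'.1]
  have low₁ : ∀ {g : ℝ → ℝ}, MonotoneOn g T → g a ≤ (1 - θ) * g a + θ * g b := fun hg => by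
    nlinarith [hg ha hb hab, hθ.1]
  have up : ∀ {g : ℝ → ℝ}, MonotoneOn g T → (1 - θ) * g a + θ * g b ≤ g b := fun hg => by
    nlinarith [hg ha hb hab, hθ.2]
  have up' : ∀ {g : ℝ → ℝ}, MonotoneOn g T → (1 - θ') * g a' + θ' * g b' ≤ g b' := fun hg => by
    nlinarith [hg ha' hb' hab', hθ'.2]
  -- a mixture that is no steeper than its lower end is the lower end
  have deg : (1 - θ) * κ a + θ * κ b ≤ κ a → (1 - θ) * h a + θ * h b = h a := fun h1 => by
    rcases eq_or_lt_of_le hab with rfl | hlt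
    · ring
    · have h2 := hκ ha hb hlt
      have h3 : θ = 0 := by
        by_contra hne
        have := lt_of_le_of_ne hθ.1 (Ne.symm hne)
        nlinarith
      rw [h3]; ring
  -- Adjacency leaves three cases: the first pair lies below the second, the lower ends coincide, or
  -- the second pair lies below the first.
  rcases lt_trichotomy a a' with hlt | rfl | hlt
  · have h1 : b ≤ a' := (hadj a' ha').resolve_left (not_le.mpr hlt)
    exact (up hh).trans ((hh hb ha' h1).trans (low hh))
  · rcases eq_or_lt_of_le hab' with rfl | hlt'
    · rw [show (1 - θ') * h a + θ' * h a = h a by ring]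
      exact (deg (hk.trans_eq (by ring))).le
    · have h2 : b ≤ b' := (hadj b' hb').resolve_left (not_le.mpr hlt')
      rcases eq_or_lt_of_le hab with rfl | hlt
      · rw [show (1 - θ) * h a + θ * h a = h a by ring]
        exact low hh
      · have h3 : b' ≤ b := (hadj' b hb).resolve_left (not_le.mpr hlt)
        obtain rfl : b = b' := le_antisymm h2 h3
        have h4 := hκ ha hb hlt
        have h5 := hh ha hb hab
        have h6 : θ ≤ θ' := by
          by_contra hne
          push Not at hne
          nlinarith
        nlinarith
  -- Here the second mixture cannot exceed `κ a` in steepness and the first cannot fall below it.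
  -- Both mixtures are therefore the point mass at `a = b'`.
  · have h1 : b' ≤ a := (hadj' a ha).resolve_left (not_le.mpr hlt)
    have h2 := hκ.monotoneOn hb' ha h1
    have e1 := deg (hk.trans ((up' hκ.monotoneOn).trans h2))
    have h3 := low₁ hκ.monotoneOn
    obtain rfl : b' = a := hκ.injOn hb' ha (by linarith [up' hκ.monotoneOn])
    have h4 := hκ ha' hb' hlt
    have h5 : θ' = 1 := by
      by_contra hne
      have := lt_of_le_of_ne hθ'.2 hne
      nlinarith
    rw [e1, h5]
    linarith

/-- Values that are dominated, from the `i`-th point on, by a profile in `C`. -/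
def relaxedProfiles {n : ℕ} (i : Fin n) (C : Set (Fin n → ℝ)) : Set (Fin n → ℝ) :=
  {w | ∃ g ∈ C, w i ≤ g i ∧ ∀ j, i < j → g j - g i ≤ w j - w i}

lemma convex_relaxedProfiles {n : ℕ} (i : Fin n) {C : Set (Fin n → ℝ)} (hC : Convex ℝ C) :
    Convex ℝ (relaxedProfiles i C) := by
  rintro w ⟨g, hg, h1, h2⟩ w' ⟨g', hg', h1', h2'⟩ a b ha hb hab
  refine ⟨a • g + b • g', hC hg hg' ha hb hab, ?_, fun j hj => ?_⟩
  · have e1 := mul_le_mul_of_nonneg_left h1 ha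
    have e2 := mul_le_mul_of_nonneg_left h1' hb
    simp only [Pi.add_apply, Pi.smul_apply, smul_eq_mul]
    linarith
  · have e1 := mul_le_mul_of_nonneg_left (h2 j hj) ha
    have e2 := mul_le_mul_of_nonneg_left (h2' j hj) hb
    simp only [Pi.add_apply, Pi.smul_apply, smul_eq_mul]
    linarith

end Mixtures

namespace ExtendedScreening

noncomputable section

set_option linter.unusedSectionVars false

variable {X : Type*} [MetricSpace X] [CompactSpace X] [MeasurableSpace X] [BorelSpace X]
  {D : ExtendedScreening X}

/-- The mixture of two allocations with weight `θ` on the second. -/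
def mix (x y : X) (θ : Icc (0 : ℝ) 1) : ProbabilityMeasure X :=
  ⟨ENNReal.ofReal (1 - θ) • Measure.dirac x + ENNReal.ofReal θ • Measure.dirac y, ⟨by
    have h1 := sub_nonneg.mpr θ.2.2
    simp [← ENNReal.ofReal_add h1 θ.2.1]⟩⟩

lemma integral_mix (x y : X) (θ : Icc (0 : ℝ) 1) (g : X → ℝ) :
    ∫ z, g z ∂(mix x y θ : Measure X) = (1 - θ) * g x + θ * g y := by
  have h : ∀ z, Integrable g (Measure.dirac z) := fun z => integrable_dirac (by simp)
  change ∫ z, g z ∂(ENNReal.ofReal (1 - θ) • Measure.dirac x + ENNReal.ofReal θ • Measure.dirac y) = _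
  rw [integral_add_measure ((h x).smul_measure ENNReal.ofReal_ne_top)
    ((h y).smul_measure ENNReal.ofReal_ne_top), integral_smul_measure, integral_smul_measure,
    integral_dirac, integral_dirac, ENNReal.toReal_ofReal (sub_nonneg.mpr θ.2.2),
    ENNReal.toReal_ofReal θ.2.1]
  simp

lemma ae_mix {x y : X} (θ : Icc (0 : ℝ) 1) {Y : Set X} (hY : MeasurableSet Y) (hx : x ∈ Y)
    (hy : y ∈ Y) : ∀ᵐ z ∂(mix x y θ : Measure X), z ∈ Y := by
  change (ENNReal.ofReal (1 - θ) • Measure.dirac x + ENNReal.ofReal θ • Measure.dirac y) Yᶜ = 0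
  simp [Measure.dirac_apply' _ hY.compl, hx, hy]

/-- The profile of values of an allocation along a grid. -/
def profile (D : ExtendedScreening X) {n : ℕ} (t : Fin n → ℝ) (x : X) : Fin n → ℝ :=
  fun j => D.v x (t j)

lemma integrable_profile {n : ℕ} (t : Fin n → ℝ) (a : ProbabilityMeasure X) :
    Integrable (D.profile t) (a : Measure X) :=
  Integrable.of_eval fun j => D.integrable_v a (t j)

lemma integral_profile {n : ℕ} (t : Fin n → ℝ) (a : ProbabilityMeasure X) :
    ∫ x, D.profile t x ∂(a : Measure X) = fun j => D.val a (t j) := by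
  funext j
  exact eval_integral (fun i => D.integrable_v a (t i)) j

/-- Along a finite grid, every lottery is dominated, up to `η`, by a finite lottery on the menu. -/
lemma IsFrontier.exists_convexHull {out : X} {Y : Set X} {A : Set (ProbabilityMeasure X)}
    (h : D.IsFrontier out Y A) {n : ℕ} {t : Fin n → ℝ} (ht : ∀ i, t i ∈ Icc D.lo D.hi)
    (htt : StrictMono t) (a : ProbabilityMeasure X) (i : Fin n) {η : ℝ} (hη : 0 < η) :
    ∃ g ∈ convexHull ℝ (D.profile t '' Y), D.val a (t i) - η ≤ g i ∧
      ∀ j, i < j → g j - g i ≤ D.val a (t j) - D.val a (t i) + η := by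
  set C := convexHull ℝ (D.profile t '' Y) with hC
  have hCc : Convex ℝ C := convex_convexHull _ _
  -- The profile of a covering lottery is a barycentre of menu profiles, hence in the closure of
  -- their hull. Adding the difference between `x` and that lottery, which is zero at `t i` and
  -- nonnegative later, lands in the closure of the relaxed profiles.
  have hx : ∀ x, D.profile t x ∈ closure (relaxedProfiles i C) := by
    intro x
    obtain ⟨c, hc, h1, h2, -⟩ := h.cover x (t i) (ht i)
    have hcl : (fun j => D.val c (t j)) ∈ closure C := by
      rw [← integral_profile]
      refine hCc.closure.integral_mem isClosed_closure ?_ (integrable_profile t c)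
      filter_upwards [h.ae_mem c hc] with y hy
      exact subset_closure (subset_convexHull _ _ ⟨y, hy, rfl⟩)
    have := map_mem_closure (f := fun g : Fin n → ℝ => fun j => g j + (D.v x (t j) - D.val c (t j)))
      (t := relaxedProfiles i C) (by fun_prop) hcl (fun g hg => ⟨g, hg, by
        simp only
        rw [h1]; linarith, fun j hj => by
        have := h2 (t j) (ht j) (htt hj).le
        simp only
        rw [h1]; linarith⟩)
    convert this using 1
    funext j
    simp [profile]
  -- A closed convex set contains the barycentre of `a`, so no measurable choice of covering
  -- lotteries is needed.
  have hmem : (fun j => D.val a (t j)) ∈ closure (relaxedProfiles i C) := by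
    rw [← integral_profile]
    exact (convex_relaxedProfiles i hCc).closure.integral_mem isClosed_closure
      (Filter.Eventually.of_forall hx) (integrable_profile t a)
  obtain ⟨w, ⟨g, hg, h1, h2⟩, hd⟩ := Metric.mem_closure_iff.mp hmem (η / 2) (by positivity)
  have hdj : ∀ j, |D.val a (t j) - w j| < η / 2 := fun j =>
    lt_of_le_of_lt (dist_le_pi_dist (fun j => D.val a (t j)) w j) hd
  refine ⟨g, hg, ?_, fun j hj => ?_⟩
  · have := (abs_lt.mp (hdj i))
    linarith [this.2]
  · have e1 := (abs_lt.mp (hdj i))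
    have e2 := (abs_lt.mp (hdj j))
    linarith [h2 j hj, e1.1, e1.2, e2.1, e2.2]

/-- A menu indexed by reals so that values are ordered by the index, and ratios of increments of
values are monotone in the type along steeper and steeper allocations. -/
structure IsRatioOrdered (D : ExtendedScreening X) (Y : Set X) (S : Set ℝ) (x : ℝ → X) : Prop where
  image_eq : x '' S = Y
  v_lt : ∀ s ∈ S, ∀ s' ∈ S, s < s' → ∀ t ∈ Ioo D.lo D.hi, D.v (x s) t < D.v (x s') t
  ratio : ∀ s₁ ∈ S, ∀ s₂ ∈ S, ∀ s₃ ∈ S, s₁ < s₂ → s₂ < s₃ → D.kap (x s₁) ≤ D.kap (x s₂) →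
    D.kap (x s₂) ≤ D.kap (x s₃) → ∀ t ∈ Ioo D.lo D.hi, ∀ t' ∈ Ioo D.lo D.hi, t ≤ t' →
      (D.v (x s₂) t' - D.v (x s₁) t') * (D.v (x s₃) t - D.v (x s₂) t) ≤
        (D.v (x s₂) t - D.v (x s₁) t) * (D.v (x s₃) t' - D.v (x s₂) t')

/-- The indices in `T` whose allocation is flatter than those of all larger indices. -/
def steepChain (D : ExtendedScreening X) (x : ℝ → X) (T : Finset ℝ) : Set ℝ :=
  {s | s ∈ T ∧ ∀ s' ∈ T, s < s' → D.kap (x s) < D.kap (x s')}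

lemma strictMonoOn_kap_steepChain (x : ℝ → X) (T : Finset ℝ) :
    StrictMonoOn (fun s => D.kap (x s)) (D.steepChain x T) := fun _ hs s' hs' hss =>
  hs.2 s' hs'.1 hss

/-- Among the indices at or above `s` that are no steeper, the largest one belongs to the chain.
Under `IsRatioOrdered` and `IsFrontier` it has at least the value of `s`, with smaller increments,
so indices outside the chain are dispensable. -/
lemma exists_mem_steepChain (x : ℝ → X) {T : Finset ℝ} {s : ℝ} (hs : s ∈ T) :
    ∃ s' ∈ D.steepChain x T, s ≤ s' ∧ D.kap (x s') ≤ D.kap (x s) := by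
  obtain ⟨m, hm, hmax⟩ := (T.filter fun s' => s ≤ s' ∧ D.kap (x s') ≤ D.kap (x s)).exists_max_image id
    ⟨s, Finset.mem_filter.mpr ⟨hs, le_rfl, le_rfl⟩⟩
  obtain ⟨h1, h2, h3⟩ := Finset.mem_filter.mp hm
  refine ⟨m, ⟨h1, fun s' hs' hlt => ?_⟩, h2, h3⟩
  by_contra hk
  push Not at hk
  have := hmax s' (Finset.mem_filter.mpr ⟨hs', h2.trans hlt.le, hk.trans h3⟩)
  simp only [id] at this
  linarith

/-- For `i < j` the points `(v(x s, t i), v(x s, t j))` of the chain lie on a convex curve by the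
ratio condition. The line through two neighbours thus lies below all of them, and below `g`. The
mixture of the neighbours around `g i` has the same value at `t i` and no larger value later; it
does not depend on `j`. -/
lemma IsFrontier.exists_mix {out : X} {Y : Set X} {A : Set (ProbabilityMeasure X)}
    (h : D.IsFrontier out Y A) {S : Set ℝ} {x : ℝ → X} (hx : D.IsRatioOrdered Y S x) {s₀ : ℝ}
    (hout : x s₀ = out) {T : Finset ℝ} (hT : ∀ s ∈ T, s ∈ S) (hs₀ : s₀ ∈ T) {n : ℕ} {t : Fin n → ℝ}
    (ht : ∀ i, t i ∈ Ioo D.lo D.hi) (htt : StrictMono t) (i : Fin n) {g : Fin n → ℝ}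
    (hg : g ∈ convexHull ℝ (D.profile t '' (x '' (T : Set ℝ)))) :
    ∃ a ∈ D.steepChain x T, ∃ b ∈ D.steepChain x T, a ≤ b ∧
      (∀ r ∈ D.steepChain x T, r ≤ a ∨ b ≤ r) ∧ ∃ θ : Icc (0 : ℝ) 1,
      g i ≤ D.val (mix (x a) (x b) θ) (t i) ∧ ∀ j, i < j →
        D.val (mix (x a) (x b) θ) (t j) - D.val (mix (x a) (x b) θ) (t i) ≤ g j - g i := by
  classical
  set T' := D.steepChain x T with hT'
  have hfin : T'.Finite := T.finite_toSet.subset fun s hs => hs.1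
  have hT'S : ∀ s ∈ T', s ∈ S := fun s hs => hT s hs.1
  have hxY : ∀ s ∈ S, x s ∈ Y := fun s hs => hx.image_eq ▸ ⟨s, hs, rfl⟩
  have hkout : D.kap out = 0 := by simp [kap, h.v_out]
  have hvle : ∀ s ∈ S, ∀ s' ∈ S, s ≤ s' → ∀ k, D.v (x s) (t k) ≤ D.v (x s') (t k) := by
    intro s hs s' hs' hss k
    rcases eq_or_lt_of_le hss with rfl | hlt
    · exact le_rfl
    · exact (hx.v_lt s hs s' hs' hlt _ (ht k)).le
  have hs₀' : s₀ ∈ T' := by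
    refine ⟨hs₀, fun s' hs' hlt => ?_⟩
    rw [hout, hkout]
    refine lt_of_le_of_ne (D.kap_nonneg _) fun h0 => ?_
    have : x s' = out := h.injOn (hxY s' (hT s' hs')) h.out_mem (by rw [hkout, h0])
    have h1 := hx.v_lt s₀ (hT _ hs₀) s' (hT _ hs') hlt (t i) (ht i)
    rw [hout, this] at h1
    exact lt_irrefl _ h1
  have hs₀min : ∀ s ∈ T', s₀ ≤ s := by
    intro s hs
    by_contra hlt
    push Not at hlt
    have := hs.2 s₀ hs₀ hlt
    rw [hout, hkout] at this
    exact absurd this (not_lt.mpr (D.kap_nonneg _))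
  have hval : ∀ a b θ r, D.val (mix (x a) (x b) θ) r = (1 - (θ : ℝ)) * D.v (x a) r + θ * D.v (x b) r :=
    fun a b θ r => integral_mix _ _ _ _
  have hdom : ∀ s ∈ T, ∃ s' ∈ T', ∀ j, D.v (x s) (t j) ≤ D.v (x s') (t j) ∧ ∀ k, j < k →
      D.v (x s') (t k) - D.v (x s') (t j) ≤ D.v (x s) (t k) - D.v (x s) (t j) := by
    intro s hs
    obtain ⟨s', hs', hss, hk⟩ := D.exists_mem_steepChain x hs
    refine ⟨s', hs', fun j => ⟨hvle s (hT s hs) s' (hT'S s' hs') hss j, fun k hjk => ?_⟩⟩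
    have := h.incr (x s') (hxY _ (hT'S s' hs')) (x s) (hxY _ (hT s hs)) hk (htt hjk).le
    simp only at this
    linarith
  -- it suffices to check affine inequalities on the generating allocations
  have haff : ∀ (j k : Fin n) (α β γ : ℝ), (∀ s ∈ T, α * D.v (x s) (t j) + β * D.v (x s) (t k) ≤ γ) →
      α * g j + β * g k ≤ γ := by
    intro j k α β γ hle
    have hconv : Convex ℝ {w : Fin n → ℝ | α * w j + β * w k ≤ γ} :=
      convex_halfSpace_le (𝕜 := ℝ) (f := fun w : Fin n → ℝ => α * w j + β * w k)
        ⟨fun w w' => by simp only [Pi.add_apply]; ring,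
          fun r w => by simp only [Pi.smul_apply, smul_eq_mul]; ring⟩ γ
    refine convexHull_min ?_ hconv hg
    rintro _ ⟨_, ⟨s, hs, rfl⟩, rfl⟩
    exact hle s hs
  have hgmono : ∀ j, i < j → g i ≤ g j := fun j hj => by
    have := haff i j 1 (-1) 0 fun s _ => by
      have := D.monotone_v (x s) (htt hj).le
      linarith
    linarith
  have hne : ({σ ∈ T' | g i ≤ D.v (x σ) (t i)}).Nonempty := by
    obtain ⟨m, hm, hmax⟩ := Set.exists_max_image T' id hfin ⟨s₀, hs₀'⟩
    refine ⟨m, hm, ?_⟩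
    have := haff i i 1 0 (D.v (x m) (t i)) fun s hs => by
      obtain ⟨s', hs', hd⟩ := hdom s hs
      have e1 := (hd i).1
      have e2 := hvle s' (hT'S s' hs') m (hT'S m hm) (hmax s' hs') i
      linarith
    linarith
  -- `b` is the first chain index whose value at `t i` reaches `g i`. If it is that of the outside
  -- option, the outside option itself works, since its increments vanish.
  obtain ⟨b, ⟨hb, hbg⟩, hbmin⟩ := Set.exists_min_image _ id (hfin.subset (sep_subset _ _)) hne
  rcases eq_or_lt_of_le (hs₀min b hb) with rfl | hlt
  · refine ⟨s₀, hs₀', s₀, hs₀', le_rfl, fun r _ => le_total r s₀, ⟨0, by simp⟩, ?_, fun j hj => ?_⟩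
    · rw [hval]; simpa using hbg
    · rw [hval, hval]
      simpa [hout, h.v_out] using hgmono j hj
  · obtain ⟨a, ⟨ha, hab⟩, hamax⟩ := Set.exists_max_image {σ ∈ T' | σ < b} id
      (hfin.subset (sep_subset _ _)) ⟨s₀, hs₀', hlt⟩
    have hab' : a < b := hab
    have hadj : ∀ r ∈ T', r ≤ a ∨ b ≤ r := fun r hr => by
      by_cases hrb : r < b
      · exact Or.inl (hamax r ⟨hr, hrb⟩)
      · exact Or.inr (not_lt.mp hrb)
    have hag : D.v (x a) (t i) < g i := by
      by_contra hcon
      have := hbmin a ⟨ha, not_lt.mp hcon⟩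
      simp only [id] at this
      linarith
    have hd : ∀ k, 0 < D.v (x b) (t k) - D.v (x a) (t k) := fun k =>
      sub_pos.mpr (hx.v_lt a (hT'S a ha) b (hT'S b hb) hab' _ (ht k))
    have hmono := strictMonoOn_kap_steepChain (D := D) x T
    have hkab : D.kap (x a) ≤ D.kap (x b) := (hmono ha hb hab').le
    -- The weight at which the mixture has value exactly `g i` at `t i`.
    set θ : ℝ := (g i - D.v (x a) (t i)) / (D.v (x b) (t i) - D.v (x a) (t i)) with hθ
    have hθmem : θ ∈ Icc (0 : ℝ) 1 := ⟨div_nonneg (by linarith) (hd i).le,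
      (div_le_one (hd i)).mpr (by linarith)⟩
    have hθi : θ * (D.v (x b) (t i) - D.v (x a) (t i)) = g i - D.v (x a) (t i) :=
      div_mul_cancel₀ _ (hd i).ne'
    refine ⟨a, ha, b, hb, hab'.le, hadj, ⟨θ, hθmem⟩, ?_, fun j hj => ?_⟩
    · rw [hval]; simp only; linarith
    · rw [hval, hval]
      simp only
      set R : ℝ := (D.v (x b) (t j) - D.v (x a) (t j)) / (D.v (x b) (t i) - D.v (x a) (t i)) with hR
      have hRi : R * (D.v (x b) (t i) - D.v (x a) (t i)) = D.v (x b) (t j) - D.v (x a) (t j) :=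
        div_mul_cancel₀ _ (hd i).ne'
      have hR1 : 1 ≤ R := by
        rw [hR, one_le_div (hd i)]
        have := h.incr (x a) (hxY _ (hT'S a ha)) (x b) (hxY _ (hT'S b hb)) hkab (htt hj).le
        exact this
      -- Chain points lie above the line of slope `R` through the points of `a` and `b`.
      have hline : ∀ s ∈ T', D.v (x a) (t j) + R * (D.v (x s) (t i) - D.v (x a) (t i)) ≤
          D.v (x s) (t j) := by
        intro s hs
        rcases hadj s hs with hsa | hbs
        · rcases eq_or_lt_of_le hsa with rfl | hsa
          · simp
          · have := hx.ratio s (hT'S s hs) a (hT'S a ha) b (hT'S b hb) hsa hab'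
              (hmono hs ha hsa).le hkab (t i) (ht i) (t j) (ht j) (htt hj).le
            rw [← hRi] at this
            have h2 := hd i
            by_contra hcon
            push Not at hcon
            have h3 := mul_lt_mul_of_pos_right hcon h2
            linarith
        · rcases eq_or_lt_of_le hbs with rfl | hbs
          · linarith
          · have := hx.ratio a (hT'S a ha) b (hT'S b hb) s (hT'S s hs) hab' hbs hkab
              (hmono hb hs hbs).le (t i) (ht i) (t j) (ht j) (htt hj).le
            have h2 := hd i
            rw [← hRi] at this
            by_contra hcon
            push Not at hcon
            have h3 : R * (D.v (x s) (t i) - D.v (x b) (t i)) > D.v (x s) (t j) - D.v (x b) (t j) := by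
              linarith
            have h4 := mul_lt_mul_of_pos_right h3 h2
            linarith
      -- The inequality passes from the chain to all of `T`: with `R ≥ 1`, moving to the dominating
      -- chain member raises the value at `t i` and lowers the increment, hence lowers `v (t j) - R
      -- * v (t i)`. Being affine, it passes to the convex hull.
      have hgj := haff i j R (-1) (R * D.v (x a) (t i) - D.v (x a) (t j)) fun s hs => by
        obtain ⟨s', hs', hdd⟩ := hdom s hs
        have e1 := hline s' hs'
        have e2 := (hdd i).1
        have e3 := (hdd i).2 j hj
        have e4 := mul_nonneg (sub_nonneg.mpr hR1) (sub_nonneg.mpr e2)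
        linarith
      have e5 : θ * (D.v (x b) (t j) - D.v (x a) (t j)) = R * (g i - D.v (x a) (t i)) := by
        rw [← hRi, ← hθi]; ring
      linarith

lemma steeperLE_mix {out : X} {Y : Set X} {A : Set (ProbabilityMeasure X)}
    (h : D.IsFrontier out Y A) {x : ℝ → X} {T : Finset ℝ} (hxY : ∀ s ∈ T, x s ∈ Y)
    {a b a' b' : ℝ} {θ θ' : Icc (0 : ℝ) 1} (ha : a ∈ D.steepChain x T) (hb : b ∈ D.steepChain x T)
    (ha' : a' ∈ D.steepChain x T) (hb' : b' ∈ D.steepChain x T) (hab : a ≤ b) (hab' : a' ≤ b')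
    (hadj : ∀ r ∈ D.steepChain x T, r ≤ a ∨ b ≤ r)
    (hadj' : ∀ r ∈ D.steepChain x T, r ≤ a' ∨ b' ≤ r)
    (hk : D.kapL (mix (x a) (x b) θ) ≤ D.kapL (mix (x a') (x b') θ')) :
    D.SteeperLE (mix (x a) (x b) θ) (mix (x a') (x b') θ') := by
  have hmono := strictMonoOn_kap_steepChain (D := D) x T
  rw [kapL, kapL, integral_mix, integral_mix] at hk
  have key : ∀ g : X → ℝ, MonotoneOn (fun s => g (x s)) (D.steepChain x T) →
      ∫ z, g z ∂(mix (x a) (x b) θ : Measure X) ≤ ∫ z, g z ∂(mix (x a') (x b') θ' : Measure X) := by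
    intro g hg
    rw [integral_mix, integral_mix]
    exact mix_le_mix hmono hg ha hb ha' hb' hab hab' hadj hadj' θ.2 θ'.2 hk
  refine ⟨fun s t hst => ?_, fun g hg => key _ fun s hs s' hs' hss =>
    hg (hmono.monotoneOn hs hs' hss)⟩
  rw [D.val_sub, D.val_sub]
  refine key _ fun s hs s' hs' hss => ?_
  have := h.incr (x s) (hxY s hs.1) (x s') (hxY s' hs'.1) (hmono.monotoneOn hs hs' hss) hst
  simp only at this ⊢
  linarith

/-- Along a finite grid, arbitrary lotteries are dominated, up to `η`, by a chain of lotteries on a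
ratio-ordered menu. -/
theorem IsFrontier.exists_chain {out : X} {Y : Set X} {A : Set (ProbabilityMeasure X)}
    (h : D.IsFrontier out Y A) {S : Set ℝ} {x : ℝ → X} (hx : D.IsRatioOrdered Y S x) {n : ℕ}
    {t : Fin n → ℝ} (ht : ∀ i, t i ∈ Ioo D.lo D.hi) (htt : StrictMono t)
    (a : Fin n → ProbabilityMeasure X) {η : ℝ} (hη : 0 < η) :
    ∃ c : Fin n → ProbabilityMeasure X, (∀ i, ∀ᵐ y ∂(c i : Measure X), y ∈ Y) ∧
      (∀ i j, D.kapL (c i) ≤ D.kapL (c j) → D.SteeperLE (c i) (c j)) ∧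
      (∀ i, D.val (a i) (t i) - η ≤ D.val (c i) (t i)) ∧
      ∀ i j, i < j → D.val (c i) (t j) - D.val (c i) (t i) ≤
        D.val (a i) (t j) - D.val (a i) (t i) + η := by
  classical
  choose g hg hg1 hg2 using fun i =>
    h.exists_convexHull (fun i => Ioo_subset_Icc_self (ht i)) htt (a i) i hη
  have hfinite : ∀ i, ∃ T : Finset ℝ, (T : Set ℝ) ⊆ S ∧
      g i ∈ convexHull ℝ (D.profile t '' (x '' (T : Set ℝ))) := by
    intro i
    have h1 := hg i
    rw [convexHull_eq_union_convexHull_finite_subsets] at h1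
    simp only [mem_iUnion] at h1
    obtain ⟨F, hF, hgF⟩ := h1
    rw [← hx.image_eq, image_image] at hF
    obtain ⟨T, hTS, rfl⟩ := Finset.subset_set_image_iff.mp hF
    refine ⟨T, hTS, ?_⟩
    rw [image_image]
    simpa using hgF
  choose T hTS hgT using hfinite
  obtain ⟨s₀, hs₀, hout⟩ : out ∈ x '' S := hx.image_eq ▸ h.out_mem
  -- All grid points share one finite index set, hence one chain; otherwise the mixtures at
  -- different grid points could not be compared.
  set U : Finset ℝ := insert s₀ (Finset.univ.biUnion T) with hU
  have hUS : ∀ s ∈ U, s ∈ S := by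
    intro s hs
    rcases Finset.mem_insert.mp hs with rfl | hs
    · exact hs₀
    · obtain ⟨i, -, hi⟩ := Finset.mem_biUnion.mp hs
      exact hTS i hi
  have hgU : ∀ i, g i ∈ convexHull ℝ (D.profile t '' (x '' (U : Set ℝ))) := fun i =>
    convexHull_mono (image_mono (image_mono fun s hs => Finset.mem_insert_of_mem
      (Finset.mem_biUnion.mpr ⟨i, Finset.mem_univ _, hs⟩))) (hgT i)
  have hUY : ∀ s ∈ U, x s ∈ Y := fun s hs => hx.image_eq ▸ ⟨s, hUS s hs, rfl⟩
  choose α hα β hβ hαβ hadj θ h1 h2 using fun i =>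
    h.exists_mix hx hout hUS (Finset.mem_insert_self _ _) ht htt i (hgU i)
  refine ⟨fun i => mix (x (α i)) (x (β i)) (θ i), fun i => ae_mix _ h.measurableSet
    (hUY _ (hα i).1) (hUY _ (hβ i).1), fun i j hk => steeperLE_mix h hUY (hα i) (hβ i) (hα j) (hβ j)
    (hαβ i) (hαβ j) (hadj i) (hadj j) hk, fun i => (hg1 i).trans (h1 i),
    fun i j hij => (h2 i j hij).trans (hg2 i j hij)⟩

end

end ExtendedScreening

/-! ### Incremental elasticities and stochastic mechanisms -/

namespace ScreeningModel

noncomputable section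

set_option linter.unusedSectionVars false

section Elasticity

variable {X : Type*} [MetricSpace X] (M : ScreeningModel X)

lemma F_mem_Ioo {t : ℝ} (ht : t ∈ Ioo M.tlo M.thi) : M.F t ∈ Ioo (0 : ℝ) 1 := by
  have hl : M.tlo ∈ M.types := left_mem_Icc.mpr M.tlo_lt_thi.le
  have hh : M.thi ∈ M.types := right_mem_Icc.mpr M.tlo_lt_thi.le
  have h1 := M.strictMonoOn_F hl (Ioo_subset_Icc_self ht) ht.1
  have h2 := M.strictMonoOn_F (Ioo_subset_Icc_self ht) hh ht.2
  rw [M.F_tlo] at h1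
  rw [M.F_thi] at h2
  exact ⟨h1, h2⟩

lemma hasDerivAt_F {t : ℝ} (ht : t ∈ Ioo M.tlo M.thi) : HasDerivAt M.F (M.f t) t :=
  (M.hasDeriv_F t (Ioo_subset_Icc_self ht)).hasDerivAt (Icc_mem_nhds ht.1 ht.2)

lemma hasDerivAt_v (x : X) {t : ℝ} (ht : t ∈ Ioo M.tlo M.thi) :
    HasDerivAt (M.v x) (M.vt x t) t :=
  (M.hasDeriv_v x t (Ioo_subset_Icc_self ht)).hasDerivAt (Icc_mem_nhds ht.1 ht.2)

/-- Inverse function theorem; continuity of the inverse comes from its monotonicity and from its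
image being a neighbourhood. -/
lemma hasDerivAt_quantile {t : ℝ} (ht : t ∈ Ioo M.tlo M.thi) :
    HasDerivAt M.quantile (M.f t)⁻¹ (M.F t) := by
  have hu := M.F_mem_Ioo ht
  have hq := M.quantile_F (Ioo_subset_Icc_self ht)
  have hinv : ∀ u ∈ Icc (0 : ℝ) 1, M.F (M.quantile u) = u ∧ M.quantile u ∈ M.types := by
    intro u hu
    obtain ⟨s, hs, rfl⟩ := M.exists_F_eq hu
    rw [M.quantile_F hs]
    exact ⟨rfl, hs⟩
  have hmono : MonotoneOn M.quantile (Ioo (0 : ℝ) 1) := by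
    intro u hu w hw huw
    have e1 := hinv u (Ioo_subset_Icc_self hu)
    have e2 := hinv w (Ioo_subset_Icc_self hw)
    rw [← M.strictMonoOn_F.le_iff_le e1.2 e2.2, e1.1, e2.1]
    exact huw
  have hcont : ContinuousAt M.quantile (M.F t) := by
    refine continuousAt_of_monotoneOn_of_image_mem_nhds hmono (Ioo_mem_nhds hu.1 hu.2) ?_
    rw [hq]
    refine Filter.mem_of_superset (Ioo_mem_nhds ht.1 ht.2) fun s hs =>
      ⟨M.F s, M.F_mem_Ioo hs, M.quantile_F (Ioo_subset_Icc_self hs)⟩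
  refine HasDerivAt.of_local_left_inverse (f := M.F) hcont (by rw [hq]; exact M.hasDerivAt_F ht)
    (M.f_pos t (Ioo_subset_Icc_self ht)).ne' ?_
  filter_upwards [Ioo_mem_nhds hu.1 hu.2] with u hu'
  exact (hinv u (Ioo_subset_Icc_self hu')).1

lemma hasDerivAt_demand (x : X) {t : ℝ} (ht : t ∈ Ioo M.tlo M.thi) :
    HasDerivAt (M.demand x) (-(M.vt x t / M.f t)) (1 - M.F t) := by
  have hq := M.quantile_F (Ioo_subset_Icc_self ht)
  have h1 : HasDerivAt (fun r : ℝ => 1 - r) (-1) (1 - M.F t) := by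
    simpa using (hasDerivAt_id (1 - M.F t)).const_sub 1
  have h2 : HasDerivAt (fun r => M.quantile (1 - r)) ((M.f t)⁻¹ * -1) (1 - M.F t) :=
    HasDerivAt.comp (1 - M.F t) (h₂ := M.quantile) (by rw [sub_sub_cancel]; exact M.hasDerivAt_quantile ht) h1
  have h3 := HasDerivAt.comp (1 - M.F t) (h₂ := M.v x) (h := fun r => M.quantile (1 - r))
    (by rw [sub_sub_cancel, hq]; exact M.hasDerivAt_v x ht) h2
  refine h3.congr_deriv ?_
  rw [div_eq_mul_inv]; ring

/-- The substitution `q = 1 - F t` turns the elasticity into the inverse of a logarithmic derivative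
in the type, times a hazard factor `(1 - F t) / f t` that is common to all pairs of allocations. -/
lemma incrElasticity_eq {x x' : X} {t : ℝ} (ht : t ∈ Ioo M.tlo M.thi)
    (hlt : M.v x t < M.v x' t) : M.incrElasticity x' x (1 - M.F t) =
      (ENNReal.ofReal ((1 - M.F t) / M.f t *
        (|M.vt x' t - M.vt x t| / (M.v x' t - M.v x t))))⁻¹ := by
  have hpos : 0 < M.v x' t - M.v x t := sub_pos.mpr hlt
  have hf := M.f_pos t (Ioo_subset_Icc_self ht)
  have hF := M.F_mem_Ioo ht
  have hd : ∀ z, M.demand z (1 - M.F t) = M.v z t := fun z =>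
    M.demand_one_sub_F z (Ioo_subset_Icc_self ht)
  have h1 := ((M.hasDerivAt_demand x' ht).sub (M.hasDerivAt_demand x ht)).log (by
    simp only [Pi.sub_apply, hd]; exact hpos.ne')
  have h2 : deriv (fun r => Real.log (M.demand x' r - M.demand x r)) (1 - M.F t) = _ := h1.deriv
  rw [incrElasticity, h2, Pi.sub_apply, hd, hd]
  congr 2
  rw [show -(M.vt x' t / M.f t) - -(M.vt x t / M.f t) = -((M.vt x' t - M.vt x t) / M.f t) by ring,
    abs_mul, abs_div, abs_neg, abs_div, abs_of_pos hpos, abs_of_pos hf,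
    abs_of_pos (show 0 < 1 - M.F t by linarith [hF.2])]
  ring

end Elasticity

section Stochastic

variable {X : Type*} [MetricSpace X] [CompactSpace X] [MeasurableSpace X] [BorelSpace X]
  {M : ScreeningModel X}

/-- Ordered incremental elasticities make ratios of increments of values monotone in the type. -/
lemma SurplusOrderedIncrElasticity.exists_isRatioOrdered {Y : Set X}
    {A : Set (ProbabilityMeasure X)} (h : M.extend.IsFrontier M.out Y A)
    (hel : M.SurplusOrderedIncrElasticity Y) : ∃ S x, M.extend.IsRatioOrdered Y S x := by
  obtain ⟨S, x, him, hlt, hratio⟩ := hel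
  have hxY : ∀ s ∈ S, x s ∈ Y := fun s hs => him ▸ ⟨s, hs, rfl⟩
  have hv : ∀ t ∈ Ioo M.tlo M.thi, ∀ x, M.extend.v x t = M.v x t := fun t ht x =>
    M.extend_v x (Ioo_subset_Icc_self ht)
  have hvt : ∀ t ∈ Ioo M.tlo M.thi, ∀ x, M.extend.vt x t = M.vt x t := fun t ht x =>
    congrArg (M.vt x) (M.clamp_of_mem (Ioo_subset_Icc_self ht))
  have hvlt : ∀ s ∈ S, ∀ s' ∈ S, s < s' → ∀ t ∈ Ioo M.tlo M.thi, M.v (x s) t < M.v (x s') t := by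
    intro s hs s' hs' hss t ht
    have hF := M.F_mem_Ioo ht
    have := (hlt s hs s' hs' hss).2 (1 - M.F t) ⟨by linarith [hF.2], by linarith [hF.1]⟩
    rwa [M.demand_one_sub_F _ (Ioo_subset_Icc_self ht),
      M.demand_one_sub_F _ (Ioo_subset_Icc_self ht)] at this
  refine ⟨S, x, him, fun s hs s' hs' hss t ht => ?_, ?_⟩
  · rw [hv t ht, hv t ht]
    exact hvlt s hs s' hs' hss t ht
  intro s₁ h₁ s₂ h₂ s₃ h₃ h12 h23 hk12 hk23 t ht t' ht' htt
  have hp : ∀ r ∈ Ioo M.tlo M.thi, 0 < M.v (x s₂) r - M.v (x s₁) r := fun r hr =>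
    sub_pos.mpr (hvlt s₁ h₁ s₂ h₂ h12 r hr)
  have hp' : ∀ r ∈ Ioo M.tlo M.thi, 0 < M.v (x s₃) r - M.v (x s₂) r := fun r hr =>
    sub_pos.mpr (hvlt s₂ h₂ s₃ h₃ h23 r hr)
  -- The hazard factor cancels, and a larger elasticity means a smaller logarithmic derivative. The
  -- absolute values can be removed because slopes are ordered along triples of increasing
  -- steepness, the only triples in `IsRatioOrdered`.
  have hlog : ∀ r ∈ Ioo M.tlo M.thi,
      (M.vt (x s₂) r - M.vt (x s₁) r) * (M.v (x s₃) r - M.v (x s₂) r) ≤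
        (M.vt (x s₃) r - M.vt (x s₂) r) * (M.v (x s₂) r - M.v (x s₁) r) := by
    intro r hr
    have hF := M.F_mem_Ioo hr
    have hf := M.f_pos r (Ioo_subset_Icc_self hr)
    have h4 := hratio s₁ h₁ s₂ h₂ s₃ h₃ h12 h23 (1 - M.F r) ⟨by linarith [hF.2], by linarith [hF.1]⟩
    rw [M.incrElasticity_eq hr (hvlt s₂ h₂ s₃ h₃ h23 r hr),
      M.incrElasticity_eq hr (hvlt s₁ h₁ s₂ h₂ h12 r hr), ENNReal.inv_lt_inv,
      ENNReal.ofReal_lt_ofReal_iff'] at h4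
    have h5 := lt_of_mul_lt_mul_left h4.1 (div_nonneg (by linarith [hF.2]) hf.le)
    have e1 := h.vt_le (hxY s₁ h₁) (hxY s₂ h₂) hk12 (Ioo_subset_Icc_self hr)
    have e2 := h.vt_le (hxY s₂ h₂) (hxY s₃ h₃) hk23 (Ioo_subset_Icc_self hr)
    rw [hvt r hr, hvt r hr] at e1 e2
    rw [abs_of_nonneg (sub_nonneg.mpr e1), abs_of_nonneg (sub_nonneg.mpr e2),
      div_lt_div_iff₀ (hp r hr) (hp' r hr)] at h5
    exact h5.le
  have hmono : MonotoneOn (fun r => (M.v (x s₃) r - M.v (x s₂) r) / (M.v (x s₂) r - M.v (x s₁) r))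
      (Ioo M.tlo M.thi) := by
    have hder : ∀ r ∈ Ioo M.tlo M.thi, HasDerivAt
        (fun r => (M.v (x s₃) r - M.v (x s₂) r) / (M.v (x s₂) r - M.v (x s₁) r))
        (((M.vt (x s₃) r - M.vt (x s₂) r) * (M.v (x s₂) r - M.v (x s₁) r) -
          (M.v (x s₃) r - M.v (x s₂) r) * (M.vt (x s₂) r - M.vt (x s₁) r)) /
          (M.v (x s₂) r - M.v (x s₁) r) ^ 2) r := fun r hr =>
      ((M.hasDerivAt_v _ hr).sub (M.hasDerivAt_v _ hr)).div
        ((M.hasDerivAt_v _ hr).sub (M.hasDerivAt_v _ hr)) (hp r hr).ne'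
    refine monotoneOn_of_deriv_nonneg (convex_Ioo _ _)
      (fun r hr => (hder r hr).continuousAt.continuousWithinAt)
      (fun r hr => (hder r (interior_subset hr)).differentiableAt.differentiableWithinAt) ?_
    intro r hr
    rw [(hder r (interior_subset hr)).deriv]
    have := hlog r (interior_subset hr)
    exact div_nonneg (by linarith) (sq_nonneg _)
  have h6 := hmono ht ht' htt
  simp only at h6
  rw [div_le_div_iff₀ (hp t ht) (hp t' ht')] at h6
  rw [hv t ht, hv t ht, hv t ht, hv t' ht', hv t' ht', hv t' ht']
  linarith

/-- Stochastic mechanisms are dominated by monotone rules with values in the lotteries on a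
ratio-ordered menu. -/
lemma IsStochasticMechanism.exists_monotone_rule {Y : Set X} {A : Set (ProbabilityMeasure X)}
    (h : M.extend.IsFrontier M.out Y A) {S : Set ℝ} {x : ℝ → X}
    (hx : M.extend.IsRatioOrdered Y S x) {a : ℝ → ProbabilityMeasure X} {p : ℝ → ℝ}
    (hm : M.IsStochasticMechanism a p) {ε : ℝ} (hε : 0 < ε) :
    ∃ b : ℝ → ProbabilityMeasure X, (∀ s, ∀ᵐ y ∂(b s : Measure X), y ∈ Y) ∧
      (∀ s s', s ≤ s' → M.extend.SteeperLE (b s) (b s')) ∧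
      M.stochasticObjective a p - ε ≤ M.extend.virtual (fun _ => 0) b := by
  set D := M.extend with hD
  have hcm : Measurable fun t : ℝ => (⟨M.clamp t, M.clamp_mem t⟩ : M.types) :=
    M.continuous_clamp.measurable.subtype_mk
  have ha : ∀ t ∈ M.types, a (M.clamp t) = a t := fun t ht => congrArg a (M.clamp_of_mem ht)
  have hval : ∀ t ∈ M.types, ∀ c, D.val c t = M.lotteryValue c t := fun t ht c =>
    integral_congr_ae (Filter.Eventually.of_forall fun y => M.extend_v y ht)
  -- The mechanism is a Markov kernel, so the value of a type's own lottery is measurable in the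
  -- type.
  let K : ProbabilityTheory.Kernel ℝ X :=
    ⟨fun t => (a (M.clamp t) : Measure X), hm.measurable_a.comp hcm⟩
  have hK : ProbabilityTheory.IsMarkovKernel K := ⟨fun t => (a (M.clamp t)).2⟩
  have hwm : Measurable fun t => D.val (a (M.clamp t)) t := by
    have hc : StronglyMeasurable (Function.uncurry fun (t : ℝ) (y : X) => D.v y t) :=
      (D.continuous_v.comp continuous_swap).stronglyMeasurable
    exact (hc.integral_kernel_prod_right (κ := K)).measurable
  obtain ⟨b, hbS, hb, hbv⟩ := ExtendedScreening.exists_monotone_rule_of_ic (D := D)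
    (S := {c | ∀ᵐ y ∂(c : Measure X), y ∈ Y})
    (w := fun s t => D.val (a (M.clamp s)) t) (p := p) (fun s t => D.abs_val_le _ _)
    (fun r s t => D.lipschitz_val _ _ _) hwm
    (fun t ht s hs => by
      rw [ha t ht, ha s hs, hval t ht, hval t ht]
      exact hm.ic t ht s hs)
    (fun t ht => by
      rw [ha t ht, hval t ht]
      exact hm.ir t ht)
    (fun n t ht htt η hη => by
      obtain ⟨c, h1, h2, h3, h4⟩ := h.exists_chain hx (t := fun i : Fin n => t i)
        (fun i => ht i i.2) (fun i j hij => htt i j hij j.2) (fun i => a (M.clamp (t i))) hη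
      refine ⟨fun i => if hi : i < n then c ⟨i, hi⟩ else pure M.out, fun i hi => ?_,
        fun i hi j hj => ?_, fun i hi => ?_, fun i j hij hj => ?_⟩
      · simp only [dif_pos hi]
        exact h1 ⟨i, hi⟩
      · simpa only [dif_pos hi, dif_pos hj] using h2 ⟨i, hi⟩ ⟨j, hj⟩
      · simpa only [dif_pos hi] using h3 ⟨i, hi⟩
      · simpa only [dif_pos (hij.trans hj)] using h4 ⟨i, hij.trans hj⟩ ⟨j, hj⟩ hij) hε
  refine ⟨b, hbS, hb, le_trans (le_of_eq ?_) hbv⟩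
  rw [stochasticObjective, objective_integral_eq (w := fun t => M.lotteryValue (a t) t)]
  congr 1
  refine intervalIntegral.integral_congr fun t ht => ?_
  rw [uIcc_of_le D.lo_lt_hi.le] at ht
  rw [ha t ht, hval t ht]

end Stochastic

end

end ScreeningModel

/-! ### Conclusion -/

theorem theorem3 {X : Type*} [MetricSpace X] [CompactSpace X] [MeasurableSpace X] [BorelSpace X]
    (M : ScreeningModel X) (Y : Set X) (hY : M.IsGeneralizedFrontier Y) :
    M.IsOptimalMenu (insert M.out Y) ∧
      (M.SurplusOrderedIncrElasticity (insert M.out Y) →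
        M.IsStochasticallyOptimalMenu (insert M.out Y)) := by
  obtain ⟨A, hA⟩ := ScreeningModel.IsGeneralizedFrontier.exists_isFrontier M hY
  obtain ⟨y, hym, hyY, hyk, hymax⟩ := hA.exists_optimal_rule
  obtain ⟨p, hp, hobj⟩ := ScreeningModel.exists_mechanism hA hym hyY hyk
  refine ⟨⟨y, p, hp, fun t _ => hyY t, fun x' p' hm => ?_⟩,
    fun hel => ⟨y, p, hp, fun t _ => hyY t, fun a p' hm => ?_⟩⟩
  · refine le_of_forall_pos_le_add fun ε hε => ?_
    obtain ⟨b, hbA, hb, hbv⟩ := hm.exists_monotone_rule hA hε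
    linarith [hymax b hbA hb]
  · obtain ⟨S, x, hx⟩ := hel.exists_isRatioOrdered hA
    refine le_of_forall_pos_le_add fun ε hε => ?_
    obtain ⟨b, hbY, hb, hbv⟩ := hm.exists_monotone_rule hA hx hε
    -- The rule `b` takes values in lotteries on the menu that need not belong to `A`. A quantile
    -- makes it deterministic, and covering that quantile leads back to `A`, where the maximality of
    -- `y` applies.
    obtain ⟨z, k, hzm, hzY, hk, hzk, hz⟩ := M.extend.exists_deterministic_rule hA.measurableSet
      ⟨_, hA.out_mem⟩ hA.injOn hbY hb (ρ := fun _ => 0) continuous_const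
    simp only [integral_zero, sub_zero] at hz
    have h1 := hA.integral_le_of_virtual_le hzm hzY hk hzk (ρ := fun _ => 0) (σ := fun _ => 0)
      monotone_const (C := 0) (fun _ => by simp) (fun _ _ _ _ => le_rfl) hymax
    simp only [sub_zero] at h1
    linarith
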